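/- Let $0<q<1$, $\mathbb A=\{z\in\mathbb C: q<|z|<1\}$, with boundary circles $B_1=\{|z|=1\}$ and $B_q=\{|z|=q\}$, $B=B_1\cup B_q$. Let $\mu_1,\mu_q$ be the multiples of arclength measure on $B_1,B_q$ with total mass $2\pi$, and $\mu=\mu_1+\mu_q$. A (multivalued) analytic function $f$ on $\mathbb A$ has index $\alpha\in[0,1)$ if its lift $F(r,t)=f(re^{it})$ to the universal cover $\{(r,t):q<r<1,\ t\in\mathbb R\}$ is analytic (in $\log r+it$), not identically zero, and satisfies $F(r,t+2\pi)=e^{2\pi i\alpha}F(r,t)$ (so $|f|$ is single valued). Let $H^2_\alpha$ be the space consisting of $0$ and of those $f$ of index $\alpha$ that have boundary values in $L^2(B)=L^2(B,\mu)$ (in the sense of $L^2$-convergence of $F(r,\cdot)$ on $(0,2\pi]$ as $r\to1$ and as $r\to q$); it is identified with the closed subspace of $L^2(B)$ formed by these boundary values, read through the branch $0<t\le2\pi$. Let $P_\alpha$ be the orthogonal projection of $L^2(B)$ onto $H^2_\alpha$, and for real-valued $\phi\in L^\infty(B)$ let $T^\alpha_\phi f=P_\alpha(\phi f)$ for $f\in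 H^2_\alpha$. Let $A(\mathbb A)$ be the algebra of continuous functions on $\overline{\mathbb A}$ that are analytic in $\mathbb A$; $g\in H^2_\alpha$ is outer if $\{ag: a\in A(\mathbb A)\}$ is dense in $H^2_\alpha$. Write $\chi(z)=z$. Theorem. Let $\phi\in L^\infty(B)$ be real-valued and not almost everywhere zero. (1) If $\alpha\in[0,1)$, $g\in H^2_\alpha$ is nonzero and $T^\alpha_\phi g=0$, then $g$ is outer and there is a nonzero $c\in\mathbb R$ with $$\phi|g|^2=c\,\log\bigl|\chi q^{-1/2}\bigr|\quad\text{a.e. on }B.\qquad(*)$$ (2) Conversely, if $\alpha\in[0,1)$ and $g\in H^2_\alpha$ is an outer function satisfying $(*)$ for some $c\in\mathbb R$, then $T^\alpha_\phi g=0$, where $\alpha$ is necessarily the index of $g$. Moreover $\log|\phi|$ is then integrable on $B_1$ and on $B_q$, and $\alpha$ is congruent modulo $1$ to $$\frac{1}{4\pi\log q}\left(\int_{B_1}\log|\phi|\,d\mu_1-\int_{B_q}\log|\phi|\,d\mu_q\right).$$ (3) There is at most one $\alpha\in[0,1)$ such that $T^\alpha_\phi$ has eigenvalue $0$, and for every $\alpha\in[0,1)$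 the kernel of $T^\alpha_\phi$ has dimension at most one. -/

import Mathlib

open MeasureTheory Set Filter Topology
open scoped ENNReal

noncomputable section

namespace SarasonAnnulus

/-- Lebesgue measure on the interval `(0, 2π]` of angles. -/
def angleMeasure : Measure ℝ := volume.restrict (Ioc 0 (2 * Real.pi))

/-- Arclength on the circle `|z| = r` (as a measure on `ℂ`), scaled to total mass `2π`:
the image of `dt` on `(0, 2π]` under `t ↦ r e^{it}`. -/
def circleMeasure (r : ℝ) : Measure ℂ := angleMeasure.map (circleMap 0 r)

/-- The measure `μ = μ₁ + μ_q` on the boundary of the annulus `q < |z| < 1`. -/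
def boundaryMeasure (q : ℝ) : Measure ℂ := circleMeasure 1 + circleMeasure q

/-- The Hilbert space `L²(B)` of the boundary `B = {|z| = 1} ∪ {|z| = q}`. -/
abbrev BoundaryL2 (q : ℝ) := Lp ℂ 2 (boundaryMeasure q)

/-- The universal cover of the annulus `q < |z| < 1`: the strip of the `w = log r + i t` with
`q < r < 1`, `t ∈ ℝ`, with covering map `w ↦ exp w = r e^{it}`. -/
def coverStrip (q : ℝ) : Set ℂ := {w | Real.log q < w.re ∧ w.re < 0}

/-- `F(r, t + 2π) = e^{2πiα} F(r, t)` on the universal cover; in particular `|F|` is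
`2π`-periodic in `t`. For `F` not identically zero and `α ∈ [0, 1)` this says that the modulus
automorphic function `F` has index `α`; the zero function is admitted for every `α`. -/
def HasIndex (q : ℝ) (F : ℂ → ℂ) (α : ℝ) : Prop :=
  ∀ w ∈ coverStrip q,
    F (w + 2 * Real.pi * Complex.I) = Complex.exp (2 * Real.pi * Complex.I * α) * F w

/-- `F` has the boundary values `u` (at `r → 1`) and `v` (at `r → q`), as functions of
`t ∈ (0, 2π]`, in the sense of `L²` convergence of the slices `t ↦ F(r, t)`. -/
structure HasSliceLimits (q : ℝ) (F : ℂ → ℂ) (u v : ℝ → ℂ) : Prop where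
  outer_circle : Tendsto (fun s : ℝ ↦
    eLpNorm (fun t : ℝ ↦ F (s + t * Complex.I) - u t) 2 angleMeasure) (𝓝[<] 0) (𝓝 0)
  inner_circle : Tendsto (fun s : ℝ ↦
    eLpNorm (fun t : ℝ ↦ F (s + t * Complex.I) - v t) 2 angleMeasure)
    (𝓝[>] (Real.log q)) (𝓝 0)

/-- `g ∈ L²(B)` consists of the boundary values of `F`: the multivalued function `F ∘ exp⁻¹` is
read on `B` through the branch `0 < t ≤ 2π`. The existence of `L²` boundary values implies that
the means `∫ |F(r, t)|² dt` are bounded for `q < r < 1`. -/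
def HasBoundaryValues (q : ℝ) (F : ℂ → ℂ) (g : BoundaryL2 q) : Prop :=
  HasSliceLimits q F (fun t ↦ g (circleMap 0 1 t)) (fun t ↦ g (circleMap 0 q t))

/-- `F` is an analytic modulus automorphic function of index `α` on the universal cover, with
boundary values `g ∈ L²(B)`. -/
structure IsHardyLift (q α : ℝ) (F : ℂ → ℂ) (g : BoundaryL2 q) : Prop where
  analytic : DifferentiableOn ℂ F (coverStrip q)
  hasIndex : HasIndex q F α
  boundary : HasBoundaryValues q F g

instance : IsFiniteMeasure angleMeasure := by unfold angleMeasure; infer_instance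

theorem memLp_slice_one {q : ℝ} (g : BoundaryL2 q) :
    MemLp (fun t ↦ g (circleMap 0 1 t)) 2 angleMeasure := by
  have h := (Lp.memLp g).mono_measure
    (show circleMeasure 1 ≤ boundaryMeasure q from Measure.le_add_right le_rfl)
  exact h.comp_of_map (continuous_circleMap 0 1).aemeasurable

theorem memLp_slice_q {q : ℝ} (g : BoundaryL2 q) :
    MemLp (fun t ↦ g (circleMap 0 q t)) 2 angleMeasure := by
  have h := (Lp.memLp g).mono_measure
    (show circleMeasure q ≤ boundaryMeasure q from Measure.le_add_left le_rfl)
  exact h.comp_of_map (continuous_circleMap 0 q).aemeasurable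

theorem ae_slice_one {q : ℝ} {p : ℂ → Prop} (h : ∀ᵐ z ∂boundaryMeasure q, p z) :
    ∀ᵐ t ∂angleMeasure, p (circleMap 0 1 t) :=
  ae_of_ae_map (continuous_circleMap 0 1).aemeasurable (ae_add_measure_iff.1 h).1

theorem ae_slice_q {q : ℝ} {p : ℂ → Prop} (h : ∀ᵐ z ∂boundaryMeasure q, p z) :
    ∀ᵐ t ∂angleMeasure, p (circleMap 0 q t) :=
  ae_of_ae_map (continuous_circleMap 0 q).aemeasurable (ae_add_measure_iff.1 h).2

theorem eventually_strip_zero {q : ℝ} (hq : q ∈ Ioo (0 : ℝ) 1) :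
    ∀ᶠ s : ℝ in 𝓝[<] 0, ∀ t : ℝ, (s + t * Complex.I : ℂ) ∈ coverStrip q := by
  filter_upwards [Ioo_mem_nhdsLT (Real.log_neg hq.1 hq.2)] with s hs t
  simpa [coverStrip] using hs

theorem eventually_strip_log {q : ℝ} (hq : q ∈ Ioo (0 : ℝ) 1) :
    ∀ᶠ s : ℝ in 𝓝[>] (Real.log q), ∀ t : ℝ, (s + t * Complex.I : ℂ) ∈ coverStrip q := by
  filter_upwards [Ioo_mem_nhdsGT (Real.log_neg hq.1 hq.2)] with s hs t
  simpa [coverStrip] using hs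

theorem isOpen_coverStrip (q : ℝ) : IsOpen (coverStrip q) :=
  (isOpen_lt continuous_const Complex.continuous_re).inter
    (isOpen_lt Complex.continuous_re continuous_const)

theorem memLp_slice_lift {q : ℝ} {F : ℂ → ℂ} (hF : DifferentiableOn ℂ F (coverStrip q)) {s : ℝ}
    (hs : ∀ t : ℝ, (s + t * Complex.I : ℂ) ∈ coverStrip q) :
    MemLp (fun t : ℝ ↦ F (s + t * Complex.I)) 2 angleMeasure := by
  have hc : Continuous (fun t : ℝ ↦ F (s + t * Complex.I)) :=
    hF.continuousOn.comp_continuous (by fun_prop) hs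
  obtain ⟨C, hC⟩ := (isCompact_Icc (a := (0 : ℝ)) (b := 2 * Real.pi)).exists_bound_of_continuousOn
    hc.continuousOn
  refine MemLp.of_bound hc.aestronglyMeasurable C ?_
  filter_upwards [ae_restrict_mem measurableSet_Ioc] with t ht
  exact hC t ⟨ht.1.le, ht.2⟩

theorem tendsto_eLpNorm_add {ι : Type*} {l : Filter ι} {f g : ι → ℝ → ℂ} {u v : ℝ → ℂ}
    (hf : ∀ᶠ i in l, AEStronglyMeasurable (f i) angleMeasure)
    (hg : ∀ᶠ i in l, AEStronglyMeasurable (g i) angleMeasure)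
    (hu : AEStronglyMeasurable u angleMeasure) (hv : AEStronglyMeasurable v angleMeasure)
    (h₁ : Tendsto (fun i ↦ eLpNorm (fun t ↦ f i t - u t) 2 angleMeasure) l (𝓝 0))
    (h₂ : Tendsto (fun i ↦ eLpNorm (fun t ↦ g i t - v t) 2 angleMeasure) l (𝓝 0)) :
    Tendsto (fun i ↦ eLpNorm (fun t ↦ (f i t + g i t) - (u t + v t)) 2 angleMeasure) l (𝓝 0) := by
  have h := h₁.add h₂
  rw [add_zero] at h
  refine tendsto_of_tendsto_of_tendsto_of_le_of_le' tendsto_const_nhds h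
    (Eventually.of_forall fun _ ↦ zero_le) ?_
  filter_upwards [hf, hg] with i hfi hgi
  have := eLpNorm_add_le (hfi.sub hu) (hgi.sub hv) (p := 2) (by norm_num)
  refine le_trans (le_of_eq ?_) this
  congr 1
  ext t
  simp only [Pi.add_apply, Pi.sub_apply]
  ring

theorem tendsto_eLpNorm_smul {ι : Type*} {l : Filter ι} {f : ι → ℝ → ℂ} {u : ℝ → ℂ} (c : ℂ)
    (h₁ : Tendsto (fun i ↦ eLpNorm (fun t ↦ f i t - u t) 2 angleMeasure) l (𝓝 0)) :
    Tendsto (fun i ↦ eLpNorm (fun t ↦ c * f i t - c * u t) 2 angleMeasure) l (𝓝 0) := by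
  have h := ENNReal.Tendsto.const_mul (a := ‖c‖ₑ) h₁ (Or.inr enorm_ne_top)
  rw [mul_zero] at h
  refine h.congr fun i ↦ ?_
  rw [← eLpNorm_const_smul]
  congr 1
  ext t
  simp [mul_sub]

theorem HasSliceLimits.congr {q : ℝ} {F : ℂ → ℂ} {u v u' v' : ℝ → ℂ}
    (h : HasSliceLimits q F u v) (hu : u =ᵐ[angleMeasure] u') (hv : v =ᵐ[angleMeasure] v') :
    HasSliceLimits q F u' v' := by
  constructor
  · refine h.outer_circle.congr fun s ↦ eLpNorm_congr_ae ?_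
    filter_upwards [hu] with t ht
    rw [ht]
  · refine h.inner_circle.congr fun s ↦ eLpNorm_congr_ae ?_
    filter_upwards [hv] with t ht
    rw [ht]

/-- The Hardy space `H²_α` of the annulus, as a subspace of `L²(B)`: the boundary values of the
analytic modulus automorphic functions of index `α`. -/
def H2 (q : Ioo (0 : ℝ) 1) (α : ℝ) : Submodule ℂ (BoundaryL2 q) where
  carrier := {g | ∃ F : ℂ → ℂ, IsHardyLift q α F g}
  zero_mem' := by
    refine ⟨fun _ ↦ 0, ⟨differentiableOn_const 0, fun w _ ↦ by simp, ?_⟩⟩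
    have h0 : HasSliceLimits q (fun _ ↦ 0) (fun _ ↦ 0) (fun _ ↦ 0) := by
      constructor <;> simp
    have hz := Lp.coeFn_zero ℂ 2 (boundaryMeasure q)
    refine h0.congr ?_ ?_
    · filter_upwards [ae_slice_one hz] with t ht using ht.symm
    · filter_upwards [ae_slice_q hz] with t ht using ht.symm
  add_mem' := by
    rintro g₁ g₂ ⟨F, hF⟩ ⟨G, hG⟩
    refine ⟨fun w ↦ F w + G w, ⟨hF.analytic.add hG.analytic, fun w hw ↦ ?_, ?_⟩⟩
    · simp only [hF.hasIndex w hw, hG.hasIndex w hw]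
      ring
    have h0 : HasSliceLimits q (fun w ↦ F w + G w)
        (fun t ↦ g₁ (circleMap 0 1 t) + g₂ (circleMap 0 1 t))
        (fun t ↦ g₁ (circleMap 0 q t) + g₂ (circleMap 0 q t)) := by
      constructor
      · exact tendsto_eLpNorm_add
          ((eventually_strip_zero q.2).mono fun s hs ↦ (memLp_slice_lift hF.analytic hs).1)
          ((eventually_strip_zero q.2).mono fun s hs ↦ (memLp_slice_lift hG.analytic hs).1)
          (memLp_slice_one g₁).1 (memLp_slice_one g₂).1
          hF.boundary.outer_circle hG.boundary.outer_circle
      · exact tendsto_eLpNorm_add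
          ((eventually_strip_log q.2).mono fun s hs ↦ (memLp_slice_lift hF.analytic hs).1)
          ((eventually_strip_log q.2).mono fun s hs ↦ (memLp_slice_lift hG.analytic hs).1)
          (memLp_slice_q g₁).1 (memLp_slice_q g₂).1
          hF.boundary.inner_circle hG.boundary.inner_circle
    have hz := Lp.coeFn_add g₁ g₂
    refine h0.congr ?_ ?_
    · filter_upwards [ae_slice_one hz] with t ht using ht.symm
    · filter_upwards [ae_slice_q hz] with t ht using ht.symm
  smul_mem' := by
    rintro c g ⟨F, hF⟩
    refine ⟨fun w ↦ c * F w, ⟨hF.analytic.const_mul c, fun w hw ↦ ?_, ?_⟩⟩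
    · simp only [hF.hasIndex w hw]
      ring
    have h0 : HasSliceLimits q (fun w ↦ c * F w)
        (fun t ↦ c * g (circleMap 0 1 t)) (fun t ↦ c * g (circleMap 0 q t)) :=
      ⟨tendsto_eLpNorm_smul c hF.boundary.outer_circle,
        tendsto_eLpNorm_smul c hF.boundary.inner_circle⟩
    have hz := Lp.coeFn_smul c g
    refine h0.congr ?_ ?_
    · filter_upwards [ae_slice_one hz] with t ht using ht.symm
    · filter_upwards [ae_slice_q hz] with t ht using ht.symm
/-- The `n`-th Fourier coefficient of `e^{-iαt} u(t)` on `(0, 2π]`, times `2π`. -/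
def coef (α : ℝ) (n : ℤ) (u : ℝ → ℂ) : ℂ :=
  ∫ t, Complex.exp (-((n + α : ℝ) : ℂ) * t * Complex.I) * u t ∂angleMeasure

theorem norm_phase (a t : ℝ) : ‖Complex.exp (-(a : ℂ) * t * Complex.I)‖ = 1 := by
  have : (-(a : ℂ) * t * Complex.I) = ((-a * t : ℝ) : ℂ) * Complex.I := by push_cast; ring
  rw [this, Complex.norm_exp_ofReal_mul_I]

theorem memLp_phase {u : ℝ → ℂ} (a : ℝ) (hu : MemLp u 2 angleMeasure) :
    MemLp (fun t : ℝ ↦ Complex.exp (-(a : ℂ) * t * Complex.I) * u t) 2 angleMeasure := by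
  refine hu.of_le ((Continuous.aestronglyMeasurable (by fun_prop)).mul hu.1) ?_
  exact Eventually.of_forall fun t ↦ by rw [norm_mul, norm_phase, one_mul]

theorem tendsto_coef {ι : Type*} {l : Filter ι} {f : ι → ℝ → ℂ} {u : ℝ → ℂ} (α : ℝ) (n : ℤ)
    (hf : ∀ᶠ i in l, MemLp (f i) 2 angleMeasure) (hu : MemLp u 2 angleMeasure)
    (h : Tendsto (fun i ↦ eLpNorm (fun t ↦ f i t - u t) 2 angleMeasure) l (𝓝 0)) :
    Tendsto (fun i ↦ coef α n (f i)) l (𝓝 (coef α n u)) := by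
  refine tendsto_integral_of_L1' _ (memLp_phase _ hu).1 ?_ ?_
  · exact hf.mono fun i hi ↦ (memLp_phase _ hi).integrable (by norm_num)
  have h2 := ENNReal.Tendsto.mul_const (b := angleMeasure univ ^
    (1 / (1 : ℝ≥0∞).toReal - 1 / (2 : ℝ≥0∞).toReal)) h
    (Or.inr (ENNReal.rpow_ne_top_of_nonneg (by norm_num) (measure_ne_top _ _)))
  rw [zero_mul] at h2
  refine tendsto_of_tendsto_of_tendsto_of_le_of_le' tendsto_const_nhds h2
    (Eventually.of_forall fun _ ↦ zero_le) ?_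
  filter_upwards [hf] with i hi
  refine le_trans (le_of_eq ?_) (eLpNorm_le_eLpNorm_mul_rpow_measure_univ (p := 1) (q := 2)
    (by norm_num) (hi.sub hu).1)
  refine eLpNorm_congr_norm_ae (Eventually.of_forall fun t ↦ ?_)
  simp only [Pi.sub_apply]
  rw [← mul_sub, norm_mul, norm_phase, one_mul]

theorem coef_slice_const {q α : ℝ} {F : ℂ → ℂ} (hF : DifferentiableOn ℂ F (coverStrip q))
    (hα : HasIndex q F α) (n : ℤ) {s s' : ℝ} (hs : s ∈ Ioo (Real.log q) 0)
    (hs' : s' ∈ Ioo (Real.log q) 0) :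
    Complex.exp (-((n + α : ℝ) : ℂ) * s) * coef α n (fun t ↦ F (s + t * Complex.I)) =
      Complex.exp (-((n + α : ℝ) : ℂ) * s') * coef α n (fun t ↦ F (s' + t * Complex.I)) := by
  set K : ℂ → ℂ := fun w ↦ Complex.exp (-((n + α : ℝ) : ℂ) * w) * F w with hK
  have hKd : DifferentiableOn ℂ K (coverStrip q) :=
    DifferentiableOn.mul (by fun_prop) hF
  have hper : ∀ x : ℝ, x ∈ Ioo (Real.log q) 0 →
      K (x + (2 * Real.pi : ℝ) * Complex.I) = K (x + (0 : ℝ) * Complex.I) := by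
    intro x hx
    have hmem : (x : ℂ) ∈ coverStrip q := by simpa [coverStrip] using hx
    have h1 := hα x hmem
    have e0 : (x + (0 : ℝ) * Complex.I : ℂ) = x := by simp
    have e1 : (x + (2 * Real.pi : ℝ) * Complex.I : ℂ) = x + 2 * Real.pi * Complex.I := by
      push_cast; ring
    rw [e0, e1]
    simp only [hK]
    rw [h1, ← mul_assoc, ← Complex.exp_add]
    congr 1
    have : -((n + α : ℝ) : ℂ) * (x + 2 * Real.pi * Complex.I) + 2 * Real.pi * Complex.I * α
        = -((n + α : ℝ) : ℂ) * x + ((-n : ℤ) : ℂ) * (2 * Real.pi * Complex.I) := by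
      push_cast; ring
    rw [this, Complex.exp_add, Complex.exp_int_mul_two_pi_mul_I, mul_one]
  have hsub : uIcc s s' ⊆ Ioo (Real.log q) 0 := by
    intro x hx
    exact ⟨lt_of_lt_of_le (lt_min hs.1 hs'.1) hx.1, lt_of_le_of_lt hx.2 (max_lt hs.2 hs'.2)⟩
  have hR := Complex.integral_boundary_rect_eq_zero_of_differentiableOn K (s : ℂ)
    (s' + (2 * Real.pi : ℝ) * Complex.I) (hKd.mono fun w hw ↦ by
      have := hsub (by simpa using hw.1)
      exact this)
  have hint : ∀ x : ℝ, Complex.exp (-((n + α : ℝ) : ℂ) * x) *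
      coef α n (fun t ↦ F (x + t * Complex.I)) =
      ∫ t : ℝ in (0 : ℝ)..(2 * Real.pi), K (x + t * Complex.I) := by
    intro x
    rw [intervalIntegral.integral_of_le (by positivity), coef, ← integral_const_mul]
    refine integral_congr_ae (Eventually.of_forall fun t ↦ ?_)
    simp only [hK]
    rw [← mul_assoc, ← Complex.exp_add]
    congr 2
    ring
  rw [hint, hint]
  have hh : (∫ x : ℝ in s..s', K (x + (0 : ℝ) * Complex.I)) =
      ∫ x : ℝ in s..s', K (x + (2 * Real.pi : ℝ) * Complex.I) :=
    intervalIntegral.integral_congr fun x hx ↦ (hper x (hsub hx)).symm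
  have r1 : ((s' : ℂ) + (2 * Real.pi : ℝ) * Complex.I).re = s' := by simp
  have r2 : ((s' : ℂ) + (2 * Real.pi : ℝ) * Complex.I).im = 2 * Real.pi := by simp
  rw [r1, r2, Complex.ofReal_re, Complex.ofReal_im, hh, sub_self, zero_add, ← smul_sub] at hR
  have := (smul_eq_zero.1 hR).resolve_left Complex.I_ne_zero
  exact (sub_eq_zero.1 this).symm

theorem coef_relation {q : ℝ} (hq : q ∈ Ioo (0 : ℝ) 1) {α : ℝ} {F : ℂ → ℂ} {u v : ℝ → ℂ}
    (hF : DifferentiableOn ℂ F (coverStrip q)) (hα : HasIndex q F α)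
    (hu : MemLp u 2 angleMeasure) (hv : MemLp v 2 angleMeasure) (h : HasSliceLimits q F u v)
    (n : ℤ) :
    coef α n v = Complex.exp (((n + α : ℝ) : ℂ) * Real.log q) * coef α n u := by
  have hL := Real.log_neg hq.1 hq.2
  set s₀ : ℝ := Real.log q / 2 with hs₀
  have hs₀m : s₀ ∈ Ioo (Real.log q) 0 := ⟨by linarith, by linarith⟩
  set A := Complex.exp (-((n + α : ℝ) : ℂ) * s₀) * coef α n (fun t ↦ F (s₀ + t * Complex.I))
  have h1 := tendsto_coef α n ((eventually_strip_zero hq).mono fun s hs ↦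
    memLp_slice_lift hF hs) hu h.outer_circle
  have h2 := tendsto_coef α n ((eventually_strip_log hq).mono fun s hs ↦
    memLp_slice_lift hF hs) hv h.inner_circle
  have hc : Continuous fun s : ℝ ↦ Complex.exp (-((n + α : ℝ) : ℂ) * s) := by fun_prop
  have h1' := ((hc.tendsto 0).mono_left nhdsWithin_le_nhds).mul h1
  have h2' := ((hc.tendsto (Real.log q)).mono_left nhdsWithin_le_nhds).mul h2
  have e1 : Complex.exp (-((n + α : ℝ) : ℂ) * (0 : ℝ)) * coef α n u = A := by
    refine tendsto_nhds_unique h1' (Tendsto.congr' ?_ tendsto_const_nhds)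
    filter_upwards [Ioo_mem_nhdsLT hL] with s hs
    exact coef_slice_const hF hα n hs₀m hs
  have e2 : Complex.exp (-((n + α : ℝ) : ℂ) * Real.log q) * coef α n v = A := by
    refine tendsto_nhds_unique h2' (Tendsto.congr' ?_ tendsto_const_nhds)
    filter_upwards [Ioo_mem_nhdsGT hL] with s hs
    exact coef_slice_const hF hα n hs₀m hs
  rw [Complex.ofReal_zero, mul_zero, Complex.exp_zero, one_mul] at e1
  rw [e1, ← e2, ← mul_assoc, ← Complex.exp_add, neg_mul, add_neg_cancel, Complex.exp_zero, one_mul]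

theorem coef_sub {u v : ℝ → ℂ} (α : ℝ) (n : ℤ) (hu : MemLp u 2 angleMeasure)
    (hv : MemLp v 2 angleMeasure) :
    coef α n (fun t ↦ u t - v t) = coef α n u - coef α n v := by
  rw [coef, coef, coef, ← integral_sub ((memLp_phase _ hu).integrable (by norm_num))
    ((memLp_phase _ hv).integrable (by norm_num))]
  simp only [mul_sub]

theorem hasSum_coef {u : ℝ → ℂ} (α : ℝ) (hu : MemLp u 2 angleMeasure) :
    HasSum (fun n : ℤ ↦ ‖coef α n u‖ ^ 2) (2 * Real.pi * ∫ t, ‖u t‖ ^ 2 ∂angleMeasure) := by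
  have hab : (0 : ℝ) < 2 * Real.pi := by positivity
  have h := hasSum_sq_fourierCoeffOn hab (memLp_phase α hu)
  have h2 := h.mul_left ((2 * Real.pi) ^ 2)
  have key : ∀ n : ℤ, ‖coef α n u‖ ^ 2 = (2 * Real.pi) ^ 2 * ‖fourierCoeffOn hab
      (fun t : ℝ ↦ Complex.exp (-(α : ℂ) * t * Complex.I) * u t) n‖ ^ 2 := by
    intro n
    rw [fourierCoeffOn_eq_integral, intervalIntegral.integral_of_le hab.le, norm_smul,
      mul_pow ‖_‖, ← mul_assoc]
    have : (2 * Real.pi) ^ 2 * ‖1 / (2 * Real.pi - 0)‖ ^ 2 = 1 := by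
      rw [sub_zero, Real.norm_of_nonneg (by positivity)]
      field_simp
    rw [this, one_mul]
    congr 2
    refine integral_congr_ae (Eventually.of_forall fun t ↦ ?_)
    simp only [smul_eq_mul, fourier_coe_apply]
    rw [← mul_assoc, ← Complex.exp_add]
    congr 2
    push_cast
    have : (Real.pi : ℂ) ≠ 0 := by exact_mod_cast Real.pi_ne_zero
    field_simp
    ring
  have key2 : 2 * Real.pi * ∫ t, ‖u t‖ ^ 2 ∂angleMeasure = (2 * Real.pi) ^ 2 *
      ((2 * Real.pi - 0)⁻¹ • ∫ t : ℝ in (0 : ℝ)..(2 * Real.pi),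
        ‖Complex.exp (-(α : ℂ) * t * Complex.I) * u t‖ ^ 2) := by
    rw [intervalIntegral.integral_of_le hab.le]
    simp only [norm_mul, norm_phase, one_mul, sub_zero, smul_eq_mul, angleMeasure]
    field_simp
  rw [key2]
  simpa only [key] using h2

theorem eLpNorm_eq {u : ℝ → ℂ} (hu : MemLp u 2 angleMeasure) :
    eLpNorm u 2 angleMeasure = ENNReal.ofReal ((∫ t, ‖u t‖ ^ 2 ∂angleMeasure) ^ (2 : ℝ)⁻¹) := by
  rw [hu.eLpNorm_eq_integral_rpow_norm (by norm_num) (by norm_num)]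
  simp

theorem norm_coef_le {u : ℝ → ℂ} (α : ℝ) (n : ℤ) :
    ‖coef α n u‖ ≤ ∫ t, ‖u t‖ ∂angleMeasure := by
  refine (norm_integral_le_integral_norm _).trans (le_of_eq ?_)
  simp only [norm_mul, norm_phase, one_mul]

/-- The terms of the Laurent-type series `∑ aₙ z^{n+α}` on the universal cover. -/
def term (α : ℝ) (u : ℝ → ℂ) (n : ℤ) (w : ℂ) : ℂ :=
  (2 * Real.pi : ℂ)⁻¹ * coef α n u * Complex.exp (((n + α : ℝ) : ℂ) * w)

theorem norm_term (α : ℝ) (u : ℝ → ℂ) (n : ℤ) (w : ℂ) :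
    ‖term α u n w‖ = (2 * Real.pi)⁻¹ * (‖coef α n u‖ * Real.exp ((n + α) * w.re)) := by
  have hp := Real.pi_pos
  rw [term, norm_mul, norm_mul, Complex.norm_exp, Complex.re_ofReal_mul, norm_inv, norm_mul,
    Complex.norm_real, Real.norm_of_nonneg hp.le]
  simp only [RCLike.norm_ofNat]
  ring

theorem summable_exp_abs {ε : ℝ} (hε : 0 < ε) :
    Summable fun n : ℤ ↦ Real.exp (-(ε * |(n : ℝ)|)) := by
  have h : Summable fun n : ℕ ↦ Real.exp (n * (-ε)) := Real.summable_exp_nat_mul_iff.2 (by linarith)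
  refine Summable.of_nat_of_neg ?_ ?_
  · refine h.congr fun n ↦ ?_
    simp [mul_comm]
  · refine h.congr fun n ↦ ?_
    simp [mul_comm]

theorem coef_exp_le {L α : ℝ} {u v : ℝ → ℂ}
    (hrel : ∀ n : ℤ, ‖coef α n v‖ = Real.exp ((n + α) * L) * ‖coef α n u‖)
    {M ε : ℝ} (hMu : ∀ n, ‖coef α n u‖ ≤ M) (hMv : ∀ n, ‖coef α n v‖ ≤ M) (hε : 0 < ε)
    {s : ℝ} (hs : L + ε ≤ s) (hs' : s ≤ -ε) (n : ℤ) :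
    ‖coef α n u‖ * Real.exp ((n + α) * s) ≤
      M * Real.exp (ε * |α|) * Real.exp (-(ε * |(n : ℝ)|)) := by
  have hM : 0 ≤ M := (norm_nonneg _).trans (hMu n)
  have habs : |(n : ℝ)| ≤ |(n : ℝ) + α| + |α| := by
    have := abs_sub ((n : ℝ) + α) α
    simpa using this
  have hle : Real.exp (-(ε * |(n : ℝ) + α|)) ≤
      Real.exp (ε * |α|) * Real.exp (-(ε * |(n : ℝ)|)) := by
    rw [← Real.exp_add]
    exact Real.exp_le_exp.2 (by nlinarith)
  rw [mul_assoc]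
  refine le_trans ?_ (mul_le_mul_of_nonneg_left hle hM)
  rcases le_total 0 ((n : ℝ) + α) with h | h
  · rw [abs_of_nonneg h]
    refine mul_le_mul (hMu n) (Real.exp_le_exp.2 (by nlinarith)) (Real.exp_pos _).le hM
  · rw [abs_of_nonpos h]
    have : ‖coef α n u‖ * Real.exp ((n + α) * s) =
        ‖coef α n v‖ * Real.exp ((n + α) * (s - L)) := by
      rw [hrel, mul_comm (Real.exp _) ‖coef α n u‖, mul_assoc, ← Real.exp_add]
      congr 2
      ring
    rw [this]
    refine mul_le_mul (hMv n) (Real.exp_le_exp.2 (by nlinarith)) (Real.exp_pos _).le hM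

theorem integral_phase (k : ℤ) :
    ∫ t : ℝ, Complex.exp ((k : ℂ) * t * Complex.I) ∂angleMeasure =
      if k = 0 then (2 * Real.pi : ℂ) else 0 := by
  rw [angleMeasure, ← intervalIntegral.integral_of_le (by positivity)]
  split_ifs with h
  · simp [h]
  · have hk : (k : ℂ) * Complex.I ≠ 0 := mul_ne_zero (by exact_mod_cast h) Complex.I_ne_zero
    have e : ∀ t : ℝ, Complex.exp ((k : ℂ) * t * Complex.I) =
        Complex.exp ((k : ℂ) * Complex.I * t) := fun t ↦ by congr 1; ring
    simp only [e]
    rw [integral_exp_mul_complex hk]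
    have e2 : (k : ℂ) * Complex.I * ((2 * Real.pi : ℝ) : ℂ) = k * (2 * Real.pi * Complex.I) := by
      push_cast; ring
    rw [e2, Complex.exp_int_mul_two_pi_mul_I]
    simp

theorem coef_slice_tsum {α : ℝ} {u : ℝ → ℂ} {s : ℝ}
    (hs : Summable fun n : ℤ ↦ ‖coef α n u‖ * Real.exp ((n + α) * s)) (m : ℤ) :
    coef α m (fun t ↦ ∑' n : ℤ, term α u n (s + t * Complex.I)) =
      Complex.exp (((m + α : ℝ) : ℂ) * s) * coef α m u := by
  set G : ℤ → ℝ → ℂ := fun n t ↦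
    Complex.exp (-((m + α : ℝ) : ℂ) * t * Complex.I) * term α u n (s + t * Complex.I) with hG
  have hnorm : ∀ n t, ‖G n t‖ = (2 * Real.pi)⁻¹ * (‖coef α n u‖ * Real.exp ((n + α) * s)) := by
    intro n t
    simp only [hG]
    rw [norm_mul, norm_phase, one_mul, norm_term]
    simp
  have hcont : ∀ n, Continuous (G n) := by
    intro n
    simp only [hG, term]
    fun_prop
  have hint : ∀ n, Integrable (G n) angleMeasure := fun n ↦
    (integrable_const ((2 * Real.pi)⁻¹ * (‖coef α n u‖ * Real.exp ((n + α) * s)))).mono'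
      (hcont n).aestronglyMeasurable (Eventually.of_forall fun t ↦ (hnorm n t).le)
  have hsum : Summable fun n ↦ ∫ t, ‖G n t‖ ∂angleMeasure := by
    simp only [hnorm, integral_const, smul_eq_mul]
    exact (hs.mul_left _).mul_left _
  have h := hasSum_integral_of_summable_integral_norm hint hsum
  have hval : ∀ n, ∫ t, G n t ∂angleMeasure =
      if n = m then Complex.exp (((m + α : ℝ) : ℂ) * s) * coef α m u else 0 := by
    intro n
    have e : ∀ t, G n t = (2 * Real.pi : ℂ)⁻¹ * coef α n u * Complex.exp (((n + α : ℝ) : ℂ) * s) *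
        Complex.exp (((n - m : ℤ) : ℂ) * t * Complex.I) := by
      intro t
      simp only [hG, term]
      rw [mul_left_comm, ← Complex.exp_add, mul_assoc ((2 * Real.pi : ℂ)⁻¹ * coef α n u),
        ← Complex.exp_add]
      congr 2
      push_cast
      ring
    simp only [e]
    rw [integral_const_mul, integral_phase]
    by_cases hnm : n = m
    · subst hnm
      have : (Real.pi : ℂ) ≠ 0 := by exact_mod_cast Real.pi_ne_zero
      simp only [sub_self, if_true]
      field_simp
    · simp [hnm, sub_eq_zero]
  simp only [hval] at h
  have h2 := h.unique (hasSum_ite_eq m _)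
  rw [← h2, coef]
  refine integral_congr_ae (Eventually.of_forall fun t ↦ ?_)
  simp only [hG]
  rw [tsum_mul_left]

theorem tendsto_slice {α L : ℝ} {u v : ℝ → ℂ} {F : ℂ → ℂ}
    (hu : MemLp u 2 angleMeasure) (hv : MemLp v 2 angleMeasure)
    (hrel : ∀ n : ℤ, ‖coef α n v‖ = Real.exp ((n + α) * L) * ‖coef α n u‖)
    (hF : ∀ s ∈ Ioo L 0, MemLp (fun t : ℝ ↦ F (s + t * Complex.I)) 2 angleMeasure)
    (hco : ∀ s ∈ Ioo L 0, ∀ n : ℤ, coef α n (fun t ↦ F (s + t * Complex.I)) =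
      Complex.exp (((n + α : ℝ) : ℂ) * s) * coef α n u)
    {b : ℝ → ℂ} (hb : MemLp b 2 angleMeasure) {s₁ : ℝ} (hs₁ : s₁ ∈ Icc L 0)
    (hbco : ∀ n : ℤ, coef α n b = Complex.exp (((n + α : ℝ) : ℂ) * s₁) * coef α n u)
    {l : Filter ℝ} (hl : l ≤ 𝓝 s₁) (hl' : ∀ᶠ s in l, s ∈ Ioo L 0) :
    Tendsto (fun s : ℝ ↦ eLpNorm (fun t : ℝ ↦ F (s + t * Complex.I) - b t) 2 angleMeasure)
      l (𝓝 0) := by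
  have hp := Real.pi_pos
  set D : ℝ → ℤ → ℝ := fun s n ↦
    ‖Complex.exp (((n + α : ℝ) : ℂ) * s) * coef α n u -
      Complex.exp (((n + α : ℝ) : ℂ) * s₁) * coef α n u‖ ^ 2 with hD
  have hexp : ∀ (n : ℤ) (s : ℝ), ‖Complex.exp (((n + α : ℝ) : ℂ) * s)‖ =
      Real.exp ((n + α) * s) := by
    intro n s
    rw [Complex.norm_exp, ← Complex.ofReal_mul, Complex.ofReal_re]
  have hexple : ∀ (n : ℤ) (s : ℝ), s ∈ Icc L 0 →
      Real.exp ((n + α) * s) * ‖coef α n u‖ ≤ ‖coef α n u‖ + ‖coef α n v‖ := by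
    intro n s hs
    rw [hrel]
    have h0 := norm_nonneg (coef α n u)
    have h1 := Real.exp_pos (((n : ℝ) + α) * L)
    have : Real.exp ((n + α) * s) ≤ 1 + Real.exp (((n : ℝ) + α) * L) := by
      rcases le_total 0 ((n : ℝ) + α) with h | h
      · have : Real.exp (((n : ℝ) + α) * s) ≤ 1 :=
          Real.exp_le_one_iff.2 (mul_nonpos_of_nonneg_of_nonpos h hs.2)
        linarith
      · have : Real.exp (((n : ℝ) + α) * s) ≤ Real.exp (((n : ℝ) + α) * L) :=
          Real.exp_le_exp.2 (mul_le_mul_of_nonpos_left hs.1 h)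
        linarith
    nlinarith
  have hT : Tendsto (fun s ↦ ∑' n, D s n) l (𝓝 (∑' _ : ℤ, (0 : ℝ))) := by
    refine tendsto_tsum_of_dominated_convergence
      (bound := fun n ↦ 8 * ‖coef α n u‖ ^ 2 + 8 * ‖coef α n v‖ ^ 2)
      (((hasSum_coef α hu).summable.mul_left 8).add ((hasSum_coef α hv).summable.mul_left 8)) ?_ ?_
    · intro n
      have hc : Continuous fun s : ℝ ↦ D s n := by
        simp only [hD]
        fun_prop
      have := (hc.tendsto s₁).mono_left hl
      simpa [hD] using this
    · filter_upwards [hl'] with s hs n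
      have h1 : ‖Complex.exp (((n + α : ℝ) : ℂ) * s) * coef α n u -
          Complex.exp (((n + α : ℝ) : ℂ) * s₁) * coef α n u‖ ≤
          2 * (‖coef α n u‖ + ‖coef α n v‖) := by
        refine (norm_sub_le _ _).trans ?_
        rw [norm_mul, norm_mul, hexp, hexp]
        linarith [hexple n s ⟨hs.1.le, hs.2.le⟩, hexple n s₁ hs₁]
      simp only [hD]
      rw [Real.norm_of_nonneg (by positivity)]
      have h2 := pow_le_pow_left₀ (norm_nonneg _) h1 2
      nlinarith [sq_nonneg (‖coef α n u‖ - ‖coef α n v‖)]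
  rw [tsum_zero] at hT
  have hI : Tendsto (fun s : ℝ ↦ ∫ t, ‖F (s + t * Complex.I) - b t‖ ^ 2 ∂angleMeasure) l (𝓝 0) := by
    have h2 := hT.const_mul (2 * Real.pi)⁻¹
    rw [mul_zero] at h2
    refine h2.congr' ?_
    filter_upwards [hl'] with s hs
    have h3 := (hasSum_coef α ((hF s hs).sub hb)).tsum_eq
    have h4 : ∀ n, ‖coef α n ((fun t : ℝ ↦ F (s + t * Complex.I)) - b)‖ ^ 2 = D s n := by
      intro n
      have := coef_sub α n (hF s hs) hb
      rw [hco s hs, hbco] at this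
      simp only [hD]
      rw [← this]
      rfl
    simp only [h4] at h3
    rw [h3, ← mul_assoc, inv_mul_cancel₀ (by positivity), one_mul]
    rfl
  have hR := hI.rpow_const (p := (2 : ℝ)⁻¹) (Or.inr (by norm_num))
  have hE := ENNReal.tendsto_ofReal hR
  rw [Real.zero_rpow (by norm_num), ENNReal.ofReal_zero] at hE
  refine hE.congr' ?_
  filter_upwards [hl'] with s hs
  exact (eLpNorm_eq ((hF s hs).sub hb)).symm

theorem exists_lift {q : ℝ} (hq : q ∈ Ioo (0 : ℝ) 1) {α : ℝ} {u v : ℝ → ℂ}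
    (hu : MemLp u 2 angleMeasure) (hv : MemLp v 2 angleMeasure)
    (hrel : ∀ n : ℤ, coef α n v = Complex.exp (((n + α : ℝ) : ℂ) * Real.log q) * coef α n u) :
    ∃ F : ℂ → ℂ, DifferentiableOn ℂ F (coverStrip q) ∧ HasIndex q F α ∧
      HasSliceLimits q F u v := by
  have hL := Real.log_neg hq.1 hq.2
  set L := Real.log q with hLdef
  have hrel' : ∀ n : ℤ, ‖coef α n v‖ = Real.exp ((n + α) * L) * ‖coef α n u‖ := by
    intro n
    rw [hrel, norm_mul, Complex.norm_exp, ← Complex.ofReal_mul, Complex.ofReal_re]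
  set M : ℝ := max (∫ t, ‖u t‖ ∂angleMeasure) (∫ t, ‖v t‖ ∂angleMeasure)
  have hMu : ∀ n, ‖coef α n u‖ ≤ M := fun n ↦ (norm_coef_le α n).trans (le_max_left _ _)
  have hMv : ∀ n, ‖coef α n v‖ ≤ M := fun n ↦ (norm_coef_le α n).trans (le_max_right _ _)
  set F : ℂ → ℂ := fun w ↦ ∑' n : ℤ, term α u n w with hFdef
  have hdiff : DifferentiableOn ℂ F (coverStrip q) := by
    intro w hw
    have hw1 : L < w.re := hw.1
    have hw2 : w.re < 0 := hw.2
    obtain ⟨ε, hε, h1, h2⟩ : ∃ ε > 0, L + ε < w.re ∧ w.re < -ε := by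
      refine ⟨min (w.re - L) (-w.re) / 2, ?_, ?_, ?_⟩
      · have : 0 < min (w.re - L) (-w.re) := lt_min (by linarith) (by linarith)
        linarith
      · linarith [min_le_left (w.re - L) (-w.re)]
      · linarith [min_le_right (w.re - L) (-w.re)]
    have hop : IsOpen {z : ℂ | L + ε < z.re ∧ z.re < -ε} :=
      (isOpen_lt continuous_const Complex.continuous_re).inter
        (isOpen_lt Complex.continuous_re continuous_const)
    have hd := Complex.differentiableOn_tsum_of_summable_norm
      (F := fun n w ↦ term α u n w)
      (u := fun n : ℤ ↦ (2 * Real.pi)⁻¹ * (M * Real.exp (ε * |α|) * Real.exp (-(ε * |(n : ℝ)|))))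
      (((summable_exp_abs hε).mul_left _).mul_left _)
      (fun n ↦ by unfold term; fun_prop) hop
      (fun n z hz ↦ by
        rw [norm_term]
        exact mul_le_mul_of_nonneg_left
          (coef_exp_le hrel' hMu hMv hε hz.1.le hz.2.le n) (by positivity))
    exact (hd.differentiableAt (hop.mem_nhds ⟨h1, h2⟩)).differentiableWithinAt
  have hmem : ∀ s ∈ Ioo L 0, ∀ t : ℝ, (s + t * Complex.I : ℂ) ∈ coverStrip q := by
    intro s hs t
    simpa [coverStrip] using hs
  have hsumm : ∀ s ∈ Ioo L 0,
      Summable fun n : ℤ ↦ ‖coef α n u‖ * Real.exp ((n + α) * s) := by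
    intro s hs
    set ε := min (s - L) (-s) with hεd
    have hε : 0 < ε := lt_min (by linarith [hs.1]) (by linarith [hs.2])
    refine Summable.of_nonneg_of_le (fun n ↦ by positivity)
      (coef_exp_le hrel' hMu hMv hε (s := s) ?_ ?_)
      ((summable_exp_abs hε).mul_left _)
    · linarith [min_le_left (s - L) (-s)]
    · linarith [min_le_right (s - L) (-s)]
  have hco : ∀ s ∈ Ioo L 0, ∀ n : ℤ, coef α n (fun t ↦ F (s + t * Complex.I)) =
      Complex.exp (((n + α : ℝ) : ℂ) * s) * coef α n u :=
    fun s hs n ↦ coef_slice_tsum (hsumm s hs) n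
  have hFm : ∀ s ∈ Ioo L 0, MemLp (fun t : ℝ ↦ F (s + t * Complex.I)) 2 angleMeasure :=
    fun s hs ↦ memLp_slice_lift hdiff (hmem s hs)
  refine ⟨F, hdiff, ?_, ?_, ?_⟩
  · intro w _
    simp only [hFdef, ← tsum_mul_left]
    refine tsum_congr fun n ↦ ?_
    simp only [term]
    rw [mul_left_comm (Complex.exp _), ← Complex.exp_add]
    congr 1
    have : ((n + α : ℝ) : ℂ) * (w + 2 * Real.pi * Complex.I) =
        (2 * Real.pi * Complex.I * α + ((n + α : ℝ) : ℂ) * w) +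
          (n : ℂ) * (2 * Real.pi * Complex.I) := by
      push_cast; ring
    rw [this, Complex.exp_add _ ((n : ℂ) * _), Complex.exp_int_mul_two_pi_mul_I, mul_one]
  · exact tendsto_slice hu hv hrel' hFm hco hu (s₁ := 0) ⟨hL.le, le_rfl⟩ (by simp)
      nhdsWithin_le_nhds (Ioo_mem_nhdsLT hL)
  · exact tendsto_slice hu hv hrel' hFm hco hv (s₁ := L) ⟨le_rfl, hL.le⟩ hrel
      nhdsWithin_le_nhds (Ioo_mem_nhdsGT hL)

theorem mem_H2_iff {q : Ioo (0 : ℝ) 1} {α : ℝ} {g : BoundaryL2 q} :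
    g ∈ H2 q α ↔ ∀ n : ℤ, coef α n (fun t ↦ g (circleMap 0 q t)) =
      Complex.exp (((n + α : ℝ) : ℂ) * Real.log q) * coef α n (fun t ↦ g (circleMap 0 1 t)) := by
  constructor
  · rintro ⟨F, hF⟩ n
    exact coef_relation q.2 hF.analytic hF.hasIndex (memLp_slice_one g) (memLp_slice_q g)
      hF.boundary n
  · intro h
    obtain ⟨F, h1, h2, h3⟩ := exists_lift q.2 (memLp_slice_one g) (memLp_slice_q g) h
    exact ⟨F, h1, h2, h3⟩

theorem tendsto_slices_of_tendsto {q : ℝ} {G : ℕ → BoundaryL2 q} {g : BoundaryL2 q}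
    (h : Tendsto G atTop (𝓝 g)) {r : ℝ} (hr : circleMeasure r ≤ boundaryMeasure q) :
    Tendsto (fun k ↦ eLpNorm (fun t ↦ G k (circleMap 0 r t) - g (circleMap 0 r t)) 2 angleMeasure)
      atTop (𝓝 0) := by
  have h1 := (Lp.tendsto_Lp_iff_tendsto_eLpNorm' G g).1 h
  refine tendsto_of_tendsto_of_tendsto_of_le_of_le tendsto_const_nhds h1
    (fun _ ↦ zero_le) fun k ↦ ?_
  have hm : AEStronglyMeasurable (⇑(G k) - ⇑g) (circleMeasure r) :=
    ((Lp.memLp (G k)).1.sub (Lp.memLp g).1).mono_measure hr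
  have e := eLpNorm_map_measure (p := 2) hm (continuous_circleMap 0 r).aemeasurable
  refine le_trans (le_of_eq ?_) (eLpNorm_mono_measure (⇑(G k) - ⇑g) hr)
  exact e.symm

theorem isClosed_H2 (q : Ioo (0 : ℝ) 1) (α : ℝ) : IsClosed (H2 q α : Set (BoundaryL2 q)) := by
  refine IsSeqClosed.isClosed fun G g hG h ↦ mem_H2_iff.2 fun n ↦ ?_
  have h1 := tendsto_coef α n (Eventually.of_forall fun k ↦ memLp_slice_one (G k))
    (memLp_slice_one g) (tendsto_slices_of_tendsto h (Measure.le_add_right le_rfl))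
  have h2 := tendsto_coef α n (Eventually.of_forall fun k ↦ memLp_slice_q (G k))
    (memLp_slice_q g) (tendsto_slices_of_tendsto h (Measure.le_add_left le_rfl))
  refine tendsto_nhds_unique h2 ((h1.const_mul _).congr fun k ↦ ?_)
  exact (mem_H2_iff.1 (hG k) n).symm

instance (q : Ioo (0 : ℝ) 1) (α : ℝ) : CompleteSpace (H2 q α) :=
  (isClosed_H2 q α).completeSpace_coe

/-- Multiplication by a real-valued `φ ∈ L^∞(B)` on `L²(B)`. -/
def mulSymbol {q : ℝ} (φ : Lp ℝ ∞ (boundaryMeasure q)) : BoundaryL2 q →L[ℂ] BoundaryL2 q :=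
  LinearMap.mkContinuous
    { toFun := fun g ↦ (φ • g : BoundaryL2 q)
      map_add' := fun g h ↦ by
        refine Lp.ext ?_
        filter_upwards [Lp.coeFn_lpSMul (r := 2) φ (g + h), Lp.coeFn_add g h,
          Lp.coeFn_add (φ • g : BoundaryL2 q) (φ • h), Lp.coeFn_lpSMul (r := 2) φ g,
          Lp.coeFn_lpSMul (r := 2) φ h] with z h1 h2 h3 h4 h5
        rw [h1, h3, Pi.smul_apply', h2, Pi.add_apply, Pi.add_apply, h4, h5, Pi.smul_apply',
          Pi.smul_apply', smul_add]
      map_smul' := fun c g ↦ by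
        refine Lp.ext ?_
        filter_upwards [Lp.coeFn_lpSMul (r := 2) φ (c • g), Lp.coeFn_smul c g,
          Lp.coeFn_smul c (φ • g : BoundaryL2 q), Lp.coeFn_lpSMul (r := 2) φ g] with z h1 h2 h3 h4
        rw [h1, RingHom.id_apply, h3, Pi.smul_apply', h2, Pi.smul_apply, Pi.smul_apply, h4,
          Pi.smul_apply', smul_comm] }
    ‖φ‖ fun g ↦ Lp.norm_smul_le φ g

/-- The Toeplitz operator `T_φ^α f = P_α (φ f)` on `H²_α`, with `P_α` the orthogonal projection of
`L²(B)` onto `H²_α`. -/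
def toeplitz (q : Ioo (0 : ℝ) 1) (α : ℝ) (φ : Lp ℝ ∞ (boundaryMeasure q)) :
    H2 q α →L[ℂ] H2 q α :=
  (H2 q α).orthogonalProjectionOnto ∘L mulSymbol φ ∘L (H2 q α).subtypeL

/-- The annulus algebra: functions continuous on the closed annulus and analytic on the open one
(values elsewhere are irrelevant). -/
def annulusAlgebra (q : ℝ) : Set (ℂ → ℂ) :=
  {a | ContinuousOn a {z | q ≤ ‖z‖ ∧ ‖z‖ ≤ 1} ∧ DifferentiableOn ℂ a {z | q < ‖z‖ ∧ ‖z‖ < 1}}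

/-- `g ∈ H²_α` is outer if `{a g ∈ H²_α : a ∈ A(𝔸)}` is dense in `H²_α`. -/
def IsOuter {q : Ioo (0 : ℝ) 1} {α : ℝ} (g : H2 q α) : Prop :=
  Dense {k : H2 q α | ∃ a ∈ annulusAlgebra q,
    ∀ᵐ z ∂boundaryMeasure q, (k : BoundaryL2 q) z = a z * (g : BoundaryL2 q) z}

/-- The identity `φ |g|² = c log |χ q^{-1/2}|` almost everywhere on `B`, where `χ(z) = z`. -/
def LogIdentity {q : ℝ} (φ : Lp ℝ ∞ (boundaryMeasure q)) (g : BoundaryL2 q) (c : ℝ) : Prop :=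
  ∀ᵐ z ∂boundaryMeasure q,
    φ z * ‖g z‖ ^ 2 = c * Real.log ‖z * ((q ^ (-(1 / 2) : ℝ) : ℝ) : ℂ)‖

/-- The number `(4π log q)⁻¹ (∫_{|z|=1} log |φ| dμ₁ - ∫_{|z|=q} log |φ| dμ_q)`. -/
def logMean {q : ℝ} (φ : Lp ℝ ∞ (boundaryMeasure q)) : ℝ :=
  1 / (4 * Real.pi * Real.log q) *
    ((∫ z, Real.log |φ z| ∂circleMeasure 1) - ∫ z, Real.log |φ z| ∂circleMeasure q)

end SarasonAnnulus

end

noncomputable section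

namespace SarasonAnnulus

/-! Everything is done with Fourier coefficients on the two circles. By `mem_H2_iff`, membership in
`H²_α` means that the coefficient of order `n + α` on the inner circle is `q ^ (n + α)` times the
one on the outer circle.

Let `T g = 0`, so that `φ g` is orthogonal to `H²_α`. The functions `z ^ n g` lie in `H²_α`; testing
against them shows that the coefficients `A n`, `B n` of `φ |g|²` on the outer and inner circle
satisfy `A n + q ^ n * B n = 0`. Since `φ |g|²` is real, conjugation gives the same relation with `q
^ (-n)`. Hence `A n = B n = 0` for `n ≠ 0` and `A 0 = -B 0`: the function `φ |g|²` takes opposite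
constant values on the two circles, and this is the logarithmic identity (`exists_logIdentity`).

The constant `c` is nonzero because `c = 0` would give `φ g = 0`, which forces `g = 0`
(`eq_zero_of_mulSymbol_eq_zero`). For this, consider the closed space of all `k ∈ H²_α` with `φ k =
0`. It is invariant under multiplication by `z ^ n`. If it is nonzero, some point evaluation is
nonzero on it; let `k` represent that evaluation there. Then `|k|²` represents evaluation at an
interior point on all `z ^ n`. Solving for its coefficients shows that they decay exponentially on
each circle, so `|k|²` is real-analytic there and nonzero almost everywhere. Then `φ = 0`, a
contradiction.

With `c ≠ 0`, boundedness of `φ` makes `1 / g` bounded on the boundary, and `φ g` is a constant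
multiple of the reciprocal of the conjugate of `g`, with opposite constants on the two circles.
Orthogonality of `φ g` to `z ^ (n + α)` for all `n` is then exactly the coefficient relation placing
`1 / g` in `H²_{-α}` (`isHardyPair_inv_of_toeplitz`, with converse
`toeplitz_eq_zero_of_isHardyPair_inv`). For such `g`, lying in `H²_{-α}` after inversion is also
equivalent to being outer. In one direction (`isOuter_of_isHardyPair_inv`), `z ^ (m + α) / g` is
bounded, analytic and single valued, hence a weak-* limit of Laurent polynomials, so anything
orthogonal to all `z ^ n g` is orthogonal to all `z ^ (m + α)`. In the other
(`isHardyPair_inv_of_isOuter`), `z ^ α` is a limit of functions `a g`, and division by `g` carries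
the relation from `a` to `z ^ α / g`.

The index is read off from a logarithm. If `g` and `1 / g` are both of Hardy class, the lift of `g`
has an analytic logarithm whose increment over one turn is `2πi (α + N)`. Therefore the mean of `log
|g|` over a circle is affine in `log r` with slope `2π (α + N)`; passing to the boundary
(`exists_integral_log_sub`) and inserting `log |φ| = const - 2 log |g|` gives the formula, and with
it uniqueness of `α`. Finally, the logarithmic identity holds for all elements of the kernel, so
polarization shows that the quotient of two of them is constant (`mem_span_of_toeplitz`). -/

/-! ### Fejér means, weak-* approximation and uniqueness of Fourier coefficients. -/

/-- The `N`-th Fejér mean of the Fourier series of `u`. -/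
def fejer (u : ℝ → ℂ) (N : ℕ) (t : ℝ) : ℂ :=
  (2 * Real.pi * (N + 1) : ℂ)⁻¹ * ∑ j ∈ Finset.range (N + 1), ∑ k ∈ Finset.range (N + 1),
    coef 0 ((j : ℤ) - k) u * Complex.exp (((j : ℤ) - k : ℤ) * t * Complex.I)

/-- The Fejér kernel, up to normalization. -/
def fejerKernel (N : ℕ) (x : ℝ) : ℝ :=
  ‖∑ j ∈ Finset.range (N + 1), Complex.exp (j * x * Complex.I)‖ ^ 2

theorem fejerKernel_eq (N : ℕ) (x : ℝ) : (fejerKernel N x : ℂ) =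
    ∑ j ∈ Finset.range (N + 1), ∑ k ∈ Finset.range (N + 1),
      Complex.exp (((j : ℤ) - k : ℤ) * x * Complex.I) := by
  rw [fejerKernel, Complex.ofReal_pow, ← Complex.mul_conj', map_sum, Finset.sum_mul_sum]
  refine Finset.sum_congr rfl fun j _ ↦ Finset.sum_congr rfl fun k _ ↦ ?_
  rw [← Complex.exp_conj, ← Complex.exp_add]
  congr 1
  simp only [map_mul, Complex.conj_I, Complex.conj_ofReal, Complex.conj_natCast]
  push_cast
  ring

theorem continuous_fejerKernel (N : ℕ) : Continuous (fejerKernel N) := by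
  unfold fejerKernel
  fun_prop

theorem integrable_phase {u : ℝ → ℂ} (a : ℝ) (hu : Integrable u angleMeasure) :
    Integrable (fun t : ℝ ↦ Complex.exp (-(a : ℂ) * t * Complex.I) * u t) angleMeasure := by
  refine hu.mono ((Continuous.aestronglyMeasurable (by fun_prop)).mul hu.1) ?_
  exact Eventually.of_forall fun t ↦ by rw [norm_mul, norm_phase, one_mul]

/-- Convolution with a nonnegative kernel is the form of the mean from which the uniform bound
follows. -/
theorem fejer_eq_integral {u : ℝ → ℂ} (hu : Integrable u angleMeasure) (N : ℕ) (t : ℝ) :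
    fejer u N t = (2 * Real.pi * (N + 1) : ℂ)⁻¹ *
      ∫ τ, (fejerKernel N (t - τ) : ℂ) * u τ ∂angleMeasure := by
  rw [fejer]
  congr 1
  simp only [fejerKernel_eq, Finset.sum_mul]
  have key : ∀ j k : ℕ, ∀ τ : ℝ,
      Complex.exp (((j : ℤ) - k : ℤ) * ((t - τ : ℝ) : ℂ) * Complex.I) * u τ =
      Complex.exp (-((((j : ℤ) - k : ℤ) + 0 : ℝ) : ℂ) * τ * Complex.I) * u τ *
        Complex.exp (((j : ℤ) - k : ℤ) * t * Complex.I) := by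
    intro j k τ
    rw [mul_right_comm (Complex.exp (-_ * _ * _)), ← Complex.exp_add]
    congr 2
    push_cast
    ring
  simp only [key]
  have hi : ∀ j k : ℕ, Integrable (fun τ : ℝ ↦
      Complex.exp (-((((j : ℤ) - k : ℤ) + 0 : ℝ) : ℂ) * τ * Complex.I) * u τ *
        Complex.exp (((j : ℤ) - k : ℤ) * t * Complex.I)) angleMeasure :=
    fun j k ↦ (integrable_phase _ hu).mul_const _
  rw [integral_finsetSum _ fun j _ ↦ integrable_finsetSum _ fun k _ ↦ hi j k]
  refine Finset.sum_congr rfl fun j _ ↦ ?_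
  rw [integral_finsetSum _ fun k _ ↦ hi j k]
  refine Finset.sum_congr rfl fun k _ ↦ ?_
  rw [integral_mul_const]
  rfl

theorem coef_exp (n m : ℤ) :
    coef 0 n (fun t ↦ Complex.exp ((m : ℂ) * t * Complex.I)) =
      if m = n then (2 * Real.pi : ℂ) else 0 := by
  have h := integral_phase (m - n)
  simp only [sub_eq_zero] at h
  rw [← h, coef]
  refine integral_congr_ae (Eventually.of_forall fun t ↦ ?_)
  simp only
  rw [← Complex.exp_add]
  congr 1
  push_cast
  ring

theorem fejer_one (N : ℕ) (t : ℝ) : fejer (fun _ ↦ 1) N t = 1 := by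
  have h1 : ∀ n : ℤ, coef 0 n (fun _ ↦ 1) = if 0 = n then (2 * Real.pi : ℂ) else 0 := by
    intro n
    have := coef_exp n 0
    simpa using this
  have hp : (Real.pi : ℂ) ≠ 0 := by exact_mod_cast Real.pi_ne_zero
  have hN : (N + 1 : ℂ) ≠ 0 := by exact_mod_cast Nat.succ_ne_zero N
  rw [fejer]
  have : ∀ j ∈ Finset.range (N + 1), ∑ k ∈ Finset.range (N + 1),
      coef 0 ((j : ℤ) - k) (fun _ ↦ 1) * Complex.exp (((j : ℤ) - k : ℤ) * t * Complex.I) =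
      (2 * Real.pi : ℂ) := by
    intro j hj
    rw [Finset.sum_eq_single_of_mem j hj]
    · simp [h1]
    · intro k _ hk
      rw [h1, if_neg, zero_mul]
      omega
  rw [Finset.sum_congr rfl this]
  simp only [Finset.sum_const, Finset.card_range, nsmul_eq_mul]
  push_cast
  field_simp

/-- The kernel is nonnegative and, by `fejer_one`, has mean one after normalization, so the mean is
an average of values of `u`. -/
theorem norm_fejer_le {u : ℝ → ℂ} (hu : Integrable u angleMeasure) {C : ℝ}
    (hC : ∀ᵐ t ∂angleMeasure, ‖u t‖ ≤ C) (N : ℕ) (t : ℝ) : ‖fejer u N t‖ ≤ C := by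
  have h1 := fejer_eq_integral (integrable_const (1 : ℂ)) N t
  rw [fejer_one] at h1
  have hkc : Continuous fun τ ↦ fejerKernel N (t - τ) :=
    (continuous_fejerKernel N).comp (by fun_prop)
  have hk0 : ∀ x, 0 ≤ fejerKernel N x := fun x ↦ by unfold fejerKernel; positivity
  have hki : Integrable (fun τ ↦ fejerKernel N (t - τ)) angleMeasure :=
    (hkc.integrableOn_Icc (a := 0) (b := 2 * Real.pi)).mono_set Ioc_subset_Icc_self
  have hc : ((2 * Real.pi * (N + 1) : ℂ)⁻¹) = (((2 * Real.pi * (N + 1))⁻¹ : ℝ) : ℂ) := by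
    push_cast; rfl
  have hpos : (0 : ℝ) ≤ (2 * Real.pi * (N + 1))⁻¹ := by positivity
  simp only [mul_one] at h1
  rw [hc, integral_complex_ofReal, ← Complex.ofReal_mul] at h1
  have h1' : (2 * Real.pi * (N + 1))⁻¹ * ∫ τ, fejerKernel N (t - τ) ∂angleMeasure = 1 := by
    exact_mod_cast h1.symm
  rw [fejer_eq_integral hu, hc, norm_mul, Complex.norm_real, Real.norm_of_nonneg hpos]
  have h2 : ‖∫ τ, (fejerKernel N (t - τ) : ℂ) * u τ ∂angleMeasure‖ ≤
      ∫ τ, fejerKernel N (t - τ) * C ∂angleMeasure := by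
    refine norm_integral_le_of_norm_le (hki.mul_const C) ?_
    filter_upwards [hC] with τ hτ
    rw [norm_mul, Complex.norm_real, Real.norm_of_nonneg (hk0 _)]
    exact mul_le_mul_of_nonneg_left hτ (hk0 _)
  rw [integral_mul_const] at h2
  calc _ ≤ (2 * Real.pi * (N + 1))⁻¹ * ((∫ τ, fejerKernel N (t - τ) ∂angleMeasure) * C) :=
        mul_le_mul_of_nonneg_left h2 hpos
    _ = C := by rw [← mul_assoc, h1', one_mul]

/-- The multiplier of the `n`-th Fourier coefficient in the `N`-th Fejér mean. -/
def fejerWeight (N : ℕ) (n : ℤ) : ℝ :=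
  (∑ j ∈ Finset.range (N + 1), ∑ k ∈ Finset.range (N + 1),
    if (j : ℤ) - k = n then (1 : ℝ) else 0) / (N + 1)

theorem coef_fejer (u : ℝ → ℂ) (N : ℕ) (n : ℤ) :
    coef 0 n (fejer u N) = fejerWeight N n * coef 0 n u := by
  have hp : (Real.pi : ℂ) ≠ 0 := by exact_mod_cast Real.pi_ne_zero
  have hN : (N + 1 : ℂ) ≠ 0 := by exact_mod_cast Nat.succ_ne_zero N
  have e : ∀ t : ℝ, Complex.exp (-((n + 0 : ℝ) : ℂ) * t * Complex.I) * fejer u N t =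
      ∑ j ∈ Finset.range (N + 1), ∑ k ∈ Finset.range (N + 1),
      (2 * Real.pi * (N + 1) : ℂ)⁻¹ * coef 0 ((j : ℤ) - k) u *
      (Complex.exp (-((n + 0 : ℝ) : ℂ) * t * Complex.I) *
        Complex.exp (((j : ℤ) - k : ℤ) * t * Complex.I)) := by
    intro t
    simp only [fejer, Finset.mul_sum]
    refine Finset.sum_congr rfl fun j _ ↦ Finset.sum_congr rfl fun k _ ↦ ?_
    ring
  have hi : ∀ j k : ℕ, Integrable (fun t : ℝ ↦
      (2 * Real.pi * (N + 1) : ℂ)⁻¹ * coef 0 ((j : ℤ) - k) u *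
      (Complex.exp (-((n + 0 : ℝ) : ℂ) * t * Complex.I) *
        Complex.exp (((j : ℤ) - k : ℤ) * t * Complex.I))) angleMeasure := by
    intro j k
    have hc : Continuous (fun t : ℝ ↦
      (2 * Real.pi * (N + 1) : ℂ)⁻¹ * coef 0 ((j : ℤ) - k) u *
      (Complex.exp (-((n + 0 : ℝ) : ℂ) * t * Complex.I) *
        Complex.exp (((j : ℤ) - k : ℤ) * t * Complex.I))) := by fun_prop
    exact (hc.integrableOn_Icc (a := 0) (b := 2 * Real.pi)).mono_set Ioc_subset_Icc_self
  rw [coef]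
  simp only [e]
  rw [integral_finsetSum _ fun j _ ↦ integrable_finsetSum _ fun k _ ↦ hi j k, fejerWeight,
    Complex.ofReal_div, Complex.ofReal_sum, Finset.sum_div, Finset.sum_mul]
  refine Finset.sum_congr rfl fun j _ ↦ ?_
  rw [integral_finsetSum _ fun k _ ↦ hi j k, Complex.ofReal_sum, Finset.sum_div, Finset.sum_mul]
  refine Finset.sum_congr rfl fun k _ ↦ ?_
  rw [integral_const_mul]
  have := coef_exp n ((j : ℤ) - k)
  rw [coef] at this
  push_cast at this ⊢
  rw [this]
  split_ifs with h
  · rw [h, Complex.ofReal_one]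
    field_simp
  · simp

/-- The weight is the proportion of those `j` in `0, …, N` for which `j - n` is again in this range;
at most `|n|` of them fail. -/
theorem fejerWeight_mem (N : ℕ) (n : ℤ) :
    fejerWeight N n ≤ 1 ∧ 1 - |(n : ℝ)| / (N + 1) ≤ fejerWeight N n := by
  have hN : (0 : ℝ) < N + 1 := by positivity
  have h1 : ∀ j ∈ Finset.range (N + 1), (∑ k ∈ Finset.range (N + 1),
      if (j : ℤ) - k = n then (1 : ℝ) else 0) =
      if 0 ≤ (j : ℤ) - n ∧ (j : ℤ) - n < N + 1 then 1 else 0 := by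
    intro j _
    split_ifs with h
    · rw [Finset.sum_eq_single_of_mem ((j : ℤ) - n).toNat (Finset.mem_range.2 (by omega))]
      · rw [if_pos (by omega)]
      · intro k _ hk
        rw [if_neg (by omega)]
    · refine Finset.sum_eq_zero fun k hk ↦ ?_
      have := Finset.mem_range.1 hk
      rw [if_neg (by omega)]
  rw [fejerWeight, Finset.sum_congr rfl h1]
  constructor
  · rw [div_le_one hN]
    refine (Finset.sum_le_card_nsmul _ _ 1 fun j _ ↦ ?_).trans (by simp)
    split_ifs <;> norm_num
  · rw [le_div_iff₀ hN, sub_mul, one_mul, div_mul_cancel₀ _ hN.ne', sub_le_comm]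
    have h2 : (N + 1 : ℝ) - ∑ j ∈ Finset.range (N + 1),
        (if 0 ≤ (j : ℤ) - n ∧ (j : ℤ) - n < N + 1 then (1 : ℝ) else 0) =
        ∑ j ∈ Finset.range (N + 1),
        (if 0 ≤ (j : ℤ) - n ∧ (j : ℤ) - n < N + 1 then (0 : ℝ) else 1) := by
      rw [sub_eq_iff_eq_add, ← Finset.sum_add_distrib]
      have : ∀ j ∈ Finset.range (N + 1),
        ((if 0 ≤ (j : ℤ) - n ∧ (j : ℤ) - n < N + 1 then (0 : ℝ) else 1) +
        (if 0 ≤ (j : ℤ) - n ∧ (j : ℤ) - n < N + 1 then (1 : ℝ) else 0)) = 1 := by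
        intro j _
        split_ifs <;> norm_num
      rw [Finset.sum_congr rfl this]
      simp
    rw [h2]
    have h3 : ∀ j : ℕ, (if 0 ≤ (j : ℤ) - n ∧ (j : ℤ) - n < N + 1 then (0 : ℝ) else 1) =
      if ¬(0 ≤ (j : ℤ) - n ∧ (j : ℤ) - n < N + 1) then (1 : ℝ) else 0 := by
      intro j
      rw [ite_not]
    simp only [h3]
    rw [Finset.sum_boole]
    have h4 : ((Finset.range (N + 1)).filter
        (fun j : ℕ ↦ ¬(0 ≤ (j : ℤ) - n ∧ (j : ℤ) - n < N + 1))).card ≤ n.natAbs := by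
      rcases le_total 0 n with h | h
      · calc _ ≤ (Finset.range n.natAbs).card := by
              refine Finset.card_le_card fun j hj ↦ ?_
              simp only [Finset.mem_filter, Finset.mem_range] at hj ⊢
              omega
          _ = _ := Finset.card_range _
      · calc _ ≤ (Finset.Ico (N + 1 - n.natAbs) (N + 1)).card := by
              refine Finset.card_le_card fun j hj ↦ ?_
              simp only [Finset.mem_filter, Finset.mem_range, Finset.mem_Ico] at hj ⊢
              omega
          _ ≤ _ := by rw [Nat.card_Ico]; omega
    rw [← Int.cast_abs, ← Int.natCast_natAbs]
    exact_mod_cast h4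

theorem tendsto_fejerWeight (n : ℤ) : Tendsto (fun N ↦ fejerWeight N n) atTop (𝓝 1) := by
  have h : Tendsto (fun N : ℕ ↦ 1 - |(n : ℝ)| * (1 / ((N : ℝ) + 1))) atTop
      (𝓝 (1 - |(n : ℝ)| * 0)) :=
    tendsto_const_nhds.sub (tendsto_one_div_add_atTop_nhds_zero_nat.const_mul _)
  rw [mul_zero, sub_zero] at h
  refine tendsto_of_tendsto_of_tendsto_of_le_of_le h tendsto_const_nhds (fun N ↦ ?_)
    fun N ↦ (fejerWeight_mem N n).1
  have := (fejerWeight_mem N n).2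
  rwa [div_eq_mul_one_div] at this

theorem fejerWeight_nonneg (N : ℕ) (n : ℤ) : 0 ≤ fejerWeight N n := by
  unfold fejerWeight
  refine div_nonneg (Finset.sum_nonneg fun j _ ↦ Finset.sum_nonneg fun k _ ↦ ?_) (by positivity)
  split_ifs <;> norm_num

theorem continuous_fejer (u : ℝ → ℂ) (N : ℕ) : Continuous (fejer u N) := by
  unfold fejer
  fun_prop

theorem memLp_of_continuous {u : ℝ → ℂ} (hu : Continuous u) : MemLp u 2 angleMeasure := by
  obtain ⟨C, hC⟩ := (isCompact_Icc (a := (0 : ℝ)) (b := 2 * Real.pi)).exists_bound_of_continuousOn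
    hu.continuousOn
  refine MemLp.of_bound hu.aestronglyMeasurable C ?_
  filter_upwards [ae_restrict_mem measurableSet_Ioc] with t ht
  exact hC t ⟨ht.1.le, ht.2⟩

/-- Parseval turns the error into `∑ (weight - 1)² |coef|²`; each weight tends to one, and the
squares of the coefficients dominate. -/
theorem tendsto_eLpNorm_fejer {u : ℝ → ℂ} (hu : MemLp u 2 angleMeasure) :
    Tendsto (fun N ↦ eLpNorm (fejer u N - u) 2 angleMeasure) atTop (𝓝 0) := by
  have hp := Real.pi_pos
  have hT : Tendsto (fun N ↦ ∑' n : ℤ, (fejerWeight N n - 1) ^ 2 * ‖coef 0 n u‖ ^ 2) atTop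
      (𝓝 (∑' _ : ℤ, (0 : ℝ))) := by
    refine tendsto_tsum_of_dominated_convergence (bound := fun n ↦ ‖coef 0 n u‖ ^ 2)
      (hasSum_coef 0 hu).summable (fun n ↦ ?_) (Eventually.of_forall fun N n ↦ ?_)
    · have := (((tendsto_fejerWeight n).sub_const 1).pow 2).mul_const (‖coef 0 n u‖ ^ 2)
      simpa using this
    · rw [Real.norm_of_nonneg (by positivity)]
      refine mul_le_of_le_one_left (by positivity) ?_
      have h1 := fejerWeight_nonneg N n
      have h2 := (fejerWeight_mem N n).1
      nlinarith
  rw [tsum_zero] at hT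
  have hI : Tendsto (fun N ↦ ∫ t, ‖(fejer u N - u) t‖ ^ 2 ∂angleMeasure) atTop (𝓝 0) := by
    have h2 := hT.const_mul (2 * Real.pi)⁻¹
    rw [mul_zero] at h2
    refine h2.congr fun N ↦ ?_
    have hm := memLp_of_continuous (continuous_fejer u N)
    have h3 := (hasSum_coef 0 (hm.sub hu)).tsum_eq
    have h4 : ∀ n, ‖coef 0 n (fejer u N - u)‖ ^ 2 =
        (fejerWeight N n - 1) ^ 2 * ‖coef 0 n u‖ ^ 2 := by
      intro n
      have := coef_sub 0 n hm hu
      rw [coef_fejer] at this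
      change ‖coef 0 n (fun t ↦ fejer u N t - u t)‖ ^ 2 = _
      rw [this, ← sub_one_mul, norm_mul, mul_pow]
      congr 1
      rw [← Complex.ofReal_one, ← Complex.ofReal_sub, Complex.norm_real, Real.norm_eq_abs, sq_abs]
    simp only [h4] at h3
    rw [h3, ← mul_assoc, inv_mul_cancel₀ (by positivity), one_mul]
  have hR := hI.rpow_const (p := (2 : ℝ)⁻¹) (Or.inr (by norm_num))
  have hE := ENNReal.tendsto_ofReal hR
  rw [Real.zero_rpow (by norm_num), ENNReal.ofReal_zero] at hE
  exact hE.congr fun N ↦ (eLpNorm_eq ((memLp_of_continuous (continuous_fejer u N)).sub hu)).symm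

/-- Fejér means of a bounded function converge to it in the weak-* topology of `L^∞`. -/
theorem tendsto_integral_fejer_mul {u w : ℝ → ℂ} (hu : AEStronglyMeasurable u angleMeasure)
    {C : ℝ} (hC : ∀ᵐ t ∂angleMeasure, ‖u t‖ ≤ C) (hw : Integrable w angleMeasure) :
    Tendsto (fun N ↦ ∫ t, fejer u N t * w t ∂angleMeasure) atTop
      (𝓝 (∫ t, u t * w t ∂angleMeasure)) := by
  have hu2 : MemLp u 2 angleMeasure := MemLp.of_bound hu C hC
  -- Convergence in `L²` yields almost everywhere convergence only along a subsequence, but this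
  -- suffices to identify the limit; the uniform bound on Fejér means then gives dominated
  -- convergence.
  refine tendsto_of_subseq_tendsto fun ns hns ↦ ?_
  have h1 := (tendsto_eLpNorm_fejer hu2).comp hns
  have h2 : TendstoInMeasure angleMeasure (fun k ↦ fejer u (ns k)) atTop u :=
    tendstoInMeasure_of_tendsto_eLpNorm (by norm_num)
      (fun k ↦ (continuous_fejer u (ns k)).aestronglyMeasurable) hu h1
  obtain ⟨ms, -, hms⟩ := h2.exists_seq_tendsto_ae
  refine ⟨ms, tendsto_integral_of_dominated_convergence (fun t ↦ C * ‖w t‖)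
    (fun k ↦ (continuous_fejer u _).aestronglyMeasurable.mul hw.1) (hw.norm.const_mul C)
    (fun k ↦ Eventually.of_forall fun t ↦ ?_) ?_⟩
  · rw [norm_mul]
    exact mul_le_mul_of_nonneg_right
      (norm_fejer_le (hu2.integrable (by norm_num)) hC _ _) (norm_nonneg _)
  · filter_upwards [hms] with t ht using ht.mul_const _

/-- The pairing of a Fejér mean with an integrable function sees only Fourier coefficients, so
linear relations between coefficients pass to integrals in the limit. -/
theorem integral_fejer_mul (u : ℝ → ℂ) {w : ℝ → ℂ} (hw : Integrable w angleMeasure) (N : ℕ) :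
    ∫ t, fejer u N t * w t ∂angleMeasure =
    (2 * Real.pi * (N + 1) : ℂ)⁻¹ * ∑ j ∈ Finset.range (N + 1), ∑ k ∈ Finset.range (N + 1),
      coef 0 ((j : ℤ) - k) u * coef 0 ((k : ℤ) - j) w := by
  have e : ∀ t : ℝ, fejer u N t * w t = (2 * Real.pi * (N + 1) : ℂ)⁻¹ *
      ∑ j ∈ Finset.range (N + 1), ∑ k ∈ Finset.range (N + 1), coef 0 ((j : ℤ) - k) u *
      (Complex.exp (-((((k : ℤ) - j : ℤ) + 0 : ℝ) : ℂ) * t * Complex.I) * w t) := by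
    intro t
    rw [fejer, mul_assoc, Finset.sum_mul]
    congr 1
    refine Finset.sum_congr rfl fun j _ ↦ ?_
    rw [Finset.sum_mul]
    refine Finset.sum_congr rfl fun k _ ↦ ?_
    rw [mul_assoc]
    congr 3
    push_cast
    ring
  simp only [e]
  have hi : ∀ j k : ℕ, Integrable (fun t : ℝ ↦ coef 0 ((j : ℤ) - k) u *
      (Complex.exp (-((((k : ℤ) - j : ℤ) + 0 : ℝ) : ℂ) * t * Complex.I) * w t)) angleMeasure :=
    fun j k ↦ (integrable_phase _ hw).const_mul _
  rw [integral_const_mul, integral_finsetSum _ fun j _ ↦ integrable_finsetSum _ fun k _ ↦ hi j k]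
  congr 1
  refine Finset.sum_congr rfl fun j _ ↦ ?_
  rw [integral_finsetSum _ fun k _ ↦ hi j k]
  refine Finset.sum_congr rfl fun k _ ↦ ?_
  rw [integral_const_mul]
  rfl

/-- All pairings with Fejér means of an indicator vanish, hence so does the integral of `w` over
every measurable set. -/
theorem ae_eq_zero_of_coef_eq_zero {w : ℝ → ℂ} (hw : Integrable w angleMeasure)
    (h : ∀ n, coef 0 n w = 0) : w =ᵐ[angleMeasure] 0 := by
  refine hw.ae_eq_zero_of_forall_setIntegral_eq_zero fun s hs _ ↦ ?_
  have hb : ∀ᵐ t ∂angleMeasure, ‖s.indicator (fun _ ↦ (1 : ℂ)) t‖ ≤ 1 :=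
    Eventually.of_forall fun t ↦ (norm_indicator_le_norm_self _ _).trans (by simp)
  have h1 := tendsto_integral_fejer_mul
    (aestronglyMeasurable_const.indicator hs) hb hw
  simp only [integral_fejer_mul _ hw, h, mul_zero, Finset.sum_const_zero] at h1
  have h2 := tendsto_nhds_unique h1 tendsto_const_nhds
  rw [← integral_indicator hs, ← h2]
  refine integral_congr_ae (Eventually.of_forall fun t ↦ ?_)
  by_cases ht : t ∈ s <;> simp [ht]

theorem coef_sub_of_integrable {u v : ℝ → ℂ} (α : ℝ) (n : ℤ) (hu : Integrable u angleMeasure)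
    (hv : Integrable v angleMeasure) :
    coef α n (fun t ↦ u t - v t) = coef α n u - coef α n v := by
  rw [coef, coef, coef, ← integral_sub (integrable_phase _ hu) (integrable_phase _ hv)]
  simp only [mul_sub]

theorem ae_eq_of_coef_eq {u v : ℝ → ℂ} (hu : Integrable u angleMeasure)
    (hv : Integrable v angleMeasure) (h : ∀ n, coef 0 n u = coef 0 n v) :
    u =ᵐ[angleMeasure] v := by
  filter_upwards [ae_eq_zero_of_coef_eq_zero (hu.sub hv) fun n ↦ by
    have := coef_sub_of_integrable 0 n hu hv
    rw [h n, sub_self] at this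
    exact this] with t ht
  exact sub_eq_zero.1 ht

/-! ### Products of two functions of Hardy class. -/

theorem eLpNorm_one_mul_le {f g : ℝ → ℂ} (hf : AEStronglyMeasurable f angleMeasure)
    (hg : AEStronglyMeasurable g angleMeasure) :
    eLpNorm (fun t ↦ f t * g t) 1 angleMeasure ≤
      eLpNorm f 2 angleMeasure * eLpNorm g 2 angleMeasure := by
  have h := eLpNorm_smul_le_mul_eLpNorm (p := 2) (q := 2) (r := 1) hg hf
  exact h

/-- Cauchy–Schwarz applied to `fg - uv = (f - u)(g - v) + (f - u)v + (g - v)u`. -/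
theorem tendsto_eLpNorm_one_mul {ι : Type*} {l : Filter ι} {f g : ι → ℝ → ℂ} {u v : ℝ → ℂ}
    (hf : ∀ᶠ i in l, MemLp (f i) 2 angleMeasure) (hg : ∀ᶠ i in l, MemLp (g i) 2 angleMeasure)
    (hu : MemLp u 2 angleMeasure) (hv : MemLp v 2 angleMeasure)
    (h₁ : Tendsto (fun i ↦ eLpNorm (fun t ↦ f i t - u t) 2 angleMeasure) l (𝓝 0))
    (h₂ : Tendsto (fun i ↦ eLpNorm (fun t ↦ g i t - v t) 2 angleMeasure) l (𝓝 0)) :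
    Tendsto (fun i ↦ eLpNorm (fun t ↦ f i t * g i t - u t * v t) 1 angleMeasure) l (𝓝 0) := by
  have h : Tendsto (fun i ↦ eLpNorm (fun t ↦ f i t - u t) 2 angleMeasure *
      eLpNorm (fun t ↦ g i t - v t) 2 angleMeasure +
      eLpNorm (fun t ↦ f i t - u t) 2 angleMeasure * eLpNorm v 2 angleMeasure +
      eLpNorm (fun t ↦ g i t - v t) 2 angleMeasure * eLpNorm u 2 angleMeasure) l
      (𝓝 (0 * 0 + 0 * eLpNorm v 2 angleMeasure + 0 * eLpNorm u 2 angleMeasure)) :=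
    ((ENNReal.Tendsto.mul h₁ (Or.inr (by simp)) h₂ (Or.inr (by simp))).add
      (ENNReal.Tendsto.mul_const h₁ (Or.inr hv.2.ne))).add
      (ENNReal.Tendsto.mul_const h₂ (Or.inr hu.2.ne))
  simp only [zero_mul, add_zero] at h
  refine tendsto_of_tendsto_of_tendsto_of_le_of_le' tendsto_const_nhds h
    (Eventually.of_forall fun _ ↦ zero_le) ?_
  filter_upwards [hf, hg] with i hfi hgi
  have hF : AEStronglyMeasurable (fun t ↦ f i t - u t) angleMeasure := hfi.1.sub hu.1
  have hG : AEStronglyMeasurable (fun t ↦ g i t - v t) angleMeasure := hgi.1.sub hv.1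
  have e : (fun t ↦ f i t * g i t - u t * v t) =
      ((fun t ↦ (f i t - u t) * (g i t - v t)) + (fun t ↦ (f i t - u t) * v t)) +
        fun t ↦ (g i t - v t) * u t := by
    ext t
    simp only [Pi.add_apply]
    ring
  rw [e]
  refine (eLpNorm_add_le ((hF.mul hG).add (hF.mul hv.1)) (hG.mul hu.1) le_rfl).trans ?_
  refine add_le_add ((eLpNorm_add_le (hF.mul hG) (hF.mul hv.1) le_rfl).trans ?_)
    (eLpNorm_one_mul_le hG hu.1)
  exact add_le_add (eLpNorm_one_mul_le hF hG) (eLpNorm_one_mul_le hF hv.1)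

theorem tendsto_coef_of_L1 {ι : Type*} {l : Filter ι} {f : ι → ℝ → ℂ} {u : ℝ → ℂ} (α : ℝ) (n : ℤ)
    (hf : ∀ᶠ i in l, Integrable (f i) angleMeasure) (hu : Integrable u angleMeasure)
    (h : Tendsto (fun i ↦ eLpNorm (fun t ↦ f i t - u t) 1 angleMeasure) l (𝓝 0)) :
    Tendsto (fun i ↦ coef α n (f i)) l (𝓝 (coef α n u)) := by
  refine tendsto_integral_of_L1' _ (integrable_phase _ hu).1 ?_ ?_
  · exact hf.mono fun i hi ↦ integrable_phase _ hi
  refine h.congr fun i ↦ eLpNorm_congr_norm_ae (Eventually.of_forall fun t ↦ ?_)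
  simp only [Pi.sub_apply]
  rw [← mul_sub, norm_mul, norm_phase, one_mul]

theorem HasIndex.mul {q α β : ℝ} {F H : ℂ → ℂ} (hF : HasIndex q F α) (hH : HasIndex q H β) :
    HasIndex q (fun w ↦ F w * H w) (α + β) := by
  intro w hw
  simp only
  rw [hF w hw, hH w hw]
  push_cast
  rw [mul_add, Complex.exp_add]
  ring

/-- The coefficient of the slice at `s` in terms of its limit at the outer circle. -/
theorem coef_slice_of_tendsto {q : ℝ} (hq : q ∈ Ioo (0 : ℝ) 1) {α : ℝ} {F : ℂ → ℂ}
    (hF : DifferentiableOn ℂ F (coverStrip q)) (hα : HasIndex q F α) {n : ℤ} {A : ℂ}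
    (h : Tendsto (fun s : ℝ ↦ coef α n (fun t ↦ F (s + t * Complex.I))) (𝓝[<] 0) (𝓝 A)) {s : ℝ}
    (hs : s ∈ Ioo (Real.log q) 0) :
    coef α n (fun t ↦ F (s + t * Complex.I)) = Complex.exp (((n + α : ℝ) : ℂ) * s) * A := by
  have hL := Real.log_neg hq.1 hq.2
  have hc : Continuous fun s : ℝ ↦ Complex.exp (-((n + α : ℝ) : ℂ) * s) := by fun_prop
  have h1 := ((hc.tendsto 0).mono_left nhdsWithin_le_nhds).mul h
  have e1 : Complex.exp (-((n + α : ℝ) : ℂ) * (0 : ℝ)) * A =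
      Complex.exp (-((n + α : ℝ) : ℂ) * s) * coef α n (fun t ↦ F (s + t * Complex.I)) := by
    refine tendsto_nhds_unique h1 (Tendsto.congr' ?_ tendsto_const_nhds)
    filter_upwards [Ioo_mem_nhdsLT hL] with s' hs'
    exact coef_slice_const hF hα n hs hs'
  rw [Complex.ofReal_zero, mul_zero, Complex.exp_zero, one_mul] at e1
  rw [e1, ← mul_assoc, ← Complex.exp_add, neg_mul, add_neg_cancel, Complex.exp_zero, one_mul]

/-- Only the limits of a single coefficient enter. The relation is therefore available for products,
whose boundary values converge merely in `L¹`, and for the annulus algebra. -/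
theorem coef_relation_of_tendsto {q : ℝ} (hq : q ∈ Ioo (0 : ℝ) 1) {α : ℝ} {F : ℂ → ℂ}
    (hF : DifferentiableOn ℂ F (coverStrip q)) (hα : HasIndex q F α) {n : ℤ} {A B : ℂ}
    (h : Tendsto (fun s : ℝ ↦ coef α n (fun t ↦ F (s + t * Complex.I))) (𝓝[<] 0) (𝓝 A))
    (h' : Tendsto (fun s : ℝ ↦ coef α n (fun t ↦ F (s + t * Complex.I)))
      (𝓝[>] (Real.log q)) (𝓝 B)) :
    B = Complex.exp (((n + α : ℝ) : ℂ) * Real.log q) * A := by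
  have hL := Real.log_neg hq.1 hq.2
  have hc : Continuous fun s : ℝ ↦ Complex.exp (((n + α : ℝ) : ℂ) * s) * A := by fun_prop
  refine tendsto_nhds_unique h'
    (((hc.tendsto (Real.log q)).mono_left nhdsWithin_le_nhds).congr' ?_)
  filter_upwards [Ioo_mem_nhdsGT hL] with s hs
  exact (coef_slice_of_tendsto hq hF hα h hs).symm

section Mul

variable {q α β : ℝ} {F H : ℂ → ℂ} {u v x y : ℝ → ℂ}

theorem integrable_mul_of_memLp (hu : MemLp u 2 angleMeasure) (hx : MemLp x 2 angleMeasure) :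
    Integrable (fun t ↦ u t * x t) angleMeasure :=
  memLp_one_iff_integrable.1 (hx.mul hu)

theorem tendsto_coef_mul_outer (hq : q ∈ Ioo (0 : ℝ) 1)
    (hF : DifferentiableOn ℂ F (coverStrip q)) (hH : DifferentiableOn ℂ H (coverStrip q))
    (hu : MemLp u 2 angleMeasure) (hx : MemLp x 2 angleMeasure)
    (h : HasSliceLimits q F u v) (h' : HasSliceLimits q H x y) (γ : ℝ) (n : ℤ) :
    Tendsto (fun s : ℝ ↦ coef γ n (fun t ↦ F (s + t * Complex.I) * H (s + t * Complex.I)))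
      (𝓝[<] 0) (𝓝 (coef γ n fun t ↦ u t * x t)) := by
  have hf := (eventually_strip_zero hq).mono fun s hs ↦ memLp_slice_lift hF hs
  have hh := (eventually_strip_zero hq).mono fun s hs ↦ memLp_slice_lift hH hs
  exact tendsto_coef_of_L1 _ _ ((hf.and hh).mono fun s hs ↦ integrable_mul_of_memLp hs.1 hs.2)
    (integrable_mul_of_memLp hu hx)
    (tendsto_eLpNorm_one_mul hf hh hu hx h.outer_circle h'.outer_circle)

theorem tendsto_coef_mul_inner (hq : q ∈ Ioo (0 : ℝ) 1)
    (hF : DifferentiableOn ℂ F (coverStrip q)) (hH : DifferentiableOn ℂ H (coverStrip q))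
    (hv : MemLp v 2 angleMeasure) (hy : MemLp y 2 angleMeasure)
    (h : HasSliceLimits q F u v) (h' : HasSliceLimits q H x y) (γ : ℝ) (n : ℤ) :
    Tendsto (fun s : ℝ ↦ coef γ n (fun t ↦ F (s + t * Complex.I) * H (s + t * Complex.I)))
      (𝓝[>] (Real.log q)) (𝓝 (coef γ n fun t ↦ v t * y t)) := by
  have hf := (eventually_strip_log hq).mono fun s hs ↦ memLp_slice_lift hF hs
  have hh := (eventually_strip_log hq).mono fun s hs ↦ memLp_slice_lift hH hs
  exact tendsto_coef_of_L1 _ _ ((hf.and hh).mono fun s hs ↦ integrable_mul_of_memLp hs.1 hs.2)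
    (integrable_mul_of_memLp hv hy)
    (tendsto_eLpNorm_one_mul hf hh hv hy h.inner_circle h'.inner_circle)

/-- The product of two functions of Hardy class `H²`, of indices `α` and `β`, satisfies the
coefficient relation of index `α + β`. -/
theorem coef_mul_relation (hq : q ∈ Ioo (0 : ℝ) 1)
    (hu : MemLp u 2 angleMeasure) (hv : MemLp v 2 angleMeasure)
    (hx : MemLp x 2 angleMeasure) (hy : MemLp y 2 angleMeasure)
    (h : ∀ n : ℤ, coef α n v = Complex.exp (((n + α : ℝ) : ℂ) * Real.log q) * coef α n u)
    (h' : ∀ n : ℤ, coef β n y = Complex.exp (((n + β : ℝ) : ℂ) * Real.log q) * coef β n x)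
    (n : ℤ) :
    coef (α + β) n (fun t ↦ v t * y t) =
      Complex.exp (((n + (α + β) : ℝ) : ℂ) * Real.log q) * coef (α + β) n (fun t ↦ u t * x t) := by
  obtain ⟨F, hF, hFα, hFb⟩ := exists_lift hq hu hv h
  obtain ⟨H, hH, hHβ, hHb⟩ := exists_lift hq hx hy h'
  exact coef_relation_of_tendsto hq (hF.mul hH) (hFα.mul hHβ)
    (tendsto_coef_mul_outer hq hF hH hu hx hFb hHb _ n)
    (tendsto_coef_mul_inner hq hF hH hv hy hFb hHb _ n)

end Mul

/-! ### The space `L²(B)` as pairs of functions on the two circles. -/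

/-- The branch of the argument with values in `(0, 2π]`. -/
def angle (z : ℂ) : ℝ := if z.arg ≤ 0 then z.arg + 2 * Real.pi else z.arg

theorem measurable_angle : Measurable angle :=
  Measurable.ite (measurableSet_le Complex.measurable_arg measurable_const)
    (Complex.measurable_arg.add_const _) Complex.measurable_arg

theorem angle_circleMap {r : ℝ} (hr : 0 < r) {t : ℝ} (ht : t ∈ Ioc 0 (2 * Real.pi)) :
    angle (circleMap 0 r t) = t := by
  have hp := Real.pi_pos
  have e : ∀ x : ℝ, circleMap 0 r x = r * (Complex.cos x + Complex.sin x * Complex.I) := by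
    intro x
    rw [circleMap, zero_add, Complex.exp_mul_I]
  rcases le_or_gt t Real.pi with h | h
  · have : (circleMap 0 r t).arg = t := by
      rw [e, Complex.arg_mul_cos_add_sin_mul_I hr ⟨by linarith [ht.1], h⟩]
    rw [angle, this, if_neg (not_le.2 ht.1)]
  · have h1 : circleMap 0 r t = circleMap 0 r (t - 2 * Real.pi) :=
      ((periodic_circleMap 0 r).sub_eq t).symm
    have : (circleMap 0 r t).arg = t - 2 * Real.pi := by
      rw [h1, e, Complex.arg_mul_cos_add_sin_mul_I hr ⟨by linarith, by linarith [ht.2]⟩]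
    rw [angle, this, if_pos (by linarith [ht.2])]
    ring

theorem ae_boundary_of_slices {q : ℝ} {p : ℂ → Prop} (hp : MeasurableSet {z | p z})
    (h1 : ∀ᵐ t ∂angleMeasure, p (circleMap 0 1 t)) (h2 : ∀ᵐ t ∂angleMeasure, p (circleMap 0 q t)) :
    ∀ᵐ z ∂boundaryMeasure q, p z :=
  ae_add_measure_iff.2
    ⟨(ae_map_iff (continuous_circleMap 0 1).aemeasurable hp).2 h1,
      (ae_map_iff (continuous_circleMap 0 q).aemeasurable hp).2 h2⟩

theorem exists_boundaryL2 {q : ℝ} (hq : q ∈ Ioo (0 : ℝ) 1) {u v : ℝ → ℂ}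
    (hu : MemLp u 2 angleMeasure) (hv : MemLp v 2 angleMeasure) :
    ∃ g : BoundaryL2 q, (∀ᵐ t ∂angleMeasure, g (circleMap 0 1 t) = u t) ∧
      ∀ᵐ t ∂angleMeasure, g (circleMap 0 q t) = v t := by
  -- The modulus tells the circles apart because `q ≠ 1`, and measurable representatives make the
  -- glued function Borel.
  set f : ℂ → ℂ := fun z ↦ if ‖z‖ = 1 then hu.1.mk u (angle z) else hv.1.mk v (angle z) with hf
  have hfm : Measurable f :=
    Measurable.ite (measurableSet_eq_fun measurable_norm measurable_const)
      (hu.1.stronglyMeasurable_mk.measurable.comp measurable_angle)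
      (hv.1.stronglyMeasurable_mk.measurable.comp measurable_angle)
  have e1 : ∀ᵐ t ∂angleMeasure, f (circleMap 0 1 t) = u t := by
    filter_upwards [hu.1.ae_eq_mk, ae_restrict_mem measurableSet_Ioc] with t ht ht'
    simp only [hf]
    rw [if_pos (by simp), angle_circleMap one_pos ht', ht]
  have e2 : ∀ᵐ t ∂angleMeasure, f (circleMap 0 q t) = v t := by
    filter_upwards [hv.1.ae_eq_mk, ae_restrict_mem measurableSet_Ioc] with t ht ht'
    simp only [hf]
    rw [if_neg (by simpa [abs_of_pos hq.1] using hq.2.ne), angle_circleMap hq.1 ht', ht]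
  have m1 : MemLp f 2 (circleMeasure 1) :=
    (memLp_map_measure_iff hfm.aestronglyMeasurable (continuous_circleMap 0 1).aemeasurable).2
      (hu.ae_eq (e1.mono fun t ht ↦ ht.symm))
  have m2 : MemLp f 2 (circleMeasure q) :=
    (memLp_map_measure_iff hfm.aestronglyMeasurable (continuous_circleMap 0 q).aemeasurable).2
      (hv.ae_eq (e2.mono fun t ht ↦ ht.symm))
  have m : MemLp f 2 (boundaryMeasure q) := by
    rw [memLp_two_iff_integrable_sq_norm hfm.aestronglyMeasurable]
    exact (m1.integrable_norm_pow two_ne_zero).add_measure (m2.integrable_norm_pow two_ne_zero)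
  refine ⟨m.toLp f, ?_, ?_⟩
  · filter_upwards [e1, ae_slice_one m.coeFn_toLp] with t h1 h2
    rw [h2, h1]
  · filter_upwards [e2, ae_slice_q m.coeFn_toLp] with t h1 h2
    rw [h2, h1]

theorem inner_eq {q : ℝ} (f g : BoundaryL2 q) : inner ℂ f g =
    (∫ t, starRingEnd ℂ (f (circleMap 0 1 t)) * g (circleMap 0 1 t) ∂angleMeasure) +
      ∫ t, starRingEnd ℂ (f (circleMap 0 q t)) * g (circleMap 0 q t) ∂angleMeasure := by
  have hi := L2.integrable_inner (𝕜 := ℂ) f g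
  have hi1 := hi.mono_measure (show circleMeasure 1 ≤ boundaryMeasure q from
    Measure.le_add_right le_rfl)
  have hi2 := hi.mono_measure (show circleMeasure q ≤ boundaryMeasure q from
    Measure.le_add_left le_rfl)
  rw [L2.inner_def]
  refine (integral_add_measure hi1 hi2).trans ?_
  congr 1
  · refine (integral_map (continuous_circleMap 0 1).aemeasurable hi1.1).trans ?_
    simp only [RCLike.inner_apply']
  · refine (integral_map (continuous_circleMap 0 q).aemeasurable hi2.1).trans ?_
    simp only [RCLike.inner_apply']

theorem ext_slices {q : ℝ} {f g : BoundaryL2 q}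
    (h1 : ∀ᵐ t ∂angleMeasure, f (circleMap 0 1 t) = g (circleMap 0 1 t))
    (h2 : ∀ᵐ t ∂angleMeasure, f (circleMap 0 q t) = g (circleMap 0 q t)) : f = g :=
  Lp.ext (ae_boundary_of_slices (measurableSet_eq_fun (Lp.stronglyMeasurable f).measurable
    (Lp.stronglyMeasurable g).measurable) h1 h2)

theorem mulSymbol_ae {q : ℝ} (φ : Lp ℝ ∞ (boundaryMeasure q)) (g : BoundaryL2 q) :
    ∀ᵐ z ∂boundaryMeasure q, mulSymbol φ g z = (φ z : ℂ) * g z := by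
  filter_upwards [Lp.coeFn_lpSMul (r := 2) φ g] with z hz
  change (φ • g : BoundaryL2 q) z = _
  rw [hz]
  simp

theorem toeplitz_eq_zero_iff {q : Ioo (0 : ℝ) 1} {α : ℝ} {φ : Lp ℝ ∞ (boundaryMeasure q)}
    {g : H2 q α} : toeplitz q α φ g = 0 ↔
      ∀ k ∈ H2 q α, inner ℂ k (mulSymbol φ (g : BoundaryL2 q)) = 0 := by
  rw [toeplitz, ContinuousLinearMap.comp_apply, ContinuousLinearMap.comp_apply,
    Submodule.orthogonalProjectionOnto_eq_zero_iff, Submodule.mem_orthogonal]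
  rfl

theorem inner_mulSymbol {q : ℝ} (φ : Lp ℝ ∞ (boundaryMeasure q)) (k g : BoundaryL2 q) :
    inner ℂ k (mulSymbol φ g) =
    (∫ t, starRingEnd ℂ (k (circleMap 0 1 t)) * (φ (circleMap 0 1 t) * g (circleMap 0 1 t))
      ∂angleMeasure) +
      ∫ t, starRingEnd ℂ (k (circleMap 0 q t)) * (φ (circleMap 0 q t) * g (circleMap 0 q t))
        ∂angleMeasure := by
  rw [inner_eq]
  congr 1
  · refine integral_congr_ae ?_
    filter_upwards [ae_slice_one (mulSymbol_ae φ g)] with t ht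
    rw [ht]
  · refine integral_congr_ae ?_
    filter_upwards [ae_slice_q (mulSymbol_ae φ g)] with t ht
    rw [ht]

/-! ### Hardy pairs and multiplication by powers of `z`. -/

/-- `(u, v)` are boundary values on the outer and inner circle of a function in `H²_α`, expressed
through Fourier coefficients. -/
structure IsHardyPair (q α : ℝ) (u v : ℝ → ℂ) : Prop where
  memLp_outer : MemLp u 2 angleMeasure
  memLp_inner : MemLp v 2 angleMeasure
  coef_eq : ∀ n : ℤ, coef α n v = Complex.exp (((n + α : ℝ) : ℂ) * Real.log q) * coef α n u

theorem isHardyPair_slices {q : Ioo (0 : ℝ) 1} {α : ℝ} {g : BoundaryL2 q} (hg : g ∈ H2 q α) :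
    IsHardyPair q α (fun t ↦ g (circleMap 0 1 t)) (fun t ↦ g (circleMap 0 q t)) :=
  ⟨memLp_slice_one g, memLp_slice_q g, mem_H2_iff.1 hg⟩

theorem coef_congr {α : ℝ} {n : ℤ} {u v : ℝ → ℂ} (h : u =ᵐ[angleMeasure] v) :
    coef α n u = coef α n v := by
  refine integral_congr_ae ?_
  filter_upwards [h] with t ht
  rw [ht]

theorem IsHardyPair.exists_mem {q : Ioo (0 : ℝ) 1} {α : ℝ} {u v : ℝ → ℂ}
    (h : IsHardyPair q α u v) :
    ∃ g ∈ H2 q α, (∀ᵐ t ∂angleMeasure, g (circleMap 0 1 t) = u t) ∧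
      ∀ᵐ t ∂angleMeasure, g (circleMap 0 q t) = v t := by
  obtain ⟨g, h1, h2⟩ := exists_boundaryL2 q.2 h.memLp_outer h.memLp_inner
  refine ⟨g, mem_H2_iff.2 fun n ↦ ?_, h1, h2⟩
  rw [coef_congr h1, coef_congr h2, h.coef_eq]

theorem coef_const_mul (α : ℝ) (n : ℤ) (c : ℂ) (u : ℝ → ℂ) :
    coef α n (fun t ↦ c * u t) = c * coef α n u := by
  rw [coef, coef, ← integral_const_mul]
  refine integral_congr_ae (Eventually.of_forall fun t ↦ ?_)
  simp only
  ring

/-- The phases combine through `(m + α) - (n + β) = (m - n) + γ`. The relation between the indices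
is a hypothesis so that sums such as `-α + α` appear already simplified. -/
theorem coef_exp_mul {α β γ : ℝ} (hγ : γ + β = α) (m n : ℤ) (u : ℝ → ℂ) :
    coef α m (fun t ↦ Complex.exp (((n + β : ℝ) : ℂ) * t * Complex.I) * u t) =
      coef γ (m - n) u := by
  rw [coef, coef]
  refine integral_congr_ae (Eventually.of_forall fun t ↦ ?_)
  simp only
  rw [← mul_assoc, ← Complex.exp_add, ← hγ]
  congr 2
  push_cast
  ring

theorem norm_exp_phase (a t : ℝ) : ‖Complex.exp ((a : ℂ) * t * Complex.I)‖ = 1 := by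
  have := norm_phase (-a) t
  simpa using this

theorem memLp_exp_mul {u : ℝ → ℂ} (a : ℝ) (hu : MemLp u 2 angleMeasure) :
    MemLp (fun t : ℝ ↦ Complex.exp ((a : ℂ) * t * Complex.I) * u t) 2 angleMeasure := by
  have := memLp_phase (-a) hu
  simpa using this

/-- Multiplication by `z ^ (n + β)` shifts the index of a Hardy pair. -/
theorem IsHardyPair.exp_mul {q α β γ : ℝ} {u v : ℝ → ℂ} (h : IsHardyPair q γ u v)
    (hγ : γ + β = α) (n : ℤ) :
    IsHardyPair q α (fun t ↦ Complex.exp (((n + β : ℝ) : ℂ) * t * Complex.I) * u t)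
      (fun t ↦ Complex.exp (((n + β : ℝ) : ℂ) * Real.log q) *
        (Complex.exp (((n + β : ℝ) : ℂ) * t * Complex.I) * v t)) := by
  refine ⟨memLp_exp_mul _ h.memLp_outer, (memLp_exp_mul _ h.memLp_inner).const_mul _, fun m ↦ ?_⟩
  rw [coef_const_mul, coef_exp_mul hγ, coef_exp_mul hγ, h.coef_eq, ← mul_assoc, ← Complex.exp_add,
    ← hγ]
  congr 2
  push_cast
  ring

theorem isHardyPair_one (q : ℝ) : IsHardyPair q 0 (fun _ ↦ 1) (fun _ ↦ 1) := by
  refine ⟨memLp_const 1, memLp_const 1, fun n ↦ ?_⟩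
  have := coef_exp n 0
  simp only [Int.cast_zero, zero_mul, Complex.exp_zero] at this
  rw [this]
  split_ifs with h
  · subst h
    simp
  · simp

theorem isHardyPair_exp (q α : ℝ) (n : ℤ) :
    IsHardyPair q α (fun t ↦ Complex.exp (((n + α : ℝ) : ℂ) * t * Complex.I))
      (fun t ↦ Complex.exp (((n + α : ℝ) : ℂ) * Real.log q) *
        Complex.exp (((n + α : ℝ) : ℂ) * t * Complex.I)) := by
  have := (isHardyPair_one q).exp_mul (zero_add α) n
  simpa only [mul_one] using this

theorem conj_exp_phase (a t : ℝ) : starRingEnd ℂ (Complex.exp ((a : ℂ) * t * Complex.I)) =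
    Complex.exp (-(a : ℂ) * t * Complex.I) := by
  rw [← Complex.exp_conj]
  congr 1
  simp

theorem conj_exp_real (a b : ℝ) : starRingEnd ℂ (Complex.exp ((a : ℂ) * b)) =
    Complex.exp ((a : ℂ) * b) := by
  rw [← Complex.exp_conj]
  congr 1
  simp

theorem conj_exp_int_phase (n : ℤ) (t : ℝ) : starRingEnd ℂ (Complex.exp (n * t * Complex.I)) =
    Complex.exp (-((n + 0 : ℝ) : ℂ) * t * Complex.I) := by
  rw [← Complex.exp_conj]
  congr 1
  simp

theorem conj_exp_int_real (n : ℤ) (b : ℝ) :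
    starRingEnd ℂ (Complex.exp (n * (b : ℂ))) = Complex.exp (n * (b : ℂ)) := by
  rw [← Complex.exp_conj]
  congr 1
  simp

theorem ae_eq_zero_of_forall_coef_eq_zero {α : ℝ} {u : ℝ → ℂ} (hu : Integrable u angleMeasure)
    (h : ∀ n, coef α n u = 0) : u =ᵐ[angleMeasure] 0 := by
  have h1 : ∀ n, coef 0 n (fun t ↦ Complex.exp (-(α : ℂ) * t * Complex.I) * u t) = 0 := by
    intro n
    have := coef_exp_mul (α := 0) (β := -α) (γ := α) (by ring) n 0 u
    rw [h] at this
    simpa using this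
  filter_upwards [ae_eq_zero_of_coef_eq_zero (integrable_phase α hu) h1] with t ht
  exact (mul_eq_zero.1 ht).resolve_left (Complex.exp_ne_zero _)

/-- The coefficient relation makes the inner coefficients vanish together with the outer ones. -/
theorem eq_zero_of_coef_outer {q : Ioo (0 : ℝ) 1} {α : ℝ} {h : BoundaryL2 q} (hh : h ∈ H2 q α)
    (h0 : ∀ n, coef α n (fun t ↦ h (circleMap 0 1 t)) = 0) : h = 0 := by
  have h1 := ae_eq_zero_of_forall_coef_eq_zero ((memLp_slice_one h).integrable (by norm_num)) h0
  have h2 := ae_eq_zero_of_forall_coef_eq_zero (α := α) ((memLp_slice_q h).integrable (by norm_num)) fun n ↦ by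
    rw [mem_H2_iff.1 hh n, h0, mul_zero]
  have hz := Lp.coeFn_zero ℂ 2 (boundaryMeasure q)
  refine ext_slices ?_ ?_
  · filter_upwards [h1, ae_slice_one hz] with t h1 h2
    rw [h1, h2]
    rfl
  · filter_upwards [h2, ae_slice_q hz] with t h1 h2
    rw [h1, h2]
    rfl

/-- An element of `H²_α` orthogonal to all `z ^ (n + α)` vanishes. -/
theorem eq_zero_of_orthogonal_exp {q : Ioo (0 : ℝ) 1} {α : ℝ} {h : BoundaryL2 q}
    (hh : h ∈ H2 q α)
    (h0 : ∀ n : ℤ, (∫ t, starRingEnd ℂ (Complex.exp (((n + α : ℝ) : ℂ) * t * Complex.I)) *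
      h (circleMap 0 1 t) ∂angleMeasure) + ∫ t, starRingEnd ℂ
        (Complex.exp (((n + α : ℝ) : ℂ) * Real.log q) *
        Complex.exp (((n + α : ℝ) : ℂ) * t * Complex.I)) * h (circleMap 0 q t) ∂angleMeasure = 0) :
    h = 0 := by
  refine eq_zero_of_coef_outer hh fun n ↦ ?_
  have h1 := h0 n
  simp only [map_mul, conj_exp_phase, conj_exp_real] at h1
  simp only [mul_assoc (Complex.exp (((n + α : ℝ) : ℂ) * Real.log q))] at h1
  rw [integral_const_mul] at h1
  have h2 := mem_H2_iff.1 hh n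
  simp only [coef] at h2 ⊢
  -- Orthogonality becomes `(1 + q ^ (2(n + α)))` times the outer coefficient equal to zero, and the
  -- first factor is positive.
  rw [h2, ← mul_assoc, ← Complex.exp_add, ← Complex.ofReal_mul, ← Complex.ofReal_add,
    ← Complex.ofReal_exp, ← one_add_mul] at h1
  refine (mul_eq_zero.1 h1).resolve_left ?_
  have := Real.exp_pos ((n + α) * Real.log q + (n + α) * Real.log q)
  exact_mod_cast (by positivity : 1 + Real.exp ((n + α) * Real.log q + (n + α) * Real.log q) ≠ 0)

/-! ### Uniqueness: a nonzero Hardy function does not vanish where a nonzero symbol lives. -/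

/-- An integrable function on the circle with exponentially decaying Fourier coefficients is
real-analytic, so it vanishes almost everywhere if it vanishes on a set of positive measure. -/
theorem ae_eq_zero_of_coef_decay {ψ : ℝ → ℂ} (hψ : Integrable ψ angleMeasure) {M ε : ℝ}
    (hε : 0 < ε) (hM : ∀ n, ‖coef 0 n ψ‖ ≤ M * Real.exp (-(ε * |(n : ℝ)|)))
    (h0 : ¬ ∀ᵐ t ∂angleMeasure, ψ t ≠ 0) : ψ =ᵐ[angleMeasure] 0 := by
  -- Half of the decay rate pays for the growth of the exponentials on this strip; the other half
  -- keeps the series summable.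
  set S : Set ℂ := {w | -(ε / 2) < w.re ∧ w.re < ε / 2} with hS
  have hSo : IsOpen S := (isOpen_lt continuous_const Complex.continuous_re).inter
    (isOpen_lt Complex.continuous_re continuous_const)
  have hSc : IsPreconnected S :=
    ((convex_halfSpace_re_gt (-(ε / 2))).inter (convex_halfSpace_re_lt (ε / 2))).isPreconnected
  have hbound : ∀ (n : ℤ) (x : ℝ), -(ε / 2) < x → x < ε / 2 →
      ‖coef 0 n ψ‖ * Real.exp ((n + 0) * x) ≤ M * Real.exp (-(ε / 2 * |(n : ℝ)|)) := by
    intro n x h1 h2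
    have hx : |x| ≤ ε / 2 := abs_le.2 ⟨h1.le, h2.le⟩
    have h3 : (n : ℝ) * x ≤ |(n : ℝ)| * (ε / 2) :=
      (le_abs_self _).trans ((abs_mul _ _).le.trans
        (mul_le_mul_of_nonneg_left hx (abs_nonneg _)))
    have hM0 : 0 ≤ M := by
      have := (norm_nonneg _).trans (hM 0)
      simpa using this
    calc _ ≤ M * Real.exp (-(ε * |(n : ℝ)|)) * Real.exp ((n + 0) * x) :=
          mul_le_mul_of_nonneg_right (hM n) (Real.exp_pos _).le
      _ = M * Real.exp (-(ε * |(n : ℝ)|) + (n + 0) * x) := by rw [mul_assoc, ← Real.exp_add]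
      _ ≤ _ := by
          refine mul_le_mul_of_nonneg_left (Real.exp_le_exp.2 ?_) hM0
          linarith
  set F : ℂ → ℂ := fun w ↦ ∑' n : ℤ, term 0 ψ n w with hF
  have hd : DifferentiableOn ℂ F S := by
    refine Complex.differentiableOn_tsum_of_summable_norm
      (((summable_exp_abs (half_pos hε)).mul_left M).mul_left (2 * Real.pi)⁻¹)
      (fun n ↦ by unfold term; fun_prop) hSo fun n w hw ↦ ?_
    rw [norm_term]
    exact mul_le_mul_of_nonneg_left (hbound n w.re hw.1 hw.2) (by positivity)
  have hmem : ∀ t : ℝ, ((0 : ℝ) + t * Complex.I : ℂ) ∈ S := by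
    intro t
    simp [hS, hε]
  have hcont : Continuous fun t : ℝ ↦ F ((0 : ℝ) + t * Complex.I) :=
    hd.continuousOn.comp_continuous (by fun_prop) hmem
  have hsumm : Summable fun n : ℤ ↦ ‖coef 0 n ψ‖ * Real.exp ((n + 0) * 0) :=
    Summable.of_nonneg_of_le (fun n ↦ by positivity)
      (fun n ↦ hbound n 0 (by linarith) (by linarith))
      ((summable_exp_abs (half_pos hε)).mul_left M)
  have hae : ψ =ᵐ[angleMeasure] fun t : ℝ ↦ F ((0 : ℝ) + t * Complex.I) := by
    refine ae_eq_of_coef_eq hψ ((memLp_of_continuous hcont).integrable (by norm_num)) fun n ↦ ?_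
    rw [hF, coef_slice_tsum hsumm]
    simp
  set Z : Set ℝ := {t | t ∈ Ioc 0 (2 * Real.pi) ∧ F ((0 : ℝ) + t * Complex.I) = 0} with hZ
  -- A finite zero set would be null, contrary to `h0`. An infinite one accumulates in the compact
  -- interval, and the accumulation point is interior to the strip of analyticity.
  have hinf : Z.Infinite := by
    intro hfin
    refine h0 ?_
    have hz : ∀ᵐ t ∂angleMeasure, t ∉ Z :=
      ae_restrict_of_ae (measure_eq_zero_iff_ae_notMem.1 (hfin.measure_zero volume))
    filter_upwards [hz, hae, ae_restrict_mem measurableSet_Ioc] with t h1 h2 h3 h4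
    exact h1 ⟨h3, h2 ▸ h4⟩
  obtain ⟨t₀, -, hacc⟩ := hinf.exists_accPt_of_subset_isCompact
    (isCompact_Icc (a := (0 : ℝ)) (b := 2 * Real.pi)) fun t ht ↦ ⟨ht.1.1.le, ht.1.2⟩
  rw [accPt_iff_frequently_nhdsNE] at hacc
  have hmap : Tendsto (fun t : ℝ ↦ ((0 : ℝ) + t * Complex.I : ℂ)) (𝓝[≠] t₀)
      (𝓝[≠] ((0 : ℝ) + t₀ * Complex.I : ℂ)) := by
    refine tendsto_nhdsWithin_of_tendsto_nhds_of_eventually_within _ ?_ ?_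
    · exact ((by fun_prop : Continuous fun t : ℝ ↦ ((0 : ℝ) + t * Complex.I : ℂ)).tendsto
        t₀).mono_left nhdsWithin_le_nhds
    · filter_upwards [self_mem_nhdsWithin] with t ht h
      refine ht ?_
      simpa using h
  have hzero := (hd.analyticOnNhd hSo).eqOn_zero_of_preconnected_of_frequently_eq_zero hSc
    (hmem t₀) (hmap.frequently (hacc.mono fun t ht ↦ ht.2))
  filter_upwards [hae] with t ht
  rw [ht, hzero (hmem t)]
  rfl

theorem norm_sq_eq {q : ℝ} (g : BoundaryL2 q) : ‖g‖ ^ 2 =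
    (∫ t, ‖g (circleMap 0 1 t)‖ ^ 2 ∂angleMeasure) +
      ∫ t, ‖g (circleMap 0 q t)‖ ^ 2 ∂angleMeasure := by
  have h1 := inner_eq g g
  rw [inner_self_eq_norm_sq_to_K] at h1
  simp only [Complex.conj_mul', ← Complex.ofReal_pow] at h1
  rw [integral_complex_ofReal, integral_complex_ofReal] at h1
  refine Complex.ofReal_injective ?_
  push_cast
  exact h1

/-- A single term of Parseval's sum is at most the whole sum. -/
theorem norm_coef_le_norm {q : ℝ} (g : BoundaryL2 q) (α : ℝ) (n : ℤ) :
    ‖coef α n (fun t ↦ g (circleMap 0 1 t))‖ ≤ Real.sqrt (2 * Real.pi) * ‖g‖ ∧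
    ‖coef α n (fun t ↦ g (circleMap 0 q t))‖ ≤ Real.sqrt (2 * Real.pi) * ‖g‖ := by
  have hp := Real.pi_pos
  have h := norm_sq_eq g
  have h1 : 0 ≤ ∫ t, ‖g (circleMap 0 1 t)‖ ^ 2 ∂angleMeasure :=
    integral_nonneg fun t ↦ by positivity
  have h2 : 0 ≤ ∫ t, ‖g (circleMap 0 q t)‖ ^ 2 ∂angleMeasure :=
    integral_nonneg fun t ↦ by positivity
  have key : ∀ {u : ℝ → ℂ}, MemLp u 2 angleMeasure → ∫ t, ‖u t‖ ^ 2 ∂angleMeasure ≤ ‖g‖ ^ 2 →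
      ‖coef α n u‖ ≤ Real.sqrt (2 * Real.pi) * ‖g‖ := by
    intro u hu hle
    have h3 := le_hasSum (hasSum_coef α hu) n fun m _ ↦ by positivity
    refine abs_le_of_sq_le_sq' (b := Real.sqrt (2 * Real.pi) * ‖g‖) ?_ (by positivity) |>.2
    rw [mul_pow, Real.sq_sqrt (by positivity)]
    exact h3.trans (mul_le_mul_of_nonneg_left hle (by positivity))
  exact ⟨key (memLp_slice_one g) (by linarith), key (memLp_slice_q g) (by linarith)⟩

/-- The majorant `b` depends only on `w` and `α`, not on the function. This uniformity makes point
evaluation a bounded functional. -/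
theorem exists_coef_exp_le {q : ℝ} {α : ℝ} {w : ℂ} (hw : w ∈ coverStrip q) :
    ∃ b : ℤ → ℝ, Summable b ∧ ∀ u v : ℝ → ℂ, ∀ M : ℝ,
      (∀ n : ℤ, coef α n v = Complex.exp (((n + α : ℝ) : ℂ) * Real.log q) * coef α n u) →
      (∀ n, ‖coef α n u‖ ≤ M) → (∀ n, ‖coef α n v‖ ≤ M) →
      ∀ n : ℤ, ‖coef α n u‖ * Real.exp ((n + α) * w.re) ≤ M * b n := by
  set ε := min (w.re - Real.log q) (-w.re) with hε
  have hε0 : 0 < ε := lt_min (by linarith [hw.1]) (by linarith [hw.2])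
  refine ⟨fun n ↦ Real.exp (ε * |α|) * Real.exp (-(ε * |(n : ℝ)|)),
    (summable_exp_abs hε0).mul_left _, fun u v M hrel hu hv n ↦ ?_⟩
  rw [← mul_assoc]
  refine coef_exp_le (L := Real.log q) (fun n ↦ ?_) hu hv hε0 ?_ ?_ n
  · rw [hrel, norm_mul, Complex.norm_exp, ← Complex.ofReal_mul, Complex.ofReal_re]
  · linarith [min_le_left (w.re - Real.log q) (-w.re)]
  · linarith [min_le_right (w.re - Real.log q) (-w.re)]

theorem norm_coef_mul_exp (α : ℝ) (u : ℝ → ℂ) (n : ℤ) (w : ℂ) :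
    ‖coef α n u * Complex.exp (((n + α : ℝ) : ℂ) * w)‖ =
      ‖coef α n u‖ * Real.exp ((n + α) * w.re) := by
  rw [norm_mul, Complex.norm_exp, Complex.re_ofReal_mul]

theorem summable_evaluation {q : Ioo (0 : ℝ) 1} {α : ℝ} {w : ℂ} (hw : w ∈ coverStrip q)
    (k : H2 q α) : Summable fun n : ℤ ↦
      ‖coef α n (fun t ↦ (k : BoundaryL2 q) (circleMap 0 1 t)) *
        Complex.exp (((n + α : ℝ) : ℂ) * w)‖ := by
  obtain ⟨b, hb, h⟩ := exists_coef_exp_le (α := α) hw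
  refine Summable.of_nonneg_of_le (fun n ↦ norm_nonneg _) (fun n ↦ ?_)
    (hb.mul_left (Real.sqrt (2 * Real.pi) * ‖(k : BoundaryL2 q)‖))
  rw [norm_coef_mul_exp]
  exact h _ _ _ (mem_H2_iff.1 k.2) (fun n ↦ (norm_coef_le_norm _ α n).1)
    (fun n ↦ (norm_coef_le_norm _ α n).2) n

/-- Evaluation of the lift at the point `w` of the universal cover, up to the factor `2π`. -/
def evaluation (q : Ioo (0 : ℝ) 1) (α : ℝ) (w : ℂ) (hw : w ∈ coverStrip q) : H2 q α →L[ℂ] ℂ :=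
  LinearMap.mkContinuous
    { toFun := fun k ↦ ∑' n : ℤ, coef α n (fun t ↦ (k : BoundaryL2 q) (circleMap 0 1 t)) *
        Complex.exp (((n + α : ℝ) : ℂ) * w)
      map_add' := fun k k' ↦ by
        rw [← (summable_evaluation hw k).of_norm.tsum_add (summable_evaluation hw k').of_norm]
        refine tsum_congr fun n ↦ ?_
        rw [← add_mul]
        congr 1
        rw [coef, coef, coef, ← integral_add
          ((memLp_phase _ (memLp_slice_one _)).integrable (by norm_num))
          ((memLp_phase _ (memLp_slice_one _)).integrable (by norm_num))]
        refine integral_congr_ae ?_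
        filter_upwards [ae_slice_one (Lp.coeFn_add (k : BoundaryL2 q) k')] with t ht
        rw [Submodule.coe_add, ht, Pi.add_apply, mul_add]
      map_smul' := fun c k ↦ by
        rw [RingHom.id_apply, smul_eq_mul, ← tsum_mul_left]
        refine tsum_congr fun n ↦ ?_
        rw [← mul_assoc, ← coef_const_mul]
        congr 1
        refine coef_congr ?_
        filter_upwards [ae_slice_one (Lp.coeFn_smul c (k : BoundaryL2 q))] with t ht
        rw [Submodule.coe_smul, ht]
        rfl }
    (Real.sqrt (2 * Real.pi) * ∑' n, (exists_coef_exp_le (α := α) hw).choose n) fun k ↦ by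
      obtain ⟨hb, h⟩ := (exists_coef_exp_le (α := α) hw).choose_spec
      rw [mul_right_comm, ← tsum_mul_left]
      refine tsum_of_norm_bounded (hb.mul_left _).hasSum fun n ↦ ?_
      rw [norm_coef_mul_exp]
      exact h _ _ _ (mem_H2_iff.1 k.2) (fun n ↦ (norm_coef_le_norm _ α n).1)
        (fun n ↦ (norm_coef_le_norm _ α n).2) n

theorem evaluation_apply {q : Ioo (0 : ℝ) 1} {α : ℝ} {w : ℂ} (hw : w ∈ coverStrip q)
    (k : H2 q α) : evaluation q α w hw k =
      ∑' n : ℤ, coef α n (fun t ↦ (k : BoundaryL2 q) (circleMap 0 1 t)) *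
        Complex.exp (((n + α : ℝ) : ℂ) * w) := rfl

/-- The coefficients of one interior slice of the lift are nonzero multiples of the outer boundary
coefficients, so a vanishing slice already forces `k = 0`. -/
theorem eq_zero_of_evaluation {q : Ioo (0 : ℝ) 1} {α : ℝ} {k : H2 q α}
    (h : ∀ w, ∀ hw : w ∈ coverStrip q, evaluation q α w hw k = 0) : k = 0 := by
  refine Subtype.ext (eq_zero_of_coef_outer k.2 fun m ↦ ?_)
  -- Any abscissa strictly between `log q` and `0` would do.
  set s : ℝ := Real.log q / 2
  have hL := Real.log_neg q.2.1 q.2.2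
  have hs : ∀ t : ℝ, (s + t * Complex.I : ℂ) ∈ coverStrip q := by
    intro t
    simp only [coverStrip, mem_ofPred_eq, Complex.add_re, Complex.ofReal_re, Complex.mul_re,
      Complex.I_re, mul_zero, Complex.ofReal_im, zero_mul, sub_self, add_zero, s, Complex.I_im]
    constructor <;> linarith
  have hsum := summable_evaluation (by simpa using hs 0) k
  simp only [norm_coef_mul_exp, Complex.ofReal_re] at hsum
  have h1 := coef_slice_tsum hsum m
  have h2 : ∀ t : ℝ, ∑' n : ℤ, term α (fun t ↦ (k : BoundaryL2 q) (circleMap 0 1 t)) n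
      (s + t * Complex.I) = 0 := by
    intro t
    have := h _ (hs t)
    rw [evaluation_apply] at this
    simp only [term, mul_assoc]
    rw [tsum_mul_left, this, mul_zero]
  simp only [h2] at h1
  have h3 : coef α m (fun _ ↦ 0) = 0 := by simp [coef]
  rw [h3] at h1
  exact (mul_eq_zero.1 h1.symm).resolve_left (Complex.exp_ne_zero _)

/-- The product of `k ∈ H²_α` with `z ^ n`. -/
theorem exists_zpow_mul {q : Ioo (0 : ℝ) 1} {α : ℝ} {k : BoundaryL2 q} (hk : k ∈ H2 q α) (n : ℤ) :
    ∃ k' ∈ H2 q α,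
      (∀ᵐ t ∂angleMeasure, k' (circleMap 0 1 t) =
        Complex.exp (n * t * Complex.I) * k (circleMap 0 1 t)) ∧
      ∀ᵐ t ∂angleMeasure, k' (circleMap 0 q t) =
        Complex.exp (n * Real.log q) * (Complex.exp (n * t * Complex.I) * k (circleMap 0 q t)) := by
  have := ((isHardyPair_slices hk).exp_mul (add_zero α) n).exists_mem
  simpa using this

/-- Multiplying by `z ^ n` shifts the coefficients, so reindexing the series extracts the factor
`exp (n w)`. -/
theorem evaluation_zpow_mul {q : Ioo (0 : ℝ) 1} {α : ℝ} {w : ℂ} (hw : w ∈ coverStrip q)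
    {k k' : H2 q α} {n : ℤ} (h : ∀ᵐ t ∂angleMeasure, (k' : BoundaryL2 q) (circleMap 0 1 t) =
        Complex.exp (n * t * Complex.I) * (k : BoundaryL2 q) (circleMap 0 1 t)) :
    evaluation q α w hw k' = Complex.exp (n * w) * evaluation q α w hw k := by
  rw [evaluation_apply, evaluation_apply, ← tsum_mul_left, ← (Equiv.addRight n).tsum_eq]
  refine tsum_congr fun m ↦ ?_
  have e := coef_exp_mul (add_zero α) (m + n) n (fun t ↦ (k : BoundaryL2 q) (circleMap 0 1 t))
  simp only [Complex.ofReal_intCast, add_zero, add_sub_cancel_right] at e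
  rw [coef_congr h, Equiv.coe_addRight, e, mul_left_comm, ← Complex.exp_add]
  congr 2
  push_cast
  ring

theorem conj_coef_ofReal (f : ℝ → ℝ) (n : ℤ) :
    starRingEnd ℂ (coef 0 n fun t ↦ (f t : ℂ)) = coef 0 (-n) fun t ↦ (f t : ℂ) := by
  rw [coef, coef, ← integral_conj]
  refine integral_congr_ae (Eventually.of_forall fun t ↦ ?_)
  simp only [map_mul, Complex.conj_ofReal]
  rw [← Complex.exp_conj]
  congr 2
  simp

/-- The solution of a pair of linear equations for Fourier coefficients decays exponentially. -/
theorem norm_le_exp_of_mul_eq {Λ σ C : ℝ} (hσ : 0 < σ) (hσ' : σ < Λ) (hC : 0 ≤ C) {n : ℤ}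
    (hn : n ≠ 0) {b x y : ℂ}
    (h : b * (Complex.exp ((n * Λ : ℝ)) - Complex.exp ((-(n * Λ) : ℝ))) = C * (x - y))
    (hx : ‖x‖ = Real.exp (n * σ)) (hy : ‖y‖ = Real.exp (-(n * σ))) :
    ‖b‖ ≤ 2 * C / (1 - Real.exp (-(2 * Λ))) * Real.exp (-((Λ - σ) * |(n : ℝ)|)) := by
  have hΛ : 0 < Λ := hσ.trans hσ'
  have hn1 : (1 : ℝ) ≤ |(n : ℝ)| := by exact_mod_cast Int.one_le_abs hn
  have h1 : ‖x - y‖ ≤ 2 * Real.exp (σ * |(n : ℝ)|) := by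
    refine (norm_sub_le _ _).trans ?_
    rw [hx, hy]
    have a1 : Real.exp (n * σ) ≤ Real.exp (σ * |(n : ℝ)|) :=
      Real.exp_le_exp.2 (by nlinarith [le_abs_self (n : ℝ)])
    have a2 : Real.exp (-(n * σ)) ≤ Real.exp (σ * |(n : ℝ)|) :=
      Real.exp_le_exp.2 (by nlinarith [neg_abs_le (n : ℝ)])
    linarith
  -- The left-hand factor is `2 sinh (nΛ)`. Its growth rate `Λ` beats the rate `σ` of the right-hand
  -- side; the constant is uniform because `|n| ≥ 1`.
  have h2 : Real.exp (Λ * |(n : ℝ)|) * (1 - Real.exp (-(2 * Λ))) ≤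
      ‖Complex.exp ((n * Λ : ℝ)) - Complex.exp ((-(n * Λ) : ℝ))‖ := by
    rw [← Complex.ofReal_exp, ← Complex.ofReal_exp, ← Complex.ofReal_sub, Complex.norm_real,
      Real.norm_eq_abs]
    have h3 : Real.exp (Λ * |(n : ℝ)|) * (1 - Real.exp (-(2 * Λ))) ≤
        Real.exp (Λ * |(n : ℝ)|) - Real.exp (-(Λ * |(n : ℝ)|)) := by
      rw [mul_sub, mul_one, ← Real.exp_add]
      exact sub_le_sub_left (Real.exp_le_exp.2 (by nlinarith)) _
    refine h3.trans ?_
    rcases abs_cases (n : ℝ) with ⟨h4, -⟩ | ⟨h4, -⟩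
    · rw [h4, mul_comm Λ]
      exact le_abs_self _
    · rw [h4, abs_sub_comm, mul_neg, neg_neg, mul_comm Λ]
      exact le_abs_self _
  have h5 : 0 < 1 - Real.exp (-(2 * Λ)) := by
    have : Real.exp (-(2 * Λ)) < 1 := Real.exp_lt_one_iff.2 (by linarith)
    linarith
  have h6 := congrArg norm h
  rw [norm_mul, norm_mul, Complex.norm_real, Real.norm_of_nonneg hC] at h6
  have h7 : ‖b‖ * (Real.exp (Λ * |(n : ℝ)|) * (1 - Real.exp (-(2 * Λ)))) ≤
      C * (2 * Real.exp (σ * |(n : ℝ)|)) :=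
    (mul_le_mul_of_nonneg_left h2 (norm_nonneg _)).trans
      (h6.le.trans (mul_le_mul_of_nonneg_left h1 hC))
  have h8 : Real.exp (-((Λ - σ) * |(n : ℝ)|)) =
      Real.exp (σ * |(n : ℝ)|) / Real.exp (Λ * |(n : ℝ)|) := by
    rw [← Real.exp_sub]
    congr 1
    ring
  rw [h8, div_mul_div_comm, le_div_iff₀ (by positivity)]
  linarith

theorem integrable_sq_norm {u : ℝ → ℂ} (hu : MemLp u 2 angleMeasure) :
    Integrable (fun t ↦ ((‖u t‖ ^ 2 : ℝ) : ℂ)) angleMeasure :=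
  (hu.integrable_norm_pow two_ne_zero).ofReal

/-- The order `n = 0`, where the determinant `2 sinh (nΛ)` vanishes, is absorbed into the constant.
-/
theorem exists_decay_bound {c : ℤ → ℂ} {K ε : ℝ}
    (h : ∀ n, n ≠ 0 → ‖c n‖ ≤ K * Real.exp (-(ε * |(n : ℝ)|))) :
    ∃ M, ∀ n, ‖c n‖ ≤ M * Real.exp (-(ε * |(n : ℝ)|)) := by
  refine ⟨max K ‖c 0‖, fun n ↦ ?_⟩
  rcases eq_or_ne n 0 with rfl | hn
  · simp
  · exact (h n hn).trans (mul_le_mul_of_nonneg_right (le_max_left _ _) (Real.exp_pos _).le)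

/-- If `|k|²` represents evaluation at a point of the annulus, up to a positive factor, then `k`
does not vanish on a boundary set of positive measure. -/
theorem ae_ne_zero_of_represents {q : Ioo (0 : ℝ) 1} {α : ℝ} {k : BoundaryL2 q}
    (hk : k ∈ H2 q α) (hk0 : k ≠ 0) {w : ℂ} (hw : w ∈ coverStrip q) {C : ℝ} (hC : 0 ≤ C)
    (h : ∀ n : ℤ, coef 0 (-n) (fun t ↦ ((‖k (circleMap 0 1 t)‖ ^ 2 : ℝ) : ℂ)) +
      Complex.exp (n * Real.log q) * coef 0 (-n) (fun t ↦ ((‖k (circleMap 0 q t)‖ ^ 2 : ℝ) : ℂ)) =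
        C * Complex.exp (n * w)) :
    (∀ᵐ t ∂angleMeasure, k (circleMap 0 1 t) ≠ 0) ∧
      ∀ᵐ t ∂angleMeasure, k (circleMap 0 q t) ≠ 0 := by
  set A : ℤ → ℂ := fun n ↦ coef 0 n (fun t ↦ ((‖k (circleMap 0 1 t)‖ ^ 2 : ℝ) : ℂ)) with hA
  set B : ℤ → ℂ := fun n ↦ coef 0 n (fun t ↦ ((‖k (circleMap 0 q t)‖ ^ 2 : ℝ) : ℂ)) with hB
  have h1 : ∀ n : ℤ, A n + Complex.exp (-(n * Real.log q : ℂ)) * B n =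
      C * Complex.exp (-(n * w)) := by
    intro n
    have := h (-n)
    rw [neg_neg] at this
    simpa [hA, hB] using this
  -- Since `|k|²` is real, conjugating the hypothesis gives a second equation for the same two
  -- unknowns `A n` and `B n`.
  have h2 : ∀ n : ℤ, A n + Complex.exp (n * Real.log q) * B n =
      C * Complex.exp (n * starRingEnd ℂ w) := by
    intro n
    have := congrArg (starRingEnd ℂ) (h n)
    simp only [map_add, map_mul, conj_coef_ofReal, neg_neg, ← Complex.exp_conj, Complex.conj_ofReal,
      map_intCast] at this
    exact this
  have hL : Real.log q < 0 := Real.log_neg q.2.1 q.2.2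
  have hw1 : Real.log q < w.re := hw.1
  have hw2 : w.re < 0 := hw.2
  have eP : ∀ n : ℤ, Complex.exp ((n * -Real.log q : ℝ)) = Complex.exp (-(n * Real.log q : ℂ)) := by
    intro n
    push_cast
    congr 1
    ring
  have eM : ∀ n : ℤ, Complex.exp ((-(n * -Real.log q) : ℝ)) = Complex.exp (n * Real.log q) := by
    intro n
    push_cast
    congr 1
    ring
  have eI : ∀ n : ℤ, Complex.exp (-(n * Real.log q : ℂ)) * Complex.exp (n * Real.log q) = 1 := by
    intro n
    rw [← Complex.exp_add, neg_add_cancel, Complex.exp_zero]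
  -- Subtracting the two equations eliminates `A n`. Here `σ < Λ` says that `w` lies strictly to the
  -- right of `log q`.
  have hBd := fun (n : ℤ) (hn : n ≠ 0) ↦ norm_le_exp_of_mul_eq (Λ := -Real.log q) (σ := -w.re)
    (C := C) (n := n) (b := B n) (x := Complex.exp (-(n * w)))
    (y := Complex.exp (n * starRingEnd ℂ w)) (by linarith) (by linarith) hC hn
    (by rw [eP, eM]; linear_combination h1 n - h2 n)
    (by rw [Complex.norm_exp]; congr 1; simp)
    (by rw [Complex.norm_exp]; congr 1; simp)
  -- The cross-multiplied combination eliminates `B n`. Now `σ < Λ` says that `w.re < 0`.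
  have hAd := fun (n : ℤ) (hn : n ≠ 0) ↦ norm_le_exp_of_mul_eq (Λ := -Real.log q)
    (σ := -Real.log q + w.re)
    (C := C) (n := n) (b := A n)
    (x := Complex.exp (-(n * Real.log q)) * Complex.exp (n * starRingEnd ℂ w))
    (y := Complex.exp (n * Real.log q) * Complex.exp (-(n * w))) (by linarith) (by linarith) hC hn
    (by
      rw [eP, eM]
      linear_combination Complex.exp (-(n * Real.log q)) * h2 n -
        Complex.exp (n * Real.log q) * h1 n)
    (by
      rw [← Complex.exp_add, Complex.norm_exp]
      congr 1
      simp
      ring)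
    (by
      rw [← Complex.exp_add, Complex.norm_exp]
      congr 1
      simp
      ring)
  obtain ⟨MA, hMA⟩ := exists_decay_bound hAd
  obtain ⟨MB, hMB⟩ := exists_decay_bound hBd
  constructor
  · by_contra hcon
    have h0 := ae_eq_zero_of_coef_decay (integrable_sq_norm (memLp_slice_one k)) (by linarith) hMA
      (fun h ↦ hcon (h.mono fun t ht h' ↦ ht (by simp [h'])))
    refine hk0 (eq_zero_of_coef_outer hk fun n ↦ ?_)
    have h3 : (fun t ↦ k (circleMap 0 1 t)) =ᵐ[angleMeasure] fun _ ↦ 0 := by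
      filter_upwards [h0] with t ht
      simpa using ht
    rw [coef_congr h3]
    simp [coef]
  · by_contra hcon
    have h0 := ae_eq_zero_of_coef_decay (integrable_sq_norm (memLp_slice_q k)) (by linarith) hMB
      (fun h ↦ hcon (h.mono fun t ht h' ↦ ht (by simp [h'])))
    refine hk0 (eq_zero_of_coef_outer hk fun n ↦ ?_)
    have h3 : (fun t ↦ k (circleMap 0 q t)) =ᵐ[angleMeasure] fun _ ↦ 0 := by
      filter_upwards [h0] with t ht
      simpa using ht
    have h4 := mem_H2_iff.1 hk n
    rw [coef_congr h3] at h4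
    refine (mul_eq_zero.1 (h4.symm.trans ?_)).resolve_left (Complex.exp_ne_zero _)
    simp [coef]

theorem mulSymbol_eq_zero_iff {q : ℝ} {φ : Lp ℝ ∞ (boundaryMeasure q)} {g : BoundaryL2 q} :
    mulSymbol φ g = 0 ↔
      (∀ᵐ t ∂angleMeasure, (φ (circleMap 0 1 t) : ℂ) * g (circleMap 0 1 t) = 0) ∧
      ∀ᵐ t ∂angleMeasure, (φ (circleMap 0 q t) : ℂ) * g (circleMap 0 q t) = 0 := by
  have hm := mulSymbol_ae φ g
  have hz := Lp.coeFn_zero ℂ 2 (boundaryMeasure q)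
  constructor
  · intro h
    rw [h] at hm
    constructor
    · filter_upwards [ae_slice_one hm, ae_slice_one hz] with t h1 h2
      rw [← h1, h2]
      rfl
    · filter_upwards [ae_slice_q hm, ae_slice_q hz] with t h1 h2
      rw [← h1, h2]
      rfl
  · rintro ⟨h1, h2⟩
    refine ext_slices ?_ ?_
    · filter_upwards [ae_slice_one hm, ae_slice_one hz, h1] with t h1 h2 h3
      rw [h1, h2, h3]
      rfl
    · filter_upwards [ae_slice_q hm, ae_slice_q hz, h2] with t h1 h2 h3
      rw [h1, h2, h3]
      rfl

/-- Riesz representation on the closed subspace `N`; the representer is nonzero because the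
functional is nonzero at some `x ∈ N`. -/
theorem exists_represents {E : Type*} [NormedAddCommGroup E] [InnerProductSpace ℂ E]
    [CompleteSpace E] {N : Submodule ℂ E} (hN : IsClosed (N : Set E)) (ℓ : E →L[ℂ] ℂ) {x : E}
    (hx : x ∈ N) (h : ℓ x ≠ 0) : ∃ κ ∈ N, κ ≠ 0 ∧ ∀ y ∈ N, inner ℂ κ y = ℓ y := by
  have : CompleteSpace N := hN.completeSpace_coe
  set κ : N := (InnerProductSpace.toDual ℂ N).symm (ℓ ∘L N.subtypeL)
  have hrep : ∀ y : N, inner ℂ (κ : E) (y : E) = ℓ y := fun y ↦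
    InnerProductSpace.toDual_symm_apply (𝕜 := ℂ) (x := y) (y := ℓ ∘L N.subtypeL)
  refine ⟨κ, κ.2, fun h0 ↦ h ?_, fun y hy ↦ hrep ⟨y, hy⟩⟩
  rw [← hrep ⟨x, hx⟩, h0, inner_zero_left]

/-- A function in `H²_α` that vanishes where a nonzero symbol does not is zero. -/
theorem eq_zero_of_mulSymbol_eq_zero {q : Ioo (0 : ℝ) 1} {α : ℝ}
    {φ : Lp ℝ ∞ (boundaryMeasure q)} (hφ : φ ≠ 0) {g : BoundaryL2 q} (hg : g ∈ H2 q α)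
    (h : mulSymbol φ g = 0) : g = 0 := by
  by_contra hg0
  obtain ⟨w, hw, hev⟩ : ∃ w, ∃ hw : w ∈ coverStrip q, evaluation q α w hw ⟨g, hg⟩ ≠ 0 := by
    by_contra! hcon
    exact hg0 (congrArg Subtype.val (eq_zero_of_evaluation hcon))
  -- The functions in `H²_α` annihilated by `φ` form a closed subspace containing `g` and stable
  -- under multiplication by every `z ^ n`.
  have hcl := ContinuousLinearMap.isClosed_ker (mulSymbol φ ∘L (H2 q α).subtypeL)
  obtain ⟨⟨k, hkm⟩, hkφ, hκ0, hrep⟩ := exists_represents hcl (evaluation q α w hw)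
    (x := ⟨g, hg⟩) h hev
  replace hkφ : mulSymbol φ k = 0 := hkφ
  have hk0 : k ≠ 0 := fun h0 ↦ hκ0 (Subtype.ext h0)
  -- The reproducing property applied to `z ^ n k` reads `⟨k, z ^ n k⟩ = exp (n w) ‖k‖²`, and the
  -- inner product is expanded into coefficients of `|k|²`.
  have hrel : ∀ n : ℤ, coef 0 (-n) (fun t ↦ ((‖k (circleMap 0 1 t)‖ ^ 2 : ℝ) : ℂ)) +
      Complex.exp (n * Real.log q) * coef 0 (-n) (fun t ↦ ((‖k (circleMap 0 q t)‖ ^ 2 : ℝ) : ℂ)) =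
        (‖k‖ ^ 2 : ℝ) * Complex.exp (n * w) := by
    intro n
    obtain ⟨k', hk', h1, h2⟩ := exists_zpow_mul hkm n
    have hk'φ : mulSymbol φ k' = 0 := by
      obtain ⟨h3, h4⟩ := mulSymbol_eq_zero_iff.1 hkφ
      refine mulSymbol_eq_zero_iff.2 ⟨?_, ?_⟩
      · filter_upwards [h1, h3] with t h5 h6
        rw [h5, mul_left_comm, h6, mul_zero]
      · filter_upwards [h2, h4] with t h5 h6
        rw [h5, mul_left_comm, mul_left_comm _ (Complex.exp (n * t * Complex.I)), h6, mul_zero,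
          mul_zero]
    have e1 := hrep ⟨k', hk'⟩ hk'φ
    have e2 : evaluation q α w hw ⟨k', hk'⟩ = Complex.exp (n * w) * evaluation q α w hw ⟨k, hkm⟩ :=
      evaluation_zpow_mul hw h1
    have e3 : inner ℂ k k = evaluation q α w hw ⟨k, hkm⟩ := hrep ⟨k, hkm⟩ hkφ
    have e4 : inner ℂ k k' = evaluation q α w hw ⟨k', hk'⟩ := e1
    rw [inner_self_eq_norm_sq_to_K] at e3
    have e5 : ((‖k‖ ^ 2 : ℝ) : ℂ) = evaluation q α w hw ⟨k, hkm⟩ := by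
      rw [← e3]
      push_cast
      rfl
    rw [e5, mul_comm (evaluation q α w hw _), ← e2, ← e4, inner_eq, coef, coef,
      ← integral_const_mul]
    congr 1
    · refine integral_congr_ae ?_
      filter_upwards [h1] with t ht
      rw [ht, mul_left_comm, Complex.conj_mul']
      push_cast
      simp
    · refine integral_congr_ae ?_
      filter_upwards [h2] with t ht
      have e6 : ∀ a b c : ℂ, c * (a * (b * k (circleMap 0 q t))) =
          b * (a * (c * k (circleMap 0 q t))) := fun a b c ↦ by ring
      rw [ht, e6, Complex.conj_mul']
      push_cast
      simp only [add_zero, neg_neg]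
      ring
  obtain ⟨n1, n2⟩ := ae_ne_zero_of_represents hkm hk0 hw (by positivity) hrel
  obtain ⟨z1, z2⟩ := mulSymbol_eq_zero_iff.1 hkφ
  refine hφ (Lp.ext ?_)
  have hz := Lp.coeFn_zero ℝ ∞ (boundaryMeasure q)
  have : ∀ᵐ z ∂boundaryMeasure q, φ z = 0 := by
    refine ae_boundary_of_slices (measurableSet_eq_fun (Lp.stronglyMeasurable φ).measurable
      measurable_const) ?_ ?_
    · filter_upwards [n1, z1] with t h1 h2
      exact_mod_cast (mul_eq_zero.1 h2).resolve_right h1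
    · filter_upwards [n2, z2] with t h1 h2
      exact_mod_cast (mul_eq_zero.1 h2).resolve_right h1
  filter_upwards [this, hz] with z h1 h2
  rw [h1, h2]
  rfl

/-! ### The logarithmic identity and boundedness of `1 / g`. -/

/-- The function `log |z q ^ (-1/2)|` equals `-(log q) / 2` on the outer circle and `(log q) / 2` on
the inner one, so the identity asks for opposite constants. -/
theorem logIdentity_iff {q : Ioo (0 : ℝ) 1} {φ : Lp ℝ ∞ (boundaryMeasure q)} {g : BoundaryL2 q}
    {c : ℝ} : LogIdentity φ g c ↔
      (∀ᵐ t ∂angleMeasure, φ (circleMap 0 1 t) * ‖g (circleMap 0 1 t)‖ ^ 2 =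
        -(c * Real.log q / 2)) ∧
      ∀ᵐ t ∂angleMeasure, φ (circleMap 0 q t) * ‖g (circleMap 0 q t)‖ ^ 2 =
        c * Real.log q / 2 := by
  have hq : (0 : ℝ) < q := q.2.1
  have hr : (0 : ℝ) < (q : ℝ) ^ (-(1 / 2) : ℝ) := Real.rpow_pos_of_pos hq _
  have e1 : ∀ t, c * Real.log ‖circleMap 0 1 t * (((q : ℝ) ^ (-(1 / 2) : ℝ) : ℝ) : ℂ)‖ =
      -(c * Real.log q / 2) := by
    intro t
    rw [norm_mul, norm_circleMap_zero, abs_one, one_mul, Complex.norm_real,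
      Real.norm_of_nonneg hr.le, Real.log_rpow hq]
    ring
  have e2 : ∀ t, c * Real.log ‖circleMap 0 q t * (((q : ℝ) ^ (-(1 / 2) : ℝ) : ℝ) : ℂ)‖ =
      c * Real.log q / 2 := by
    intro t
    rw [norm_mul, norm_circleMap_zero, abs_of_pos hq, Complex.norm_real,
      Real.norm_of_nonneg hr.le, Real.log_mul hq.ne' hr.ne', Real.log_rpow hq]
    ring
  constructor
  · intro h
    exact ⟨(ae_slice_one h).mono fun t ht ↦ ht.trans (e1 t),
      (ae_slice_q h).mono fun t ht ↦ ht.trans (e2 t)⟩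
  · rintro ⟨h1, h2⟩
    refine ae_boundary_of_slices (measurableSet_eq_fun ?_ ?_) ?_ ?_
    · exact (Lp.stronglyMeasurable φ).measurable.mul
        ((Lp.stronglyMeasurable g).measurable.norm.pow_const 2)
    · exact (Real.measurable_log.comp (measurable_id.mul_const _).norm).const_mul c
    · exact h1.mono fun t ht ↦ ht.trans (e1 t).symm
    · exact h2.mono fun t ht ↦ ht.trans (e2 t).symm

theorem exists_ae_norm_le {q : ℝ} (φ : Lp ℝ ∞ (boundaryMeasure q)) :
    ∃ K, ∀ᵐ z ∂boundaryMeasure q, ‖φ z‖ ≤ K := by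
  refine ⟨(eLpNorm φ ∞ (boundaryMeasure q)).toReal, ?_⟩
  have h := ae_le_eLpNormEssSup (f := φ) (μ := boundaryMeasure q)
  rw [← eLpNorm_exponent_top] at h
  filter_upwards [h] with z hz
  have := ENNReal.toReal_mono (Lp.memLp φ).2.ne hz
  simpa using this

/-- `u` is invertible almost everywhere, with a bounded inverse. -/
def HasBoundedInv (u : ℝ → ℂ) : Prop :=
  (∀ᵐ t ∂angleMeasure, u t ≠ 0) ∧ ∃ C, ∀ᵐ t ∂angleMeasure, ‖(u t)⁻¹‖ ≤ C

/-- Indeed `1 / |u|² = |f| / |d|`, and `x ≤ 1 + x²` removes the square without a square root. -/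
theorem hasBoundedInv_of_mul_sq {f : ℝ → ℝ} {u : ℝ → ℂ} {d K : ℝ} (hd : d ≠ 0)
    (hf : ∀ᵐ t ∂angleMeasure, ‖f t‖ ≤ K) (h : ∀ᵐ t ∂angleMeasure, f t * ‖u t‖ ^ 2 = d) :
    HasBoundedInv u := by
  have h0 : ∀ᵐ t ∂angleMeasure, u t ≠ 0 := by
    filter_upwards [h] with t ht h0
    rw [h0] at ht
    simp at ht
    exact hd ht.symm
  refine ⟨h0, 1 + K / |d|, ?_⟩
  filter_upwards [h0, hf, h] with t h0 h1 h2
  have hu : 0 < ‖u t‖ := norm_pos_iff.2 h0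
  have h3 : ‖(u t)⁻¹‖ ^ 2 = ‖f t‖ / |d| := by
    rw [← h2, abs_mul, abs_of_pos (pow_pos hu 2), norm_inv, Real.norm_eq_abs]
    have : f t ≠ 0 := fun h ↦ hd (by rw [← h2, h, zero_mul])
    have : |f t| ≠ 0 := abs_ne_zero.2 this
    field_simp
  have h4 : ‖(u t)⁻¹‖ ^ 2 ≤ K / |d| := by
    rw [h3]
    exact div_le_div_of_nonneg_right h1 (abs_nonneg d)
  nlinarith [sq_nonneg (‖(u t)⁻¹‖ - 1), norm_nonneg (u t)⁻¹]

theorem HasBoundedInv.memLp {u : ℝ → ℂ} (h : HasBoundedInv u)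
    (hu : AEStronglyMeasurable u angleMeasure) : MemLp (fun t ↦ (u t)⁻¹) 2 angleMeasure := by
  obtain ⟨C, hC⟩ := h.2
  exact MemLp.of_bound hu.aemeasurable.inv.aestronglyMeasurable C hC

theorem LogIdentity.hasBoundedInv {q : Ioo (0 : ℝ) 1} {φ : Lp ℝ ∞ (boundaryMeasure q)}
    {g : BoundaryL2 q} {c : ℝ} (h : LogIdentity φ g c) (hc : c ≠ 0) :
    HasBoundedInv (fun t ↦ g (circleMap 0 1 t)) ∧ HasBoundedInv (fun t ↦ g (circleMap 0 q t)) := by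
  have hL := (Real.log_neg q.2.1 q.2.2).ne
  obtain ⟨K, hK⟩ := exists_ae_norm_le φ
  obtain ⟨h1, h2⟩ := logIdentity_iff.1 h
  exact ⟨hasBoundedInv_of_mul_sq (neg_ne_zero.2 (div_ne_zero (mul_ne_zero hc hL) two_ne_zero))
      (ae_slice_one hK) h1,
    hasBoundedInv_of_mul_sq (div_ne_zero (mul_ne_zero hc hL) two_ne_zero) (ae_slice_q hK) h2⟩

/-! ### The kernel of the Toeplitz operator in terms of `1 / g`. -/

/-- From `φ |g|² = ±d`, the function `φ g` is `±d` divided by the conjugate of `g`. Conjugation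
leaves a bilinear pairing of `k` with `1 / g` in which the circles enter with opposite signs. -/
theorem conj_inner_mulSymbol {q : Ioo (0 : ℝ) 1} {φ : Lp ℝ ∞ (boundaryMeasure q)}
    {g : BoundaryL2 q} {c : ℝ} (h : LogIdentity φ g c) (hc : c ≠ 0) (k : BoundaryL2 q) :
    starRingEnd ℂ (inner ℂ k (mulSymbol φ g)) = (c * Real.log q / 2 : ℝ) *
      ((∫ t, k (circleMap 0 q t) * (g (circleMap 0 q t))⁻¹ ∂angleMeasure) -
        ∫ t, k (circleMap 0 1 t) * (g (circleMap 0 1 t))⁻¹ ∂angleMeasure) := by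
  obtain ⟨h1, h2⟩ := logIdentity_iff.1 h
  obtain ⟨b1, b2⟩ := h.hasBoundedInv hc
  have key : ∀ (x y : ℂ) (f d : ℝ), y ≠ 0 → f * ‖y‖ ^ 2 = d →
      starRingEnd ℂ (starRingEnd ℂ x * (f * y)) = d * (x * y⁻¹) := by
    intro x y f d hy hd
    have e : (f : ℂ) * (starRingEnd ℂ y * y) = d := by
      rw [Complex.conj_mul', ← Complex.ofReal_pow, ← Complex.ofReal_mul, hd]
    simp only [map_mul, Complex.conj_conj, Complex.conj_ofReal]
    rw [← e]
    field_simp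
  rw [inner_mulSymbol, map_add, ← integral_conj, ← integral_conj, mul_sub, add_comm,
    ← integral_const_mul, ← integral_const_mul, sub_eq_add_neg, ← integral_neg]
  congr 1
  · refine integral_congr_ae ?_
    filter_upwards [h2, b2.1] with t ht ht0
    exact key _ _ _ _ ht0 ht
  · refine integral_congr_ae ?_
    filter_upwards [h1, b1.1] with t ht ht0
    refine (key _ _ _ _ ht0 ht).trans ?_
    push_cast
    ring

/-- A nonzero element `g` of the kernel satisfying the logarithmic identity has `1 / g` in
`H²_{-α}`. -/
theorem isHardyPair_inv_of_toeplitz {q : Ioo (0 : ℝ) 1} {α : ℝ}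
    {φ : Lp ℝ ∞ (boundaryMeasure q)} {g : H2 q α} {c : ℝ}
    (h : LogIdentity φ (g : BoundaryL2 q) c) (hc : c ≠ 0) (hT : toeplitz q α φ g = 0) :
    IsHardyPair q (-α) (fun t ↦ ((g : BoundaryL2 q) (circleMap 0 1 t))⁻¹)
      (fun t ↦ ((g : BoundaryL2 q) (circleMap 0 q t))⁻¹) := by
  obtain ⟨b1, b2⟩ := h.hasBoundedInv hc
  refine ⟨b1.memLp (memLp_slice_one _).1, b2.memLp (memLp_slice_q _).1, fun n ↦ ?_⟩
  -- The test function is `z ^ (-n + α)`: pairing it with `1 / g` on the outer circle gives exactly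
  -- the coefficient of `1 / g` of order `n - α`.
  obtain ⟨e, he, e1, e2⟩ := (isHardyPair_exp q α (-n)).exists_mem
  have h1 := conj_inner_mulSymbol h hc e
  rw [toeplitz_eq_zero_iff.1 hT e he, map_zero] at h1
  have hL := (Real.log_neg q.2.1 q.2.2).ne
  have hd : ((c * Real.log q / 2 : ℝ) : ℂ) ≠ 0 := by
    exact_mod_cast div_ne_zero (mul_ne_zero hc hL) two_ne_zero
  have h2 := sub_eq_zero.1 ((mul_eq_zero.1 h1.symm).resolve_left hd)
  have e3 : ∫ t, e (circleMap 0 1 t) * ((g : BoundaryL2 q) (circleMap 0 1 t))⁻¹ ∂angleMeasure =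
      coef (-α) n fun t ↦ ((g : BoundaryL2 q) (circleMap 0 1 t))⁻¹ := by
    refine integral_congr_ae ?_
    filter_upwards [e1] with t ht
    rw [ht]
    congr 3
    push_cast
    ring
  have e4 : ∫ t, e (circleMap 0 q t) * ((g : BoundaryL2 q) (circleMap 0 q t))⁻¹ ∂angleMeasure =
      Complex.exp ((((-n : ℤ) + α : ℝ) : ℂ) * Real.log q) *
      coef (-α) n fun t ↦ ((g : BoundaryL2 q) (circleMap 0 q t))⁻¹ := by
    rw [coef, ← integral_const_mul]
    refine integral_congr_ae ?_
    filter_upwards [e2] with t ht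
    rw [ht, mul_assoc]
    congr 4
    push_cast
    ring
  rw [e3, e4] at h2
  rw [← h2, ← mul_assoc, ← Complex.exp_add]
  have : (((n : ℝ) + -α : ℝ) : ℂ) * Real.log q + (((-n : ℤ) + α : ℝ) : ℂ) * Real.log q = 0 := by
    push_cast
    ring
  rw [this, Complex.exp_zero, one_mul]

/-- The product `k · (1 / g)` has index `α - α = 0`. Its coefficients of order zero on the two
circles agree, which is the vanishing of the difference in `conj_inner_mulSymbol`. -/
theorem toeplitz_eq_zero_of_isHardyPair_inv {q : Ioo (0 : ℝ) 1} {α : ℝ}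
    {φ : Lp ℝ ∞ (boundaryMeasure q)} {g : H2 q α} {c : ℝ}
    (h : LogIdentity φ (g : BoundaryL2 q) c) (hc : c ≠ 0)
    (hi : IsHardyPair q (-α) (fun t ↦ ((g : BoundaryL2 q) (circleMap 0 1 t))⁻¹)
      (fun t ↦ ((g : BoundaryL2 q) (circleMap 0 q t))⁻¹)) : toeplitz q α φ g = 0 := by
  refine toeplitz_eq_zero_iff.2 fun k hk ↦ ?_
  have h1 := conj_inner_mulSymbol h hc k
  have hk' := isHardyPair_slices hk
  have h2 := coef_mul_relation q.2 hk'.memLp_outer hk'.memLp_inner hi.memLp_outer hi.memLp_inner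
    hk'.coef_eq hi.coef_eq 0
  simp only [coef, add_neg_cancel, Int.cast_zero, add_zero, Complex.ofReal_zero, neg_zero, zero_mul,
    Complex.exp_zero, one_mul] at h2
  rw [h2, sub_self, mul_zero] at h1
  exact (map_eq_zero _).1 h1

/-! ### If `1 / g` is of Hardy class and bounded, then `g` is outer. -/

theorem coef_conj (u : ℝ → ℂ) (n : ℤ) :
    coef 0 n (fun t ↦ starRingEnd ℂ (u t)) = starRingEnd ℂ (coef 0 (-n) u) := by
  rw [coef, coef, ← integral_conj]
  refine integral_congr_ae (Eventually.of_forall fun t ↦ ?_)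
  simp only [map_mul]
  rw [← Complex.exp_conj]
  congr 2
  simp

/-- An annihilator of the Laurent polynomials annihilates the bounded analytic functions. -/
theorem integral_mul_add_eq_zero {L C C' : ℝ} {x y U V : ℝ → ℂ}
    (hx : AEStronglyMeasurable x angleMeasure) (hy : AEStronglyMeasurable y angleMeasure)
    (hxC : ∀ᵐ t ∂angleMeasure, ‖x t‖ ≤ C) (hyC : ∀ᵐ t ∂angleMeasure, ‖y t‖ ≤ C')
    (hU : Integrable U angleMeasure) (hV : Integrable V angleMeasure)
    (hxy : ∀ n : ℤ, coef 0 n y = Complex.exp (-(n * L)) * coef 0 n x)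
    (hUV : ∀ n : ℤ, coef 0 n U + Complex.exp (n * L) * coef 0 n V = 0) :
    (∫ t, x t * U t ∂angleMeasure) + ∫ t, y t * V t ∂angleMeasure = 0 := by
  refine tendsto_nhds_unique ((tendsto_integral_fejer_mul hx hxC hU).add
    (tendsto_integral_fejer_mul hy hyC hV)) (Tendsto.congr (fun N ↦ ?_) tendsto_const_nhds)
  rw [integral_fejer_mul _ hU, integral_fejer_mul _ hV, ← mul_add, ← Finset.sum_add_distrib]
  refine (mul_eq_zero_of_right _ (Finset.sum_eq_zero fun j _ ↦ ?_)).symm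
  rw [← Finset.sum_add_distrib]
  refine Finset.sum_eq_zero fun k _ ↦ ?_
  -- The coefficient of `x` of order `j - k` is paired with that of `U` of order `k - j`, so the
  -- annihilation relation is used at the opposite order.
  have h1 := hUV ((k : ℤ) - j)
  have h2 : Complex.exp (-(((j : ℤ) - k : ℤ) * L)) = Complex.exp (((k : ℤ) - j : ℤ) * L) := by
    congr 1
    push_cast
    ring
  rw [hxy, h2]
  linear_combination coef 0 ((j : ℤ) - k) x * h1

theorem circleMap_zpow {r : ℝ} (hr : 0 < r) (t : ℝ) (n : ℤ) :
    circleMap 0 r t ^ n = Complex.exp (n * Real.log r) * Complex.exp (n * t * Complex.I) := by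
  have : circleMap 0 r t = Complex.exp (Real.log r + t * Complex.I) := by
    rw [Complex.exp_add, ← Complex.ofReal_exp, Real.exp_log hr, circleMap, zero_add]
  rw [this, ← Complex.exp_int_mul, ← Complex.exp_add]
  congr 1
  ring

theorem zpow_mem_annulusAlgebra {q : ℝ} (hq : 0 < q) (n : ℤ) :
    (fun z : ℂ ↦ z ^ n) ∈ annulusAlgebra q := by
  have h0 : ∀ z : ℂ, q ≤ ‖z‖ → z ≠ 0 := fun z hz h ↦ by
    rw [h, norm_zero] at hz
    linarith
  exact ⟨fun z hz ↦ (continuousAt_zpow₀ z n (Or.inl (h0 z hz.1))).continuousWithinAt,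
    fun z hz ↦ (differentiableAt_zpow.2 (Or.inl (h0 z hz.1.le))).differentiableWithinAt⟩

/-- The elements `a g ∈ H²_α` with `a` in the annulus algebra. -/
def annulusModule {q : Ioo (0 : ℝ) 1} {α : ℝ} (g : H2 q α) : Submodule ℂ (H2 q α) where
  carrier := {k : H2 q α | ∃ a ∈ annulusAlgebra q,
    ∀ᵐ z ∂boundaryMeasure q, (k : BoundaryL2 q) z = a z * (g : BoundaryL2 q) z}
  zero_mem' := by
    refine ⟨fun _ ↦ 0, ⟨continuousOn_const, differentiableOn_const 0⟩, ?_⟩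
    filter_upwards [Lp.coeFn_zero ℂ 2 (boundaryMeasure q)] with z hz
    rw [zero_mul]
    exact hz
  add_mem' := by
    rintro k k' ⟨a, ha, h⟩ ⟨a', ha', h'⟩
    refine ⟨fun z ↦ a z + a' z, ⟨ha.1.add ha'.1, ha.2.add ha'.2⟩, ?_⟩
    filter_upwards [h, h', Lp.coeFn_add (k : BoundaryL2 q) k'] with z h1 h2 h3
    rw [Submodule.coe_add, h3, Pi.add_apply, h1, h2, add_mul]
  smul_mem' := by
    rintro c k ⟨a, ha, h⟩
    refine ⟨fun z ↦ c * a z, ⟨ha.1.const_mul c, ha.2.const_mul c⟩, ?_⟩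
    filter_upwards [h, Lp.coeFn_smul c (k : BoundaryL2 q)] with z h1 h2
    rw [Submodule.coe_smul, h2, Pi.smul_apply, h1, smul_eq_mul, mul_assoc]

/-- Let `h` be orthogonal to all `z ^ n g`. Then the conjugate of `g` times `h` annihilates the
conjugates of Laurent polynomials, hence also those of `z ^ (m + α) / g`. The factors `g` cancel,
and `h` is orthogonal to every `z ^ (m + α)`. -/
theorem isOuter_of_isHardyPair_inv {q : Ioo (0 : ℝ) 1} {α : ℝ} {g : H2 q α}
    (b1 : HasBoundedInv (fun t ↦ (g : BoundaryL2 q) (circleMap 0 1 t)))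
    (b2 : HasBoundedInv (fun t ↦ (g : BoundaryL2 q) (circleMap 0 q t)))
    (hi : IsHardyPair q (-α) (fun t ↦ ((g : BoundaryL2 q) (circleMap 0 1 t))⁻¹)
      (fun t ↦ ((g : BoundaryL2 q) (circleMap 0 q t))⁻¹)) : IsOuter g := by
  change Dense (annulusModule g : Set (H2 q α))
  rw [Submodule.dense_iff_topologicalClosure_eq_top, Submodule.topologicalClosure_eq_top_iff,
    Submodule.eq_bot_iff]
  rintro ⟨h, hh⟩ horth
  rw [Submodule.mem_orthogonal] at horth
  set G : BoundaryL2 q := (g : BoundaryL2 q) with hG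
  refine Subtype.ext (eq_zero_of_orthogonal_exp hh fun m ↦ ?_)
  have hU : Integrable (fun t ↦ starRingEnd ℂ (G (circleMap 0 1 t)) * h (circleMap 0 1 t))
      angleMeasure := integrable_mul_of_memLp (memLp_slice_one G).star (memLp_slice_one h)
  have hV : Integrable (fun t ↦ starRingEnd ℂ (G (circleMap 0 q t)) * h (circleMap 0 q t))
      angleMeasure := integrable_mul_of_memLp (memLp_slice_q G).star (memLp_slice_q h)
  have hUV : ∀ n : ℤ,
      coef 0 n (fun t ↦ starRingEnd ℂ (G (circleMap 0 1 t)) * h (circleMap 0 1 t)) +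
      Complex.exp (n * Real.log q) *
        coef 0 n (fun t ↦ starRingEnd ℂ (G (circleMap 0 q t)) * h (circleMap 0 q t)) = 0 := by
    intro n
    obtain ⟨k, hk, h1, h2⟩ := exists_zpow_mul g.2 n
    have hmem : (⟨k, hk⟩ : H2 q α) ∈ annulusModule g := by
      refine ⟨_, zpow_mem_annulusAlgebra q.2.1 n, ?_⟩
      refine ae_boundary_of_slices (measurableSet_eq_fun (Lp.stronglyMeasurable k).measurable
        ((measurable_id.pow_const n).mul (Lp.stronglyMeasurable G).measurable)) ?_ ?_
      · filter_upwards [h1] with t ht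
        rw [circleMap_zpow one_pos]
        simpa using ht
      · filter_upwards [h2] with t ht
        rw [circleMap_zpow q.2.1, mul_assoc]
        exact ht
    have h3 : inner ℂ k h = 0 := horth _ hmem
    rw [inner_eq] at h3
    rw [coef, coef, ← integral_const_mul]
    refine Eq.trans ?_ h3
    congr 1
    · refine integral_congr_ae ?_
      filter_upwards [h1] with t ht
      rw [ht, map_mul, conj_exp_int_phase]
      exact (mul_assoc _ _ _).symm
    · refine integral_congr_ae ?_
      filter_upwards [h2] with t ht
      rw [ht, map_mul, map_mul, conj_exp_int_phase, conj_exp_int_real]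
      ring
  obtain ⟨C1, hC1⟩ := b1.2
  obtain ⟨C2, hC2⟩ := b2.2
  -- The function `z ^ (m + α) / g` has index `-α + α = 0`; on the inner circle its bound carries
  -- the extra factor `q ^ (m + α)`.
  have hp := hi.exp_mul (neg_add_cancel α) m
  have hmain := integral_mul_add_eq_zero (L := Real.log q) (C := C1)
    (C' := ‖Complex.exp (((m + α : ℝ) : ℂ) * Real.log q)‖ * C2)
    hp.memLp_outer.star.1 hp.memLp_inner.star.1 ?_ ?_ hU hV (fun n ↦ ?_) hUV
  · refine Eq.trans ?_ hmain
    congr 1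
    · refine integral_congr_ae ?_
      filter_upwards [b1.1] with t ht
      have h5 : starRingEnd ℂ (G (circleMap 0 1 t)) ≠ 0 := (map_ne_zero _).2 ht
      simp only [Pi.star_apply, RCLike.star_def, map_mul, map_inv₀]
      field_simp
    · refine integral_congr_ae ?_
      filter_upwards [b2.1] with t ht
      have h5 : starRingEnd ℂ (G (circleMap 0 q t)) ≠ 0 := (map_ne_zero _).2 ht
      simp only [Pi.star_apply, RCLike.star_def, map_mul, map_inv₀]
      field_simp
  · filter_upwards [hC1] with t ht
    rw [Pi.star_apply, norm_star, norm_mul, norm_exp_phase, one_mul]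
    exact ht
  · filter_upwards [hC2] with t ht
    rw [Pi.star_apply, norm_star, norm_mul, norm_mul, norm_exp_phase, one_mul]
    exact mul_le_mul_of_nonneg_left ht (norm_nonneg _)
  · have h6 := congrArg (starRingEnd ℂ) (hp.coef_eq (-n))
    rw [map_mul, ← coef_conj, ← coef_conj, conj_exp_real] at h6
    refine h6.trans ?_
    congr 2
    push_cast
    ring

/-! ### Means of `log |g|` and the index. -/

/-- The bound `log t ≤ t - 1`, used for both quotients, trades the singularity of the logarithm for
reciprocals, which are controlled in `L²`. -/
theorem abs_log_sub_log_le {x y : ℂ} (hx : x ≠ 0) (hy : y ≠ 0) :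
    |Real.log ‖x‖ - Real.log ‖y‖| ≤ ‖x - y‖ * ‖x⁻¹‖ + ‖x - y‖ * ‖y⁻¹‖ := by
  have hx' := norm_pos_iff.2 hx
  have hy' := norm_pos_iff.2 hy
  have key : ∀ a b : ℂ, a ≠ 0 → b ≠ 0 → Real.log ‖a‖ - Real.log ‖b‖ ≤ ‖a - b‖ * ‖b⁻¹‖ := by
    intro a b ha hb
    have ha' := norm_pos_iff.2 ha
    have hb' := norm_pos_iff.2 hb
    rw [← Real.log_div ha'.ne' hb'.ne']
    refine (Real.log_le_sub_one_of_pos (by positivity)).trans ?_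
    rw [norm_inv, ← div_eq_mul_inv, div_sub_one hb'.ne']
    exact div_le_div_of_nonneg_right (norm_sub_norm_le a b) hb'.le
  have h1 := key x y hx hy
  have h2 := key y x hy hx
  rw [norm_sub_rev] at h2
  have p1 : 0 ≤ ‖x - y‖ * ‖x⁻¹‖ := by positivity
  have p2 : 0 ≤ ‖x - y‖ * ‖y⁻¹‖ := by positivity
  exact abs_le.2 ⟨by linarith, by linarith⟩

theorem integrable_log_norm {u : ℝ → ℂ} (hu : MemLp u 2 angleMeasure)
    (hu' : MemLp (fun t ↦ (u t)⁻¹) 2 angleMeasure) :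
    Integrable (fun t ↦ Real.log ‖u t‖) angleMeasure := by
  refine ((hu.integrable (by norm_num)).norm.add (hu'.integrable (by norm_num)).norm).mono'
    hu.1.norm.aemeasurable.log.aestronglyMeasurable (Eventually.of_forall fun t ↦ ?_)
  simp only [Pi.add_apply, norm_inv, Real.norm_eq_abs]
  have h1 := Real.log_le_self (norm_nonneg (u t))
  have h2 := Real.log_le_self (inv_nonneg.2 (norm_nonneg (u t)))
  rw [Real.log_inv] at h2
  have h3 := norm_nonneg (u t)
  have h4 := inv_nonneg.2 h3
  exact abs_le.2 ⟨by linarith, by linarith⟩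

/-- By `abs_log_sub_log_le` the difference of logarithms is dominated by `(f - u) h` and `(f - u) /
u`, both of which tend to zero in `L¹`. -/
theorem tendsto_integral_log {ι : Type*} {l : Filter ι} {f h : ι → ℝ → ℂ} {u : ℝ → ℂ}
    (hf : ∀ᶠ i in l, MemLp (f i) 2 angleMeasure) (hh : ∀ᶠ i in l, MemLp (h i) 2 angleMeasure)
    (hfh : ∀ᶠ i in l, ∀ t, f i t ≠ 0 ∧ h i t = (f i t)⁻¹)
    (hu : MemLp u 2 angleMeasure) (hu' : MemLp (fun t ↦ (u t)⁻¹) 2 angleMeasure)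
    (hu0 : ∀ᵐ t ∂angleMeasure, u t ≠ 0)
    (h₁ : Tendsto (fun i ↦ eLpNorm (fun t ↦ f i t - u t) 2 angleMeasure) l (𝓝 0))
    (h₂ : Tendsto (fun i ↦ eLpNorm (fun t ↦ h i t - (u t)⁻¹) 2 angleMeasure) l (𝓝 0)) :
    Tendsto (fun i ↦ ∫ t, Real.log ‖f i t‖ ∂angleMeasure) l
      (𝓝 (∫ t, Real.log ‖u t‖ ∂angleMeasure)) := by
  have hz : MemLp (fun _ : ℝ ↦ (0 : ℂ)) 2 angleMeasure := MemLp.zero'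
  have hd : ∀ᶠ i in l, MemLp (fun t ↦ f i t - u t) 2 angleMeasure := hf.mono fun i hi ↦ hi.sub hu
  have h₁' : Tendsto (fun i ↦ eLpNorm (fun t ↦ (f i t - u t) - 0) 2 angleMeasure) l (𝓝 0) := by
    simpa only [sub_zero] using h₁
  have c1 := tendsto_eLpNorm_one_mul hd hh hz hu' h₁' h₂
  have c2 := tendsto_eLpNorm_one_mul (g := fun _ t ↦ (u t)⁻¹) hd
    (Eventually.of_forall fun _ ↦ hu') hz hu' h₁'
    (by simp only [sub_self, eLpNorm_zero']; exact tendsto_const_nhds)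
  have c3 := c1.add c2
  simp only [zero_mul, sub_zero, add_zero] at c3
  refine tendsto_integral_of_L1' _ (integrable_log_norm hu hu').1 ?_ ?_
  · filter_upwards [hf, hh, hfh] with i h1 h2 h3
    refine integrable_log_norm h1 (h2.ae_eq (Eventually.of_forall fun t ↦ (h3 t).2))
  refine tendsto_of_tendsto_of_tendsto_of_le_of_le' tendsto_const_nhds c3
    (Eventually.of_forall fun _ ↦ zero_le) ?_
  filter_upwards [hd, hh, hfh] with i h1 h2 h3
  have e := eLpNorm_add_le (p := 1) (h1.1.mul h2.1).norm (h1.1.mul hu'.1).norm le_rfl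
  rw [eLpNorm_norm, eLpNorm_norm] at e
  refine le_trans (eLpNorm_mono_ae ?_) e
  filter_upwards [hu0] with t ht
  have := abs_log_sub_log_le (h3 t).1 ht
  simp only [Pi.sub_apply, Pi.add_apply, Pi.mul_apply, norm_mul, (h3 t).2, Real.norm_eq_abs]
  exact this.trans (le_abs_self _)

theorem isPreconnected_coverStrip (q : ℝ) : IsPreconnected (coverStrip q) :=
  ((convex_halfSpace_re_gt (Real.log q)).inter (convex_halfSpace_re_lt 0)).isPreconnected

theorem mem_coverStrip_add {q : ℝ} {w : ℂ} (hw : w ∈ coverStrip q) :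
    w + 2 * Real.pi * Complex.I ∈ coverStrip q := by
  simpa [coverStrip] using hw

theorem slice_mem_coverStrip {q s : ℝ} (hs : s ∈ Ioo (Real.log q) 0) (t : ℝ) :
    (s + t * Complex.I : ℂ) ∈ coverStrip q := by
  simpa [coverStrip] using hs

/-- The lifts of `g` and of `1 / g` are reciprocal. -/
theorem mul_eq_one_of_boundary {q : ℝ} (hq : q ∈ Ioo (0 : ℝ) 1) {α : ℝ} {F R : ℂ → ℂ}
    {u v : ℝ → ℂ} (hF : DifferentiableOn ℂ F (coverStrip q)) (hFα : HasIndex q F α)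
    (hR : DifferentiableOn ℂ R (coverStrip q)) (hRα : HasIndex q R (-α))
    (hu : MemLp u 2 angleMeasure) (hu' : MemLp (fun t ↦ (u t)⁻¹) 2 angleMeasure)
    (hFb : HasSliceLimits q F u v) (hRb : HasSliceLimits q R (fun t ↦ (u t)⁻¹) fun t ↦ (v t)⁻¹)
    (hu0 : ∀ᵐ t ∂angleMeasure, u t ≠ 0) {w : ℂ} (hw : w ∈ coverStrip q) : F w * R w = 1 := by
  have hL := Real.log_neg hq.1 hq.2
  have hp := Real.pi_pos
  have hFR : HasIndex q (fun w ↦ F w * R w) 0 := by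
    have := hFα.mul hRα
    rwa [add_neg_cancel] at this
  have hdiff : DifferentiableOn ℂ (fun w ↦ F w * R w) (coverStrip q) := hF.mul hR
  -- The boundary function `u · u⁻¹` is one almost everywhere, so the product of the lifts has the
  -- outer coefficients of the constant one.
  have hone : ∀ n : ℤ, coef 0 n (fun t ↦ u t * (u t)⁻¹) =
      if 0 = n then (2 * Real.pi : ℂ) else 0 := by
    intro n
    have h1 := coef_exp n 0
    rw [← h1]
    refine coef_congr ?_
    filter_upwards [hu0] with t ht
    simp [ht]
  -- Equal coefficients give equality almost everywhere on each slice, and continuity upgrades it to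
  -- all points of the open interval.
  have hslice : ∀ s ∈ Ioo (Real.log q) 0, ∀ t ∈ Ioo 0 (2 * Real.pi),
      F (s + t * Complex.I) * R (s + t * Complex.I) = 1 := by
    intro s hs
    have hc : Continuous fun t : ℝ ↦ F (s + t * Complex.I) * R (s + t * Complex.I) :=
      hdiff.continuousOn.comp_continuous (by fun_prop) (slice_mem_coverStrip hs)
    have hae : (fun t : ℝ ↦ F (s + t * Complex.I) * R (s + t * Complex.I)) =ᵐ[angleMeasure]
        fun _ ↦ (1 : ℂ) := by
      refine ae_eq_of_coef_eq ((memLp_of_continuous hc).integrable (by norm_num))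
        (integrable_const 1) fun n ↦ ?_
      have h1 := coef_slice_of_tendsto hq hdiff hFR
        (tendsto_coef_mul_outer hq hF hR hu hu' hFb hRb 0 n) hs
      rw [h1, hone]
      have h2 := coef_exp n 0
      simp only [Int.cast_zero, zero_mul, Complex.exp_zero] at h2
      rw [h2]
      split_ifs with h
      · rw [← h]
        simp
      · simp
    have hae' : (fun t : ℝ ↦ F (s + t * Complex.I) * R (s + t * Complex.I))
        =ᵐ[volume.restrict (Ioo 0 (2 * Real.pi))] fun _ ↦ (1 : ℂ) :=
      ae_mono (Measure.restrict_mono Ioo_subset_Ioc_self le_rfl) hae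
    exact Measure.eqOn_open_of_ae_eq hae' isOpen_Ioo hc.continuousOn continuousOn_const
  -- An open rectangle on which the product is already known to be one; the identity theorem spreads
  -- this over the strip.
  set U : Set ℂ := {z | (Real.log q < z.re ∧ z.re < 0) ∧ 0 < z.im ∧ z.im < 2 * Real.pi} with hU
  have hUo : IsOpen U := (isOpen_coverStrip q).inter
    ((isOpen_lt continuous_const Complex.continuous_im).inter
      (isOpen_lt Complex.continuous_im continuous_const))
  set w₀ : ℂ := ((Real.log q / 2 : ℝ) : ℂ) + Real.pi * Complex.I with hw₀
  have hw₀U : w₀ ∈ U := by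
    simp only [hU, hw₀, mem_ofPred_eq, Complex.add_re, Complex.ofReal_re, Complex.mul_re,
      Complex.I_re, mul_zero, Complex.ofReal_im, Complex.I_im, mul_one, sub_self, add_zero,
      Complex.add_im, Complex.mul_im, zero_add]
    refine ⟨⟨?_, ?_⟩, ?_, ?_⟩ <;> linarith
  refine (hdiff.analyticOnNhd (isOpen_coverStrip q)).eqOn_of_preconnected_of_eventuallyEq
    analyticOnNhd_const (isPreconnected_coverStrip q) (z₀ := w₀) hw₀U.1 ?_ hw
  filter_upwards [hUo.mem_nhds hw₀U] with z hz
  have := hslice z.re hz.1 z.im hz.2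
  rwa [Complex.re_add_im] at this

/-- A nonvanishing analytic function on the covering strip has an analytic logarithm. -/
theorem exists_log {q : ℝ} (hq : q ∈ Ioo (0 : ℝ) 1) {F : ℂ → ℂ}
    (hF : DifferentiableOn ℂ F (coverStrip q)) (h0 : ∀ w ∈ coverStrip q, F w ≠ 0) :
    ∃ Γ : ℂ → ℂ, DifferentiableOn ℂ Γ (coverStrip q) ∧
      ∀ w ∈ coverStrip q, Complex.exp (Γ w) = F w := by
  have hL := Real.log_neg hq.1 hq.2
  have hne : (coverStrip q).Nonempty :=
    ⟨_, slice_mem_coverStrip (s := Real.log q / 2) ⟨by linarith, by linarith⟩ 0⟩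
  have hconv : Convex ℝ (coverStrip q) :=
    (convex_halfSpace_re_gt (Real.log q)).inter (convex_halfSpace_re_lt 0)
  have hsc : IsSimplyConnected (coverStrip q) := by
    have := hconv.contractibleSpace hne
    exact SimplyConnectedSpace.ofContractible (coverStrip q)
  obtain ⟨Γ, hΓc, hΓ⟩ := Complex.exists_continuousOn_eqOn_exp_comp hsc (isOpen_coverStrip q)
    hF.continuousOn (by rintro ⟨w, hw, h⟩; exact h0 w hw h)
  refine ⟨Γ, fun w hw ↦ ?_, hΓ⟩
  have hnhds := (isOpen_coverStrip q).mem_nhds hw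
  have hFw : DifferentiableAt ℂ F w := hF.differentiableAt hnhds
  have hΓw : ContinuousAt Γ w := hΓc.continuousAt hnhds
  -- Near `w` the continuous logarithm coincides with the principal logarithm of `F z / F w`, a
  -- quotient close to one, up to an additive constant. This makes it analytic.
  have hdiff : DifferentiableAt ℂ (fun z ↦ Γ w + Complex.log (F z / F w)) w := by
    refine (DifferentiableAt.clog (hFw.div_const _) ?_).const_add _
    rw [div_self (h0 w hw)]
    exact Complex.one_mem_slitPlane
  refine (hdiff.congr_of_eventuallyEq ?_).differentiableWithinAt
  have hsmall : ∀ᶠ z in 𝓝 w, |(Γ z - Γ w).im| < Real.pi := by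
    have hc : ContinuousAt (fun z ↦ |(Γ z - Γ w).im|) w :=
      (Complex.continuous_im.continuousAt.comp (hΓw.sub continuousAt_const)).abs
    refine hc.eventually_lt continuousAt_const ?_
    simp [Real.pi_pos]
  filter_upwards [hsmall, hnhds] with z hz hzs
  have e1 : Complex.exp (Γ z) = F z := hΓ hzs
  have e2 : Complex.exp (Γ w) = F w := hΓ hw
  rw [← e1, ← e2, ← Complex.exp_sub, Complex.log_exp (abs_lt.1 hz).1 (abs_lt.1 hz).2.le]
  ring

/-- The change of a logarithm along one turn. -/
theorem exists_winding {q α : ℝ} {F Γ : ℂ → ℂ} (hα : HasIndex q F α)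
    (hΓ : DifferentiableOn ℂ Γ (coverStrip q))
    (he : ∀ w ∈ coverStrip q, Complex.exp (Γ w) = F w) :
    ∃ N : ℤ, ∀ w ∈ coverStrip q,
      Γ (w + 2 * Real.pi * Complex.I) = Γ w + 2 * Real.pi * Complex.I * (α + N) := by
  have hp : (2 * Real.pi * Complex.I : ℂ) ≠ 0 := Complex.two_pi_I_ne_zero
  -- `D` is continuous and integer valued on a connected set, hence a constant `N`.
  set D : ℂ → ℂ := fun w ↦ (Γ (w + 2 * Real.pi * Complex.I) - Γ w) / (2 * Real.pi * Complex.I) - α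
    with hD
  have hDint : ∀ w ∈ coverStrip q, ∃ n : ℤ, D w = n := by
    intro w hw
    have h1 : Complex.exp (Γ (w + 2 * Real.pi * Complex.I)) =
        Complex.exp (2 * Real.pi * Complex.I * α + Γ w) := by
      rw [he _ (mem_coverStrip_add hw), hα w hw, Complex.exp_add, he w hw]
    obtain ⟨n, hn⟩ := Complex.exp_eq_exp_iff_exists_int.1 h1
    refine ⟨n, ?_⟩
    simp only [hD]
    rw [hn]
    field_simp
    ring
  have hDc : ContinuousOn (fun w ↦ (D w).re) (coverStrip q) := by
    refine Complex.continuous_re.comp_continuousOn (((ContinuousOn.sub ?_ hΓ.continuousOn).div_const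
      _).sub continuousOn_const)
    exact hΓ.continuousOn.comp (by fun_prop) fun w hw ↦ mem_coverStrip_add hw
  have hDm : MapsTo (fun w ↦ (D w).re) (coverStrip q)
      (AddSubgroup.zmultiples (1 : ℝ) : Set ℝ) := by
    intro w hw
    obtain ⟨n, hn⟩ := hDint w hw
    refine ⟨n, ?_⟩
    simp [hn]
  rcases (coverStrip q).eq_empty_or_nonempty with hemp | ⟨w₀, hw₀⟩
  · exact ⟨0, fun w hw ↦ by rw [hemp] at hw; exact hw.elim⟩
  have : DiscreteTopology (AddSubgroup.zmultiples (1 : ℝ) : Set ℝ) :=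
    inferInstanceAs (DiscreteTopology (AddSubgroup.zmultiples (1 : ℝ)))
  obtain ⟨N, hN⟩ := hDint w₀ hw₀
  refine ⟨N, fun w hw ↦ ?_⟩
  have h1 := (isPreconnected_coverStrip q).constant_of_mapsTo ⟨this⟩ hDc hDm hw hw₀
  obtain ⟨n, hn⟩ := hDint w hw
  simp only [hN, hn, Complex.intCast_re, Int.cast_inj] at h1
  rw [h1] at hn
  simp only [hD] at hn
  rw [sub_eq_iff_eq_add, div_eq_iff hp] at hn
  linear_combination hn

/-- Subtracting `(α + N) w` makes the logarithm `2πi`-periodic, so by Cauchy's theorem its mean over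
a slice does not depend on `s`. The subtracted term contributes `(α + N) s` to the real part. -/
theorem integral_log_slice {q α : ℝ} {F Γ : ℂ → ℂ} {N : ℤ}
    (hΓ : DifferentiableOn ℂ Γ (coverStrip q))
    (he : ∀ w ∈ coverStrip q, Complex.exp (Γ w) = F w)
    (hN : ∀ w ∈ coverStrip q,
      Γ (w + 2 * Real.pi * Complex.I) = Γ w + 2 * Real.pi * Complex.I * (α + N)) :
    ∃ K : ℝ, ∀ s ∈ Ioo (Real.log q) 0,
      ∫ t : ℝ, Real.log ‖F (s + t * Complex.I)‖ ∂angleMeasure = K + 2 * Real.pi * (α + N) * s := by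
  set H : ℂ → ℂ := fun w ↦ Γ w - (α + N) * w with hH
  have hHd : DifferentiableOn ℂ H (coverStrip q) := hΓ.sub (by fun_prop)
  have hHi : HasIndex q H 0 := by
    intro w hw
    simp only [hH]
    rw [hN w hw]
    simp
    ring
  rcases (Ioo (Real.log q) 0).eq_empty_or_nonempty with hemp | ⟨s₀, hs₀⟩
  · exact ⟨0, fun s hs ↦ by rw [hemp] at hs; exact hs.elim⟩
  refine ⟨(∫ t : ℝ, H (s₀ + t * Complex.I) ∂angleMeasure).re, fun s hs ↦ ?_⟩
  have h1 := coef_slice_const hHd hHi 0 hs hs₀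
  simp only [coef, Int.cast_zero, add_zero, Complex.ofReal_zero, neg_zero, zero_mul,
    Complex.exp_zero, one_mul] at h1
  have hc : Continuous fun t : ℝ ↦ H (s + t * Complex.I) :=
    hHd.continuousOn.comp_continuous (by fun_prop) (slice_mem_coverStrip hs)
  have hi : Integrable (fun t : ℝ ↦ H (s + t * Complex.I)) angleMeasure :=
    (memLp_of_continuous hc).integrable (by norm_num)
  have e : ∀ t : ℝ, Real.log ‖F (s + t * Complex.I)‖ =
      (H (s + t * Complex.I)).re + (α + N) * s := by
    intro t
    rw [← he _ (slice_mem_coverStrip hs t), Complex.norm_exp, Real.log_exp]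
    simp [hH]
  have hre : ∫ t : ℝ, (H (s + t * Complex.I)).re ∂angleMeasure =
      (∫ t : ℝ, H (s + t * Complex.I) ∂angleMeasure).re :=
    Complex.reCLM.integral_comp_comm hi
  simp only [e]
  have hir : Integrable (fun t : ℝ ↦ (H (s + t * Complex.I)).re) angleMeasure := hi.re
  rw [integral_add hir (integrable_const _)]
  have hm : angleMeasure.real univ = 2 * Real.pi := by
    simp [angleMeasure, Real.pi_pos.le]
  rw [integral_const, hm, smul_eq_mul]
  refine (congrArg (· + _) (hre.trans (congrArg Complex.re h1))).trans ?_
  ring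

/-- The mean values of `log |g|` on the two circles for `g, 1 / g` of Hardy class determine the
index of `g` modulo one. -/
theorem exists_integral_log_sub {q : ℝ} (hq : q ∈ Ioo (0 : ℝ) 1) {α : ℝ} {u v : ℝ → ℂ}
    (h : IsHardyPair q α u v) (hi : IsHardyPair q (-α) (fun t ↦ (u t)⁻¹) fun t ↦ (v t)⁻¹)
    (hu0 : ∀ᵐ t ∂angleMeasure, u t ≠ 0) (hv0 : ∀ᵐ t ∂angleMeasure, v t ≠ 0) :
    ∃ N : ℤ, (∫ t, Real.log ‖v t‖ ∂angleMeasure) - ∫ t, Real.log ‖u t‖ ∂angleMeasure =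
      2 * Real.pi * (α + N) * Real.log q := by
  have hL := Real.log_neg hq.1 hq.2
  obtain ⟨F, hF, hFα, hFb⟩ := exists_lift hq h.memLp_outer h.memLp_inner h.coef_eq
  obtain ⟨R, hR, hRα, hRb⟩ := exists_lift hq hi.memLp_outer hi.memLp_inner hi.coef_eq
  have hFR : ∀ w ∈ coverStrip q, F w * R w = 1 := fun w hw ↦
    mul_eq_one_of_boundary hq hF hFα hR hRα h.memLp_outer hi.memLp_outer hFb hRb hu0 hw
  have hF0 : ∀ w ∈ coverStrip q, F w ≠ 0 := fun w hw h0 ↦ by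
    have := hFR w hw
    simp [h0] at this
  obtain ⟨Γ, hΓ, he⟩ := exists_log hq hF hF0
  obtain ⟨N, hN⟩ := exists_winding hFα hΓ he
  obtain ⟨K, hK⟩ := integral_log_slice hΓ he hN
  have hfh : ∀ s : ℝ, (∀ t : ℝ, (s + t * Complex.I : ℂ) ∈ coverStrip q) →
      ∀ t : ℝ, F (s + t * Complex.I) ≠ 0 ∧ R (s + t * Complex.I) = (F (s + t * Complex.I))⁻¹ :=
    fun s hs t ↦ ⟨hF0 _ (hs t), eq_inv_of_mul_eq_one_right (hFR _ (hs t))⟩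
  have t1 := tendsto_integral_log
    ((eventually_strip_zero hq).mono fun s hs ↦ memLp_slice_lift hF hs)
    ((eventually_strip_zero hq).mono fun s hs ↦ memLp_slice_lift hR hs)
    ((eventually_strip_zero hq).mono hfh) h.memLp_outer hi.memLp_outer hu0
    hFb.outer_circle hRb.outer_circle
  have t2 := tendsto_integral_log
    ((eventually_strip_log hq).mono fun s hs ↦ memLp_slice_lift hF hs)
    ((eventually_strip_log hq).mono fun s hs ↦ memLp_slice_lift hR hs)
    ((eventually_strip_log hq).mono hfh) h.memLp_inner hi.memLp_inner hv0
    hFb.inner_circle hRb.inner_circle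
  have hc : Continuous fun s : ℝ ↦ K + 2 * Real.pi * (α + N) * s := by fun_prop
  have e1 := tendsto_nhds_unique t1 (((hc.tendsto 0).mono_left nhdsWithin_le_nhds).congr' (by
    filter_upwards [Ioo_mem_nhdsLT hL] with s hs using (hK s hs).symm))
  have e2 := tendsto_nhds_unique t2 (((hc.tendsto (Real.log q)).mono_left
    nhdsWithin_le_nhds).congr' (by
      filter_upwards [Ioo_mem_nhdsGT hL] with s hs using (hK s hs).symm))
  refine ⟨N, ?_⟩
  rw [e1, e2]
  ring

/-! ### If `g` is outer and bounded below, then `1 / g` is of Hardy class. -/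

/-- The boundary values of a function in the annulus algebra satisfy the coefficient relation. -/
theorem coef_annulusAlgebra {q : ℝ} (hq : q ∈ Ioo (0 : ℝ) 1) {a : ℂ → ℂ}
    (ha : a ∈ annulusAlgebra q) (n : ℤ) :
    coef 0 n (fun t ↦ a (circleMap 0 q t)) = Complex.exp (((n + 0 : ℝ) : ℂ) * Real.log q) *
      coef 0 n (fun t ↦ a (circleMap 0 1 t)) := by
  have hL := Real.log_neg hq.1 hq.2
  have hexp : ∀ w ∈ coverStrip q, q < ‖Complex.exp w‖ ∧ ‖Complex.exp w‖ < 1 := by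
    intro w hw
    rw [Complex.norm_exp]
    exact ⟨(Real.log_lt_iff_lt_exp hq.1).1 hw.1, Real.exp_lt_one_iff.2 hw.2⟩
  have hF : DifferentiableOn ℂ (fun w ↦ a (Complex.exp w)) (coverStrip q) :=
    ha.2.comp Complex.differentiable_exp.differentiableOn hexp
  have hα : HasIndex q (fun w ↦ a (Complex.exp w)) 0 := by
    intro w _
    simp only
    rw [Complex.exp_add, Complex.exp_two_pi_mul_I]
    simp
  -- Clamping `s` to `[log q, 0]` extends the integrand continuously to all of `ℝ × ℝ`, so the
  -- coefficient depends continuously on `s` up to both circles.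
  set cl : ℝ → ℝ := fun s ↦ max (Real.log q) (min s 0) with hcl
  have hb : Continuous fun p : ℝ × ℝ ↦ a (Complex.exp (cl p.1 + p.2 * Complex.I)) := by
    refine ha.1.comp_continuous (by fun_prop) fun p ↦ ?_
    have h1 : ‖Complex.exp (cl p.1 + p.2 * Complex.I)‖ = Real.exp (cl p.1) := by
      rw [Complex.norm_exp]
      simp
    simp only [mem_ofPred_eq, h1]
    exact ⟨(Real.log_le_iff_le_exp hq.1).1 (le_max_left _ _),
      Real.exp_le_one_iff.2 (max_le hL.le (min_le_right _ _))⟩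
  have hcoef : Continuous fun s ↦ coef 0 n fun t ↦ a (Complex.exp (cl s + t * Complex.I)) := by
    have : ∀ s, (coef 0 n fun t ↦ a (Complex.exp (cl s + t * Complex.I))) =
        ∫ t in (0 : ℝ)..(2 * Real.pi), Complex.exp (-((n + 0 : ℝ) : ℂ) * t * Complex.I) *
          a (Complex.exp (cl s + t * Complex.I)) := by
      intro s
      rw [intervalIntegral.integral_of_le (by positivity)]
      rfl
    simp only [this]
    refine intervalIntegral.continuous_parametric_intervalIntegral_of_continuous' ?_ _ _
    exact Continuous.mul (by fun_prop) hb
  have hclm : ∀ s ∈ Ioo (Real.log q) 0, cl s = s := fun s hs ↦ by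
    simp only [hcl]
    rw [min_eq_left hs.2.le, max_eq_right hs.1.le]
  have hcl0 : cl 0 = 0 := by
    simp only [hcl]
    rw [min_self, max_eq_right hL.le]
  have hclL : cl (Real.log q) = Real.log q := by
    simp only [hcl]
    rw [min_eq_left hL.le, max_self]
  have c0 : ∀ t : ℝ, Complex.exp (cl 0 + t * Complex.I) = circleMap 0 1 t := by
    intro t
    rw [hcl0, circleMap]
    simp
  have cL : ∀ t : ℝ, Complex.exp (cl (Real.log q) + t * Complex.I) = circleMap 0 q t := by
    intro t
    rw [hclL, Complex.exp_add, ← Complex.ofReal_exp, Real.exp_log hq.1, circleMap, zero_add]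
  have t0 := (hcoef.tendsto 0).mono_left (nhdsWithin_le_nhds (s := Iio 0))
  have tL := (hcoef.tendsto (Real.log q)).mono_left (nhdsWithin_le_nhds (s := Ioi (Real.log q)))
  simp only [c0] at t0
  simp only [cL] at tL
  refine coef_relation_of_tendsto hq hF hα (t0.congr' ?_) (tL.congr' ?_)
  · filter_upwards [Ioo_mem_nhdsLT hL] with s hs
    rw [hclm s hs]
  · filter_upwards [Ioo_mem_nhdsGT hL] with s hs
    rw [hclm s hs]

theorem tendsto_coef_mul_inv {k : ℕ → ℝ → ℂ} {e u : ℝ → ℂ} {C : ℝ}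
    (hk : ∀ j, MemLp (k j) 2 angleMeasure) (he : MemLp e 2 angleMeasure)
    (hu : AEStronglyMeasurable u angleMeasure) (hC : ∀ᵐ t ∂angleMeasure, ‖(u t)⁻¹‖ ≤ C)
    (h : Tendsto (fun j ↦ eLpNorm (fun t ↦ k j t - e t) 2 angleMeasure) atTop (𝓝 0)) (α : ℝ)
    (n : ℤ) :
    Tendsto (fun j ↦ coef α n fun t ↦ k j t * (u t)⁻¹) atTop
      (𝓝 (coef α n fun t ↦ e t * (u t)⁻¹)) := by
  have hu' : MemLp (fun t ↦ (u t)⁻¹) 2 angleMeasure :=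
    MemLp.of_bound hu.aemeasurable.inv.aestronglyMeasurable C hC
  refine tendsto_coef_of_L1 α n (Eventually.of_forall fun j ↦ integrable_mul_of_memLp (hk j) hu')
    (integrable_mul_of_memLp he hu') ?_
  exact tendsto_eLpNorm_one_mul (g := fun _ t ↦ (u t)⁻¹) (Eventually.of_forall hk)
    (Eventually.of_forall fun _ ↦ hu') he hu' h
    (by simp only [sub_self, eLpNorm_zero']; exact tendsto_const_nhds)

/-- An outer function bounded away from zero on the boundary has its reciprocal in `H²_{-α}`. -/
theorem isHardyPair_inv_of_isOuter {q : Ioo (0 : ℝ) 1} {α : ℝ} {g : H2 q α}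
    (b1 : HasBoundedInv (fun t ↦ (g : BoundaryL2 q) (circleMap 0 1 t)))
    (b2 : HasBoundedInv (fun t ↦ (g : BoundaryL2 q) (circleMap 0 q t))) (ho : IsOuter g) :
    IsHardyPair q (-α) (fun t ↦ ((g : BoundaryL2 q) (circleMap 0 1 t))⁻¹)
      (fun t ↦ ((g : BoundaryL2 q) (circleMap 0 q t))⁻¹) := by
  refine ⟨b1.memLp (memLp_slice_one _).1, b2.memLp (memLp_slice_q _).1, fun n ↦ ?_⟩
  -- Outerness is used for the single function `z ^ α`: it is a limit of products `a j · g`, and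
  -- after division by `g` the coefficients of `a j` converge to those of `z ^ α / g`.
  obtain ⟨e, he, e1, e2⟩ := (isHardyPair_exp q α 0).exists_mem
  obtain ⟨k, hk, hlim⟩ := mem_closure_iff_seq_limit.1 (ho ⟨e, he⟩)
  choose a ha hka using hk
  have hlim' : Tendsto (fun j ↦ (k j : BoundaryL2 q)) atTop (𝓝 e) :=
    (continuous_subtype_val.tendsto _).comp hlim
  obtain ⟨C1, hC1⟩ := b1.2
  obtain ⟨C2, hC2⟩ := b2.2
  have t1 := tendsto_coef_mul_inv (fun j ↦ memLp_slice_one (k j : BoundaryL2 q))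
    (memLp_slice_one e) (memLp_slice_one (g : BoundaryL2 q)).1 hC1
    (tendsto_slices_of_tendsto hlim' (Measure.le_add_right le_rfl)) 0 n
  have t2 := tendsto_coef_mul_inv (fun j ↦ memLp_slice_q (k j : BoundaryL2 q))
    (memLp_slice_q e) (memLp_slice_q (g : BoundaryL2 q)).1 hC2
    (tendsto_slices_of_tendsto hlim' (Measure.le_add_left le_rfl)) 0 n
  have hrel : ∀ j, (coef 0 n fun t ↦ (k j : BoundaryL2 q) (circleMap 0 q t) *
      ((g : BoundaryL2 q) (circleMap 0 q t))⁻¹) = Complex.exp (((n + 0 : ℝ) : ℂ) * Real.log q) *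
      coef 0 n fun t ↦ (k j : BoundaryL2 q) (circleMap 0 1 t) *
      ((g : BoundaryL2 q) (circleMap 0 1 t))⁻¹ := by
    intro j
    have h1 : (fun t ↦ (k j : BoundaryL2 q) (circleMap 0 1 t) *
        ((g : BoundaryL2 q) (circleMap 0 1 t))⁻¹) =ᵐ[angleMeasure]
        fun t ↦ a j (circleMap 0 1 t) := by
      filter_upwards [ae_slice_one (hka j), b1.1] with t ht h0
      rw [ht, mul_assoc, mul_inv_cancel₀ h0, mul_one]
    have h2 : (fun t ↦ (k j : BoundaryL2 q) (circleMap 0 q t) *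
        ((g : BoundaryL2 q) (circleMap 0 q t))⁻¹) =ᵐ[angleMeasure]
        fun t ↦ a j (circleMap 0 q t) := by
      filter_upwards [ae_slice_q (hka j), b2.1] with t ht h0
      rw [ht, mul_assoc, mul_inv_cancel₀ h0, mul_one]
    rw [coef_congr h1, coef_congr h2]
    exact coef_annulusAlgebra q.2 (ha j) n
  have h3 := tendsto_nhds_unique t2 ((t1.const_mul _).congr fun j ↦ (hrel j).symm)
  have h4 : (coef 0 n fun t ↦ e (circleMap 0 1 t) * ((g : BoundaryL2 q) (circleMap 0 1 t))⁻¹) =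
      coef (-α) n fun t ↦ ((g : BoundaryL2 q) (circleMap 0 1 t))⁻¹ := by
    have := coef_exp_mul (neg_add_cancel α) n 0
      fun t ↦ ((g : BoundaryL2 q) (circleMap 0 1 t))⁻¹
    rw [sub_zero] at this
    rw [← this]
    refine coef_congr ?_
    filter_upwards [e1] with t ht
    rw [ht]
  have h5 : (coef 0 n fun t ↦ e (circleMap 0 q t) * ((g : BoundaryL2 q) (circleMap 0 q t))⁻¹) =
      Complex.exp (α * Real.log q) *
        coef (-α) n fun t ↦ ((g : BoundaryL2 q) (circleMap 0 q t))⁻¹ := by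
    have := coef_exp_mul (neg_add_cancel α) n 0
      fun t ↦ ((g : BoundaryL2 q) (circleMap 0 q t))⁻¹
    rw [sub_zero] at this
    rw [← this, ← coef_const_mul]
    refine coef_congr ?_
    filter_upwards [e2] with t ht
    rw [ht, mul_assoc]
    simp
  rw [h4, h5] at h3
  have h6 : Complex.exp (((n + -α : ℝ) : ℂ) * Real.log q) =
      Complex.exp (((n + 0 : ℝ) : ℂ) * Real.log q) * Complex.exp (-(α * Real.log q)) := by
    rw [← Complex.exp_add]
    congr 1
    push_cast
    ring
  rw [h6, mul_right_comm, ← h3, mul_right_comm, ← Complex.exp_add, add_neg_cancel, Complex.exp_zero,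
    one_mul]

/-! ### The index in terms of the symbol. -/

/-- Integrability of `log |φ|` on a circle where `φ |g|²` is a nonzero constant. -/
theorem log_symbol_of_mul_sq {r : ℝ} {f : ℂ → ℝ} (hf : Measurable f) {u : ℝ → ℂ} {d : ℝ}
    (hd : d ≠ 0) (hu : MemLp u 2 angleMeasure) (hu' : MemLp (fun t ↦ (u t)⁻¹) 2 angleMeasure)
    (hu0 : ∀ᵐ t ∂angleMeasure, u t ≠ 0)
    (h : ∀ᵐ t ∂angleMeasure, f (circleMap 0 r t) * ‖u t‖ ^ 2 = d) :
    Integrable (fun z ↦ Real.log |f z|) (circleMeasure r) ∧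
      ∫ z, Real.log |f z| ∂circleMeasure r =
        2 * Real.pi * Real.log |d| - 2 * ∫ t, Real.log ‖u t‖ ∂angleMeasure := by
  have hm : Measurable fun z ↦ Real.log |f z| := Real.measurable_log.comp hf.abs
  have e : (fun t ↦ Real.log |f (circleMap 0 r t)|) =ᵐ[angleMeasure]
      fun t ↦ Real.log |d| - 2 * Real.log ‖u t‖ := by
    filter_upwards [hu0, h] with t h0 ht
    have h1 : ‖u t‖ ≠ 0 := norm_ne_zero_iff.2 h0
    have h2 : |f (circleMap 0 r t)| ≠ 0 := abs_ne_zero.2 fun h2 ↦ hd (by rw [← ht, h2, zero_mul])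
    rw [← ht, abs_mul, abs_of_nonneg (sq_nonneg ‖u t‖), Real.log_mul h2 (pow_ne_zero 2 h1),
      Real.log_pow]
    push_cast
    ring
  have hi := (integrable_log_norm hu hu').const_mul 2
  have hic : Integrable (fun _ : ℝ ↦ Real.log |d|) angleMeasure := integrable_const _
  have hmass : angleMeasure.real univ = 2 * Real.pi := by
    simp [angleMeasure, Real.pi_pos.le]
  constructor
  · refine (integrable_map_measure hm.aestronglyMeasurable
      (continuous_circleMap 0 r).aemeasurable).2 ?_
    exact (hic.sub hi).congr e.symm
  · refine (integral_map (continuous_circleMap 0 r).aemeasurable hm.aestronglyMeasurable).trans ?_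
    rw [integral_congr_ae e, integral_sub hic hi, integral_const, hmass, smul_eq_mul,
      integral_const_mul]

/-- The logarithmic identity with `g, 1 / g` of Hardy class determines the index. -/
theorem exists_index_eq_logMean {q : Ioo (0 : ℝ) 1} {α : ℝ} {φ : Lp ℝ ∞ (boundaryMeasure q)}
    {g : H2 q α} {c : ℝ} (h : LogIdentity φ (g : BoundaryL2 q) c) (hc : c ≠ 0)
    (hi : IsHardyPair q (-α) (fun t ↦ ((g : BoundaryL2 q) (circleMap 0 1 t))⁻¹)
      (fun t ↦ ((g : BoundaryL2 q) (circleMap 0 q t))⁻¹)) :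
    Integrable (fun z ↦ Real.log |φ z|) (circleMeasure 1) ∧
    Integrable (fun z ↦ Real.log |φ z|) (circleMeasure q) ∧ ∃ k : ℤ, α = logMean φ + k := by
  have hL := (Real.log_neg q.2.1 q.2.2).ne
  have hd : c * Real.log q / 2 ≠ 0 := div_ne_zero (mul_ne_zero hc hL) two_ne_zero
  obtain ⟨b1, b2⟩ := h.hasBoundedInv hc
  obtain ⟨h1, h2⟩ := logIdentity_iff.1 h
  have hφ := (Lp.stronglyMeasurable φ).measurable
  obtain ⟨i1, e1⟩ := log_symbol_of_mul_sq hφ (neg_ne_zero.2 hd) (memLp_slice_one _)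
    hi.memLp_outer b1.1 h1
  obtain ⟨i2, e2⟩ := log_symbol_of_mul_sq hφ hd (memLp_slice_q _) hi.memLp_inner b2.1 h2
  obtain ⟨N, hN⟩ := exists_integral_log_sub q.2 (isHardyPair_slices g.2) hi b1.1 b2.1
  refine ⟨i1, i2, -N, ?_⟩
  have hp := Real.pi_ne_zero
  -- The constants on the two circles have the same absolute value, so their logarithms cancel in
  -- the difference.
  have e3 : (∫ z, Real.log |φ z| ∂circleMeasure 1) - ∫ z, Real.log |φ z| ∂circleMeasure q =
      2 * (2 * Real.pi * (α + N) * Real.log q) := by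
    rw [e1, e2, ← hN, abs_neg]
    ring
  rw [logMean, e3]
  push_cast
  field_simp
  ring

/-! ### Elements of the kernel: the logarithmic identity and proportionality. -/

/-- For `g` in the kernel, `φ |g|²` is constant on each boundary circle. -/
theorem exists_logIdentity {q : Ioo (0 : ℝ) 1} {α : ℝ} {φ : Lp ℝ ∞ (boundaryMeasure q)}
    {g : H2 q α} (hT : toeplitz q α φ g = 0) : ∃ c : ℝ, LogIdentity φ (g : BoundaryL2 q) c := by
  have hL := Real.log_neg q.2.1 q.2.2
  set G : BoundaryL2 q := (g : BoundaryL2 q) with hG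
  set f₁ : ℝ → ℝ := fun t ↦ φ (circleMap 0 1 t) * ‖G (circleMap 0 1 t)‖ ^ 2 with hf₁
  set f₂ : ℝ → ℝ := fun t ↦ φ (circleMap 0 q t) * ‖G (circleMap 0 q t)‖ ^ 2 with hf₂
  obtain ⟨K, hK⟩ := exists_ae_norm_le φ
  have hφm := (Lp.stronglyMeasurable φ).measurable
  have i1 : Integrable f₁ angleMeasure :=
    ((memLp_slice_one G).integrable_norm_pow two_ne_zero).bdd_mul
      (hφm.comp (continuous_circleMap 0 1).measurable).aestronglyMeasurable (ae_slice_one hK)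
  have i2 : Integrable f₂ angleMeasure :=
    ((memLp_slice_q G).integrable_norm_pow two_ne_zero).bdd_mul
      (hφm.comp (continuous_circleMap 0 q).measurable).aestronglyMeasurable (ae_slice_q hK)
  set A : ℤ → ℂ := fun n ↦ coef 0 n fun t ↦ (f₁ t : ℂ) with hA
  set B : ℤ → ℂ := fun n ↦ coef 0 n fun t ↦ (f₂ t : ℂ) with hB
  have hrel : ∀ n : ℤ, A n + Complex.exp (n * Real.log q) * B n = 0 := by
    intro n
    obtain ⟨k, hk, h1, h2⟩ := exists_zpow_mul g.2 n
    have h3 := toeplitz_eq_zero_iff.1 hT k hk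
    rw [inner_mulSymbol] at h3
    refine Eq.trans ?_ h3
    have esq : ∀ (x y z : ℂ) (f : ℝ),
        x * (z * starRingEnd ℂ y) * (f * y) = x * (z * ((f * ‖y‖ ^ 2 : ℝ) : ℂ)) := by
      intro x y z f
      push_cast
      rw [← Complex.conj_mul']
      ring
    simp only [hA, hB]
    rw [coef, coef, ← integral_const_mul]
    congr 1
    · refine integral_congr_ae ?_
      filter_upwards [h1] with t ht
      have := esq 1 (G (circleMap 0 1 t))
        (Complex.exp (-((n + 0 : ℝ) : ℂ) * t * Complex.I)) (φ (circleMap 0 1 t))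
      rw [one_mul, one_mul] at this
      rw [ht, map_mul, conj_exp_int_phase]
      exact this.symm
    · refine integral_congr_ae ?_
      filter_upwards [h2] with t ht
      rw [ht, map_mul, map_mul, conj_exp_int_phase, conj_exp_int_real]
      exact (esq _ _ _ _).symm
  -- Conjugating the relation of order `-n` keeps the same unknowns, since `f₁` and `f₂` are real,
  -- but replaces `q ^ n` by `q ^ (-n)`.
  have hrel' : ∀ n : ℤ, A n + Complex.exp (-(n * Real.log q)) * B n = 0 := by
    intro n
    have h1 := congrArg (starRingEnd ℂ) (hrel (-n))
    simp only [hA, hB, map_add, map_mul, conj_coef_ofReal, neg_neg, map_zero] at h1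
    rw [← Complex.exp_conj] at h1
    simpa [hA, hB] using h1
  -- Subtraction leaves the factor `2 sinh (n log q)`, nonzero for `n ≠ 0`.
  have hB0 : ∀ n : ℤ, n ≠ 0 → B n = 0 := by
    intro n hn
    have h1 : (Complex.exp (n * Real.log q) - Complex.exp (-(n * Real.log q))) * B n = 0 := by
      linear_combination hrel n - hrel' n
    refine (mul_eq_zero.1 h1).resolve_left fun h2 ↦ ?_
    have h3 : Real.exp (n * Real.log q) = Real.exp (-(n * Real.log q)) := by
      have := sub_eq_zero.1 h2
      exact_mod_cast this
    have h4 : (n : ℝ) * Real.log q = 0 := by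
      have := Real.exp_injective h3
      linarith
    exact (mul_ne_zero (by exact_mod_cast hn) hL.ne) h4
  have hA0 : ∀ n : ℤ, n ≠ 0 → A n = 0 := by
    intro n hn
    have := hrel n
    rwa [hB0 n hn, mul_zero, add_zero] at this
  have hconst : ∀ f : ℝ → ℝ, Integrable f angleMeasure →
      (∀ n : ℤ, n ≠ 0 → coef 0 n (fun t ↦ (f t : ℂ)) = 0) →
      ∀ᵐ t ∂angleMeasure, f t = (2 * Real.pi)⁻¹ * ∫ t, f t ∂angleMeasure := by
    intro f hf h0
    have hp : (Real.pi : ℂ) ≠ 0 := by exact_mod_cast Real.pi_ne_zero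
    have h1 : (fun t ↦ (f t : ℂ)) =ᵐ[angleMeasure]
        fun _ ↦ (((2 * Real.pi)⁻¹ * ∫ t, f t ∂angleMeasure : ℝ) : ℂ) := by
      refine ae_eq_of_coef_eq hf.ofReal (integrable_const _) fun n ↦ ?_
      have h2 := coef_const_mul 0 n (((2 * Real.pi)⁻¹ * ∫ t, f t ∂angleMeasure : ℝ) : ℂ) fun _ ↦ 1
      have h3 := coef_exp n 0
      simp only [Int.cast_zero, zero_mul, Complex.exp_zero] at h3
      simp only [mul_one] at h2
      rw [h2, h3]
      split_ifs with hn
      · subst hn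
        rw [coef]
        simp only [Int.cast_zero, add_zero, Complex.ofReal_zero, neg_zero, zero_mul,
          Complex.exp_zero, one_mul]
        rw [integral_complex_ofReal]
        push_cast
        field_simp
      · rw [h0 n (Ne.symm hn), mul_zero]
    filter_upwards [h1] with t ht
    exact_mod_cast ht
  have hsum : (∫ t, f₁ t ∂angleMeasure) + ∫ t, f₂ t ∂angleMeasure = 0 := by
    have h1 := hrel 0
    simp only [hA, hB, coef, Int.cast_zero, add_zero, Complex.ofReal_zero, neg_zero, zero_mul,
      Complex.exp_zero, one_mul] at h1
    rw [integral_complex_ofReal, integral_complex_ofReal] at h1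
    exact_mod_cast h1
  -- The constant is fixed by requiring `c (log q) / 2` to be the mean of `f₂`; `hsum` then supplies
  -- the opposite value on the outer circle.
  refine ⟨2 / Real.log q * ((2 * Real.pi)⁻¹ * ∫ t, f₂ t ∂angleMeasure),
    logIdentity_iff.2 ⟨?_, ?_⟩⟩
  · filter_upwards [hconst f₁ i1 hA0] with t ht
    refine ht.trans ?_
    rw [eq_neg_of_add_eq_zero_left hsum]
    have := hL.ne
    field_simp
  · filter_upwards [hconst f₂ i2 hB0] with t ht
    refine ht.trans ?_
    have := hL.ne
    field_simp

/-- For `c = 0` the identity says `φ g = 0`, which the uniqueness theorem excludes. -/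
theorem ne_zero_of_logIdentity {q : Ioo (0 : ℝ) 1} {α : ℝ} {φ : Lp ℝ ∞ (boundaryMeasure q)}
    (hφ : φ ≠ 0) {g : H2 q α} (hg : g ≠ 0) {c : ℝ} (h : LogIdentity φ (g : BoundaryL2 q) c) :
    c ≠ 0 := by
  rintro rfl
  obtain ⟨h1, h2⟩ := logIdentity_iff.1 h
  refine hg (Subtype.ext (eq_zero_of_mulSymbol_eq_zero hφ g.2 (mulSymbol_eq_zero_iff.2 ⟨?_, ?_⟩)))
  · filter_upwards [h1] with t ht
    simpa using ht
  · filter_upwards [h2] with t ht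
    simpa using ht

/-- The multiples of zero reduce to zero, which is not dense because `H²_α` contains `z ^ α`. -/
theorem ne_zero_of_isOuter {q : Ioo (0 : ℝ) 1} {α : ℝ} {g : H2 q α} (ho : IsOuter g) : g ≠ 0 := by
  rintro rfl
  have hsub : {k : H2 q α | ∃ a ∈ annulusAlgebra q,
      ∀ᵐ z ∂boundaryMeasure q, (k : BoundaryL2 q) z = a z * ((0 : H2 q α) : BoundaryL2 q) z} ⊆
      {0} := by
    rintro k ⟨a, -, hk⟩
    refine Subtype.ext (Lp.ext ?_)
    filter_upwards [hk, Lp.coeFn_zero ℂ 2 (boundaryMeasure q)] with z h1 h2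
    have h3 : ((0 : H2 q α) : BoundaryL2 q) z = 0 := h2
    rw [h1, h3, mul_zero]
  obtain ⟨e, he, e1, -⟩ := (isHardyPair_exp q α 0).exists_mem
  have h1 : (⟨e, he⟩ : H2 q α) ∈ closure {(0 : H2 q α)} := closure_mono hsub (ho _)
  rw [closure_singleton, mem_singleton_iff] at h1
  have h2 : e = 0 := congrArg Subtype.val h1
  have h3 : ∀ᵐ t ∂angleMeasure, False := by
    filter_upwards [e1, ae_slice_one (Lp.coeFn_zero ℂ 2 (boundaryMeasure q))] with t h4 h5
    rw [h2, h5] at h4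
    exact Complex.exp_ne_zero _ h4.symm
  rw [eventually_false_iff_eq_bot, ae_eq_bot, angleMeasure, Measure.restrict_eq_zero,
    Real.volume_Ioc, ENNReal.ofReal_eq_zero] at h3
  linarith [Real.pi_pos]

/-- The index in `[0, 1)` of a lift of a nonzero function is unique. -/
theorem index_unique {q : Ioo (0 : ℝ) 1} {α β : ℝ} (hα : α ∈ Ico (0 : ℝ) 1)
    (hβ : β ∈ Ico (0 : ℝ) 1) {F : ℂ → ℂ} {g : BoundaryL2 q} (hg : g ≠ 0)
    (hF : IsHardyLift q α F g) (hFβ : HasIndex q F β) : β = α := by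
  have hL := Real.log_neg q.2.1 q.2.2
  -- A lift vanishing throughout the strip would have zero boundary values; at a point where it does
  -- not vanish the two index factors can be compared.
  obtain ⟨w, hw, hw0⟩ : ∃ w ∈ coverStrip q, F w ≠ 0 := by
    by_contra! hcon
    have hmem : g ∈ H2 q α := ⟨F, hF⟩
    refine hg (eq_zero_of_coef_outer hmem fun n ↦ ?_)
    have h1 := tendsto_coef α n ((eventually_strip_zero q.2).mono fun s hs ↦
      memLp_slice_lift hF.analytic hs) (memLp_slice_one g) hF.boundary.outer_circle
    refine tendsto_nhds_unique h1 (tendsto_const_nhds.congr' ?_)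
    filter_upwards [eventually_strip_zero q.2] with s hs
    simp [coef, hcon _ (hs _)]
  have h1 := (hF.hasIndex w hw).symm.trans (hFβ w hw)
  obtain ⟨n, hn⟩ := Complex.exp_eq_exp_iff_exists_int.1 (mul_right_cancel₀ hw0 h1)
  have h2 : (α : ℂ) = β + n := by
    refine mul_left_cancel₀ Complex.two_pi_I_ne_zero ?_
    rw [hn]
    ring
  have h3 : α = β + n := by exact_mod_cast h2
  have h4 : (n : ℝ) < 1 := by linarith [hα.2, hβ.1]
  have h5 : (-1 : ℝ) < n := by linarith [hα.1, hβ.2]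
  have h6 : n < 1 := by exact_mod_cast h4
  have h7 : -1 < n := by exact_mod_cast h5
  have h8 : n = 0 := by omega
  rw [h3, h8]
  simp

/-- Polarization: the numbers `f |x|²`, `f |y|²`, `f |y - x|²`, `f |y - i x|²` determine the real
and imaginary parts of `y / x`. -/
theorem eq_of_mul_sq_eq {f a b c d : ℝ} {x y : ℂ} (ha : a ≠ 0) (h1 : f * ‖x‖ ^ 2 = a)
    (h2 : f * ‖y‖ ^ 2 = b) (h3 : f * ‖y - x‖ ^ 2 = c) (h4 : f * ‖y - Complex.I * x‖ ^ 2 = d) :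
    y = ((a + b - c) / (2 * a) + (a + b - d) / (2 * a) * Complex.I) * x := by
  have hf : f ≠ 0 := fun h ↦ ha (by rw [← h1, h, zero_mul])
  have hx : x ≠ 0 := fun h ↦ ha (by rw [← h1, h]; simp)
  have hn : (x.re ^ 2 + x.im ^ 2) ≠ 0 := by
    intro h
    refine hx (Complex.ext ?_ ?_)
    · simpa using (by nlinarith [sq_nonneg x.re, sq_nonneg x.im] : x.re ^ 2 = 0)
    · simpa using (by nlinarith [sq_nonneg x.re, sq_nonneg x.im] : x.im ^ 2 = 0)
  simp only [Complex.sq_norm, Complex.normSq_apply, Complex.sub_re, Complex.sub_im, Complex.mul_re,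
    Complex.mul_im, Complex.I_re, Complex.I_im, zero_mul, one_mul, zero_sub, zero_add]
    at h1 h2 h3 h4
  have e1 : (a + b - c) / (2 * a) = (y.re * x.re + y.im * x.im) / (x.re ^ 2 + x.im ^ 2) := by
    rw [div_eq_div_iff (by simpa using ha) hn, ← h1, ← h2, ← h3]
    ring
  have e2 : (a + b - d) / (2 * a) = (y.im * x.re - y.re * x.im) / (x.re ^ 2 + x.im ^ 2) := by
    rw [div_eq_div_iff (by simpa using ha) hn, ← h1, ← h2, ← h4]
    ring
  have e : ((a + b - c) / (2 * a) + (a + b - d) / (2 * a) * Complex.I : ℂ) =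
      (((a + b - c) / (2 * a) : ℝ) : ℂ) + (((a + b - d) / (2 * a) : ℝ) : ℂ) * Complex.I := by
    push_cast
    ring
  rw [e, e1, e2]
  apply Complex.ext
  · simp only [Complex.mul_re, Complex.add_re, Complex.ofReal_re, Complex.ofReal_im, Complex.I_re,
      Complex.I_im, Complex.add_im, Complex.mul_im]
    field_simp
    ring
  · simp only [Complex.mul_re, Complex.add_re, Complex.ofReal_re, Complex.ofReal_im, Complex.I_re,
      Complex.I_im, Complex.add_im, Complex.mul_im]
    field_simp
    ring

/-- Two elements of the kernel are proportional. -/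
theorem mem_span_of_toeplitz {q : Ioo (0 : ℝ) 1} {α : ℝ} {φ : Lp ℝ ∞ (boundaryMeasure q)}
    (hφ : φ ≠ 0) {g h : H2 q α} (hg : g ≠ 0) (hTg : toeplitz q α φ g = 0)
    (hTh : toeplitz q α φ h = 0) : h ∈ Submodule.span ℂ {g} := by
  have hL := (Real.log_neg q.2.1 q.2.2).ne
  obtain ⟨a, ha⟩ := exists_logIdentity hTg
  obtain ⟨b, hb⟩ := exists_logIdentity hTh
  -- Polarization needs the identity for `h - g` and `h - i g`, which lie in the kernel by
  -- linearity.
  obtain ⟨c, hc⟩ := exists_logIdentity (g := h - g) (by rw [map_sub, hTg, hTh, sub_zero])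
  obtain ⟨d, hd⟩ := exists_logIdentity (g := h - Complex.I • g)
    (by rw [map_sub, map_smul, hTg, hTh, smul_zero, sub_zero])
  have ha0 := ne_zero_of_logIdentity hφ hg ha
  have hsub : ∀ᵐ z ∂boundaryMeasure q, ((h - g : H2 q α) : BoundaryL2 q) z =
      (h : BoundaryL2 q) z - (g : BoundaryL2 q) z := by
    filter_upwards [Lp.coeFn_sub (h : BoundaryL2 q) (g : BoundaryL2 q)] with z hz using hz
  have hsub' : ∀ᵐ z ∂boundaryMeasure q, ((h - Complex.I • g : H2 q α) : BoundaryL2 q) z =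
      (h : BoundaryL2 q) z - Complex.I * (g : BoundaryL2 q) z := by
    filter_upwards [Lp.coeFn_sub (h : BoundaryL2 q) (Complex.I • (g : BoundaryL2 q)),
      Lp.coeFn_smul Complex.I (g : BoundaryL2 q)] with z hz hz'
    rw [Submodule.coe_sub, Submodule.coe_smul, hz, Pi.sub_apply, hz']
    rfl
  have hl : ∀ᵐ z ∂boundaryMeasure q, Real.log ‖z * (((q : ℝ) ^ (-(1 / 2) : ℝ) : ℝ) : ℂ)‖ ≠ 0 := by
    have hq : (0 : ℝ) < q := q.2.1
    have hr : (0 : ℝ) < (q : ℝ) ^ (-(1 / 2) : ℝ) := Real.rpow_pos_of_pos hq _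
    refine ae_boundary_of_slices ?_ (Eventually.of_forall fun t ↦ ?_)
      (Eventually.of_forall fun t ↦ ?_)
    · exact (measurableSet_eq_fun
        (Real.measurable_log.comp (measurable_id.mul_const _).norm) measurable_const).compl
    · rw [norm_mul, norm_circleMap_zero, abs_one, one_mul, Complex.norm_real,
        Real.norm_of_nonneg hr.le, Real.log_rpow hq]
      exact mul_ne_zero (by norm_num) hL
    · rw [norm_mul, norm_circleMap_zero, abs_of_pos hq, Complex.norm_real,
        Real.norm_of_nonneg hr.le, Real.log_mul hq.ne' hr.ne', Real.log_rpow hq]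
      intro h0
      exact hL (by linarith)
  -- All four weighted squares are real multiples of one and the same logarithm, nonzero almost
  -- everywhere by `hl`. It cancels, so the ratio is independent of `z`, including across the two
  -- circles.
  set κ : ℂ := (a + b - c) / (2 * a) + (a + b - d) / (2 * a) * Complex.I with hκ
  refine Submodule.mem_span_singleton.2 ⟨κ, Subtype.ext (Lp.ext ?_)⟩
  filter_upwards [ha, hb, hc, hd, hsub, hsub', hl,
    Lp.coeFn_smul κ (g : BoundaryL2 q)] with z h1 h2 h3 h4 h5 h6 h7 h8
  rw [h5] at h3
  rw [h6] at h4
  have h9 := eq_of_mul_sq_eq (mul_ne_zero ha0 h7) h1 h2 h3 h4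
  rw [Submodule.coe_smul, h8, Pi.smul_apply, smul_eq_mul, h9, hκ]
  congr 1
  have h10 : ((Real.log ‖z * (((q : ℝ) ^ (-(1 / 2) : ℝ) : ℝ) : ℂ)‖ : ℝ) : ℂ) ≠ 0 := by
    exact_mod_cast h7
  have h11 : (a : ℂ) ≠ 0 := by exact_mod_cast ha0
  push_cast
  field_simp

end SarasonAnnulus

end

/-! ### Assembly of the theorem. -/

theorem theorem2p1 (q : Set.Ioo (0 : ℝ) 1)
    (φ : Lp ℝ ∞ (SarasonAnnulus.boundaryMeasure q)) (hφ : φ ≠ 0) :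
    -- nonzero elements of the kernel are outer and satisfy the identity
    (∀ α ∈ Ico (0 : ℝ) 1, ∀ g : SarasonAnnulus.H2 q α, g ≠ 0 →
      SarasonAnnulus.toeplitz q α φ g = 0 →
        SarasonAnnulus.IsOuter g ∧ ∃ c : ℝ, c ≠ 0 ∧ SarasonAnnulus.LogIdentity φ g c) ∧
    -- conversely, outer functions with the identity lie in the kernel, and `α`, the index of `g`,
    -- is determined modulo one by `φ`
    (∀ α ∈ Ico (0 : ℝ) 1, ∀ g : SarasonAnnulus.H2 q α, SarasonAnnulus.IsOuter g →
      ∀ c : ℝ, SarasonAnnulus.LogIdentity φ g c →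
        SarasonAnnulus.toeplitz q α φ g = 0 ∧
        (∀ F : ℂ → ℂ, SarasonAnnulus.IsHardyLift q α F g →
          ∀ β ∈ Ico (0 : ℝ) 1, SarasonAnnulus.HasIndex q F β → β = α) ∧
        Integrable (fun z ↦ Real.log |φ z|) (SarasonAnnulus.circleMeasure 1) ∧
        Integrable (fun z ↦ Real.log |φ z|) (SarasonAnnulus.circleMeasure q) ∧
        ∃ k : ℤ, α = SarasonAnnulus.logMean φ + k) ∧
    -- at most one `α` has eigenvalue `0`, and its eigenspace is at most one-dimensional
    (∀ α ∈ Ico (0 : ℝ) 1, ∀ β ∈ Ico (0 : ℝ) 1,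
      Module.End.HasEigenvalue (SarasonAnnulus.toeplitz q α φ).toLinearMap 0 →
      Module.End.HasEigenvalue (SarasonAnnulus.toeplitz q β φ).toLinearMap 0 → α = β) ∧
    (∀ α ∈ Ico (0 : ℝ) 1,
      Module.rank ℂ (Module.End.eigenspace (SarasonAnnulus.toeplitz q α φ).toLinearMap 0) ≤ 1) := by
  have kernel : ∀ {α : ℝ} {g : SarasonAnnulus.H2 q α}, g ≠ 0 → SarasonAnnulus.toeplitz q α φ g = 0 →
      ∃ c : ℝ, c ≠ 0 ∧ SarasonAnnulus.LogIdentity φ (g : SarasonAnnulus.BoundaryL2 q) c := by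
    intro α g hg hT
    obtain ⟨c, hc⟩ := SarasonAnnulus.exists_logIdentity hT
    exact ⟨c, SarasonAnnulus.ne_zero_of_logIdentity hφ hg hc, hc⟩
  have index : ∀ {α : ℝ}, Module.End.HasEigenvalue (SarasonAnnulus.toeplitz q α φ).toLinearMap 0 →
      ∃ k : ℤ, α = SarasonAnnulus.logMean φ + k := by
    intro α hα
    obtain ⟨g, hg⟩ := hα.exists_hasEigenvector
    have hT : SarasonAnnulus.toeplitz q α φ g = 0 := by
      have := hg.apply_eq_smul
      rwa [zero_smul] at this
    obtain ⟨c, hc0, hc⟩ := kernel hg.2 hT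
    exact (SarasonAnnulus.exists_index_eq_logMean hc hc0
      (SarasonAnnulus.isHardyPair_inv_of_toeplitz hc hc0 hT)).2.2
  refine ⟨fun α _ g hg hT ↦ ?_, fun α hα g ho c hc ↦ ?_, fun α hα β hβ h h' ↦ ?_, fun α _ ↦ ?_⟩
  · obtain ⟨c, hc0, hc⟩ := kernel hg hT
    obtain ⟨b1, b2⟩ := hc.hasBoundedInv hc0
    exact ⟨SarasonAnnulus.isOuter_of_isHardyPair_inv b1 b2
      (SarasonAnnulus.isHardyPair_inv_of_toeplitz hc hc0 hT), c, hc0, hc⟩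
  · have hg := SarasonAnnulus.ne_zero_of_isOuter ho
    have hc0 := SarasonAnnulus.ne_zero_of_logIdentity hφ hg hc
    obtain ⟨b1, b2⟩ := hc.hasBoundedInv hc0
    have hi := SarasonAnnulus.isHardyPair_inv_of_isOuter b1 b2 ho
    refine ⟨SarasonAnnulus.toeplitz_eq_zero_of_isHardyPair_inv hc hc0 hi, fun F hF β hβ hFβ ↦ ?_,
      SarasonAnnulus.exists_index_eq_logMean hc hc0 hi⟩
    exact SarasonAnnulus.index_unique hα hβ (fun h0 ↦ hg (Subtype.ext h0)) hF hFβ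
  · obtain ⟨k, hk⟩ := index h
    obtain ⟨k', hk'⟩ := index h'
    -- Both indices differ from `logMean φ` by integers and lie in `[0, 1)`, so the two integers
    -- coincide.
    have h1 : ((k - k' : ℤ) : ℝ) < 1 := by
      push_cast
      linarith [hα.2, hβ.1]
    have h2 : (-1 : ℝ) < ((k - k' : ℤ) : ℝ) := by
      push_cast
      linarith [hα.1, hβ.2]
    have h3 : k - k' < 1 := by exact_mod_cast h1
    have h4 : -1 < k - k' := by exact_mod_cast h2
    have h5 : k = k' := by omega
    rw [hk, hk', h5]
  · rw [rank_submodule_le_one_iff']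
    -- A nonzero element of the kernel spans it; if there is none, the zero vector serves as
    -- generator.
    by_cases hE : ∃ g : SarasonAnnulus.H2 q α, g ≠ 0 ∧ SarasonAnnulus.toeplitz q α φ g = 0
    · obtain ⟨g, hg, hT⟩ := hE
      refine ⟨g, fun h hh ↦ SarasonAnnulus.mem_span_of_toeplitz hφ hg hT ?_⟩
      have := Module.End.mem_eigenspace_iff.1 hh
      rwa [zero_smul] at this
    · push Not at hE
      refine ⟨0, fun h hh ↦ ?_⟩
      have := Module.End.mem_eigenspace_iff.1 hh
      rw [zero_smul] at this
      by_contra h0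
      exact hE h (fun h1 ↦ h0 (by rw [h1]; exact Submodule.zero_mem _)) this
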